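/- **Theorem 2.3 (Goldston–Yıldırım for function fields).** Let $\mathbf F_q$ be a finite field with $q$ elements, let $k\ge 1$ be an integer and $K=q^k$. *Notation.* $\mathbf G_N$ is the set of polynomials in $\mathbf F_q[t]$ of degree $<N$ (including $0$); $|f|=q^{\deg f}$ for $f\neq 0$; $\mathcal P$ is the set of all irreducible polynomials in $\mathbf F_q[t]$. For $\mathcal A\subset\mathcal P$ the relative upper density is $\overline d_{\mathcal P}(\mathcal A)=\limsup_{N\to\infty}\#\{f\in\mathcal A:\deg f<N\}/\#\{f\in\mathcal P:\deg f<N\}$. For each $N\ge 1$ a monic irreducible polynomial $f_N$ of degree $N$ is fixed, and $\mathbf F_{q^N}$ denotes $\mathbf G_N$ with addition and multiplication modulo $f_N$. $\mathbb E$ denotes the average over a finite set. *Pseudorandom measures.* A measure is a family $\nu=(\nu_N)_{N\ge1}$ of functions $\nu_N:\mathbf F_{q^N}\to[0,\infty)$. It is ($k$-)pseudorandom if the following two conditions hold. (a) (Linear forms.) For $m\le K2^{K-1}$ affine forms $\psi_i(\mathbf x)=\sum_{j=1}^n L_{ij}x_j+b_i$ in $n\le 3K-4$ variables, where each $L_{ij}$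 is a quotient $a/g$ with $a,g\in\mathbf G_k$, $g\ne0$ (read in $\mathbf F_{q^N}$ for $N\ge k$), the vectors $(L_{ij})_j$ are nonzero and pairwise not proportional over $\mathbf F_q(t)$, and $b_i\in\mathbf F_{q^N}$ is arbitrary, $$\mathbb E\big(\nu_N(\psi_1(\mathbf x))\cdots\nu_N(\psi_m(\mathbf x))\,\big|\,\mathbf x\in\mathbf F_{q^N}^n\big)=1+o(1)\qquad(N\to\infty),$$ uniformly in all these data. (b) (Correlation.) There are functions $\tau_N:\mathbf F_{q^N}\to[0,\infty)$ such that for every real $p>1$ the averages $\mathbb E(\tau_N(x)^p\mid x\in\mathbf F_{q^N})$ are bounded uniformly in $N$, and such that for all $N\ge 1$, all $2\le l\le 2^{K-1}$ and all (not necessarily distinct) $h_1,\dots,h_l\in\mathbf F_{q^N}$ $$\mathbb E\big(\nu_N(x+h_1)\cdots\nu_N(x+h_l)\,\big|\,x\in\mathbf F_{q^N}\big)\le\sum_{1\le i<j\le l}\tau_N(h_i-h_j).$$ *Truncated divisor sums.* For $\chi:\mathbf R\to\mathbf R$ and $R>0$ put $\Lambda_R(f)=\sum \mu(d)\,\chi(\deg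 d/R)$, where the sum is over the monic divisors $d$ of $f$ with $\deg d<R$ and $\mu$ is the Möbius function of $\mathbf F_q[t]$. $\Phi(W)$ is the number of polynomials of degree $<\deg W$ that are coprime to $W$. *Statement.* There are a real $\alpha>0$, a smooth $\chi:\mathbf R\to\mathbf R$ supported on $[-1,1]$ with $\chi(0)>0$ and $\int_0^\infty\chi'(x)^2\,dx=1$, and a constant $C$, all depending only on $q$ and $k$, such that for every $\varepsilon>0$ there is $\delta>0$ with the following property. For every choice of the polynomials $f_N$ and every $\mathcal A\subset\mathcal P$ with $\overline d_{\mathcal P}(\mathcal A)\ge\varepsilon$ there exist a function $w:\{1,2,\dots\}\to\{0,1,2,\dots\}$ with $w(N)\to\infty$ and polynomials $W_N,b_N$ such that, for all $N\ge1$, $$W_N=\prod_{\substack{P\text{ monic irreducible}\\ \deg P<w(N)}}P\in\mathbf G_N,\qquad \deg b_N<\deg W_N,\qquad \gcd(b_N,W_N)=1$$ (with $\deg 0=-\infty$), such that the family $$\nu_N(h)=R\,\frac{\Phi(W_N)}{|W_N|}\,\Lambda_R(W_Nh+b_N)^2\quad(h\in\mathbf G_N),\qquad R=\alpha N,$$ is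 a pseudorandom measure, and such that for infinitely many $N$ there is a function $\phi:\mathbf F_{q^N}\to\mathbf R$ with 1. $\phi(h)=0$ for every $h\in\mathbf G_N$ with $W_Nh+b_N\notin\mathcal A$ (computed in $\mathbf F_q[t]$); 2. $0\le\phi\le\nu_N$; 3. $\mathbb E(\phi\mid\mathbf F_{q^N})\ge\delta$; 4. $\|\phi\|_\infty\le CN$. -/

import Mathlib

open Polynomial Filter
open scoped BigOperators Topology ContDiff

namespace FunctionFieldGT

/-- The finite set of all polynomials of degree less than `N` over a finite field `F`
(the zero polynomial included). -/
noncomputable def polysLT (F : Type*) [Field F] [Fintype F] (N : ℕ) : Finset F[X] :=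
  open scoped Classical in
  Finset.univ.image fun c : Fin N → F => ((degreeLTEquiv F N).symm c : F[X])

theorem mem_polysLT {F : Type*} [Field F] [Fintype F] {N : ℕ} {p : F[X]} :
    p ∈ polysLT F N ↔ p.degree < N := by
  classical
  rw [← mem_degreeLT]
  constructor
  · intro h
    obtain ⟨c, -, rfl⟩ := Finset.mem_image.1 h
    exact ((degreeLTEquiv F N).symm c).2
  · intro h
    exact Finset.mem_image.2 ⟨degreeLTEquiv F N ⟨p, h⟩, Finset.mem_univ _, by simp⟩

/-- The set of all irreducible polynomials (monic or not). -/
def irreducibles (F : Type*) [Field F] : Set F[X] := {p | Irreducible p}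

/-- The relative upper density of `A` in the set of all irreducible polynomials:
`limsup_N #{f ∈ A : deg f < N} / #{f irreducible : deg f < N}`. -/
noncomputable def relUpperDensity {F : Type*} [Field F] (A : Set F[X]) : ℝ :=
  limsup (fun N : ℕ => (Set.ncard {f ∈ A | f.degree < N} : ℝ) /
    (Set.ncard {f ∈ irreducibles F | f.degree < N} : ℝ)) atTop

/-- A choice, for every `N ≥ 1`, of a monic irreducible polynomial of degree `N`. It makes the
polynomials of degree less than `N` into a field with `q ^ N` elements. -/
structure FieldChoice (F : Type*) [Field F] where
  /-- the chosen polynomials -/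
  f : ℕ+ → F[X]
  monic : ∀ N, (f N).Monic
  irreducible : ∀ N, Irreducible (f N)
  natDegree_eq : ∀ N : ℕ+, (f N).natDegree = N

namespace FieldChoice

variable {F : Type*} [Field F]

/-- The field with `q ^ N` elements: polynomials modulo `f N`. -/
abbrev FqN (M : FieldChoice F) (N : ℕ+) : Type _ := AdjoinRoot (M.f N)

noncomputable instance (M : FieldChoice F) (N : ℕ+) : Field (M.FqN N) :=
  haveI : Fact (Irreducible (M.f N)) := ⟨M.irreducible N⟩
  AdjoinRoot.instField

instance (M : FieldChoice F) [Fintype F] (N : ℕ+) : Finite (M.FqN N) :=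
  haveI := (M.monic N).finite_adjoinRoot
  Module.finite_of_finite F

noncomputable instance (M : FieldChoice F) [Fintype F] (N : ℕ+) : Fintype (M.FqN N) :=
  Fintype.ofFinite _

/-- The polynomial of degree less than `N` that represents an element of the field. -/
noncomputable def rep (M : FieldChoice F) (N : ℕ+) (x : M.FqN N) : F[X] :=
  AdjoinRoot.modByMonicHom (M.monic N) x

/-- The value in the field of a rational function `a / g` (meaningful when `f N` does not divide
the reduced denominator, in particular when `deg g < N`). -/
noncomputable def embed (M : FieldChoice F) (N : ℕ+) (r : RatFunc F) : M.FqN N :=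
  AdjoinRoot.mk (M.f N) r.num / AdjoinRoot.mk (M.f N) r.denom

end FieldChoice

/-- The rational functions `a / g` with `deg a, deg g < k₀`, `g ≠ 0`. -/
def smallRatFunc (F : Type*) [Field F] (k₀ : ℕ) : Set (RatFunc F) :=
  {r | ∃ a g : F[X], a.degree < k₀ ∧ g.degree < k₀ ∧ g ≠ 0 ∧
    r = algebraMap F[X] (RatFunc F) a / algebraMap F[X] (RatFunc F) g}

section Pseudorandom

variable {F : Type*} [Field F] [Fintype F] (M : FieldChoice F)

/-- The `(m₀, n₀, k₀)`-linear forms condition for a family `ν N`: the average of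
`ν(ψ₁(x)) ⋯ ν(ψₘ(x))` over all `x` is `1 + o(1)` as `N → ∞`, uniformly over all systems of `m ≤ m₀`
affine forms `ψᵢ(x) = ∑ⱼ L i j * x j + b i` in `n ≤ n₀` variables whose coefficients `L i j` are
quotients of polynomials of degree less than `k₀`, whose homogeneous parts are nonzero and pairwise
not proportional over the field of rational functions, with arbitrary constant terms `b i`. -/
def LinearFormsCondition (m₀ n₀ k₀ : ℕ) (ν : ∀ N : ℕ+, M.FqN N → ℝ) : Prop :=
  ∀ ε : ℝ, 0 < ε → ∃ N₀ : ℕ+, ∀ N : ℕ+, N₀ ≤ N →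
    ∀ m n : ℕ, m ≤ m₀ → n ≤ n₀ →
    ∀ L : Fin m → Fin n → RatFunc F,
      (∀ i j, L i j ∈ smallRatFunc F k₀) →
      (∀ i, L i ≠ 0) →
      (∀ i i', i ≠ i' → ∀ c : RatFunc F, L i ≠ c • L i') →
    ∀ b : Fin m → M.FqN N,
      |(𝔼 x : Fin n → M.FqN N, ∏ i, ν N (∑ j, M.embed N (L i j) * x j + b i)) - 1| ≤ ε

/-- The `l₀`-correlation condition for a family `ν N`: there are nonnegative weights `τ N` all of
whose `L^p` norms are bounded in `N`, such that the average of `ν(x + h₁) ⋯ ν(x + hₗ)` is at most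
`∑_{i < j} τ(hᵢ - hⱼ)` for all `2 ≤ l ≤ l₀` and all shifts `h`, distinct or not. -/
def CorrelationCondition (l₀ : ℕ) (ν : ∀ N : ℕ+, M.FqN N → ℝ) : Prop :=
  ∃ τ : ∀ N : ℕ+, M.FqN N → ℝ,
    (∀ N x, 0 ≤ τ N x) ∧
    (∀ p : ℝ, 1 < p → ∃ C : ℝ, ∀ N : ℕ+, (𝔼 x : M.FqN N, τ N x ^ p) ≤ C) ∧
    ∀ N : ℕ+, ∀ l : ℕ, 2 ≤ l → l ≤ l₀ → ∀ h : Fin l → M.FqN N,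
      (𝔼 x : M.FqN N, ∏ i, ν N (x + h i)) ≤
        ∑ i : Fin l, ∑ j ∈ Finset.Ioi i, τ N (h i - h j)

/-- `k`-pseudorandom measures, with `K = q ^ k`: families of nonnegative functions satisfying the
`(K * 2 ^ (K - 1), 3 * K - 4, k)`-linear forms condition and the `2 ^ (K - 1)`-correlation
condition. -/
structure IsPseudorandom (k : ℕ) (ν : ∀ N : ℕ+, M.FqN N → ℝ) : Prop where
  nonneg : ∀ N x, 0 ≤ ν N x
  linearForms : LinearFormsCondition M
    (Fintype.card F ^ k * 2 ^ (Fintype.card F ^ k - 1)) (3 * Fintype.card F ^ k - 4) k ν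
  correlation : CorrelationCondition M (2 ^ (Fintype.card F ^ k - 1)) ν

end Pseudorandom

section DivisorSum

variable {F : Type*} [Field F] [Fintype F]

/-- The norm `|f| = q ^ deg f` for `f ≠ 0`, and `|0| = 0`. -/
noncomputable def polyNorm (f : F[X]) : ℝ :=
  open scoped Classical in
  if f = 0 then 0 else (Fintype.card F : ℝ) ^ f.natDegree

/-- Euler's totient: the number of polynomials of degree less than `deg f` coprime to `f`. -/
noncomputable def polyTotient (f : F[X]) : ℕ :=
  Set.ncard {g : F[X] | g.degree < f.degree ∧ IsCoprime g f}

/-- The product of all monic irreducible polynomials of degree less than `w`. -/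
noncomputable def polyPrimorial (F : Type*) [Field F] [Fintype F] (w : ℕ) : F[X] :=
  open scoped Classical in
  ∏ P ∈ (polysLT F w).filter (fun P : F[X] => P.Monic ∧ Irreducible P), P

/-- Admissible smooth cutoffs: smooth, supported on `[-1, 1]`, positive at `0`, and normalized by
`∫_0^∞ χ'(x)^2 dx = 1`. -/
structure IsCutoff (χ : ℝ → ℝ) : Prop where
  smooth : ContDiff ℝ ∞ χ
  support_subset : Function.support χ ⊆ Set.Icc (-1) 1
  pos : 0 < χ 0
  integral_eq : ∫ x in Set.Ioi (0 : ℝ), deriv χ x ^ 2 = 1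

/-- The truncated divisor sum `Λ_R(f) = ∑ μ(d) χ(deg d / R)`, over the monic divisors `d` of `f`
with `deg d < R`. -/
noncomputable def divisorSum (χ : ℝ → ℝ) (R : ℝ) (f : F[X]) : ℝ :=
  open scoped Classical in
  ∑ d ∈ (polysLT F ⌈R⌉₊).filter (fun d => d.Monic ∧ d ∣ f ∧ (d.natDegree : ℝ) < R),
    (UniqueFactorizationMonoid.moebius d : ℝ) * χ (d.natDegree / R)

/-- The normalized square `R * (Φ(W) / |W|) * Λ_R(W h + b) ^ 2`. -/
noncomputable def sieveWeight (χ : ℝ → ℝ) (R : ℝ) (W b h : F[X]) : ℝ :=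
  R * ((polyTotient W : ℝ) / polyNorm W) * divisorSum χ R (W * h + b) ^ 2

end DivisorSum

end FunctionFieldGT

/-!
Expanding the squares, the average of a product of `m` sieve weights along affine forms over a
box becomes a sum over squarefree divisors placed in `2 m` slots, weighted by local densities
that are multiplicative over the primes. Divisors enter the cutoffs only through their degrees,
so multiplying the divisor in a slot by a prime acts on the cutoffs as a translation. The
translations generate a commutative Banach algebra, in which the sum is an Euler product applied
to `∏ χ (· / R)`. Up to `O (∑ |P|⁻²)` the Euler factor at a prime `P` is the quotient of the
inverse zeta factors of the slots by those of the pairs of slots belonging to one form. Since the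
zeta function of `F[X]` is `1 / (1 - q u)`, the truncated products are, exactly on the functions
at hand, forward differences; so the differences of the cutoff, autocorrelated along each pair,
produce the main term `∏ ∫ (χ')² = 1`. This replaces the contour integrals of Goldston and
Yıldırım. The `W`-trick with a slowly growing `w` removes the small primes and makes the error
`o (1)`; in the correlation condition it is an exponential of `∑ |P|⁻¹` over the primes dividing
the differences `h i - h j`, all of whose moments are bounded.

For the minorant, `Λ_R` equals `χ 0` at every prime of degree at least `R`, so `ν` is constant on
the arguments that give such primes. By pigeonhole some residue `b` modulo `W` receives its share
of `A`, and the constant, restricted to the arguments that give elements of `A`, has mean at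
least `δ`.
-/

namespace FunctionFieldGT

section NormedRing

variable {𝒜 : Type*} [NormedCommRing 𝒜]

theorem norm_mul_le_one {x y : 𝒜} (hx : ‖x‖ ≤ 1) (hy : ‖y‖ ≤ 1) : ‖x * y‖ ≤ 1 :=
  (norm_mul_le x y).trans (mul_le_one₀ hx (norm_nonneg y) hy)

theorem norm_smul_le_of_norm_le_one [NormedAlgebra ℝ 𝒜] {z : 𝒜} {p : ℝ} (hp0 : 0 ≤ p)
    (hz : ‖z‖ ≤ 1) : ‖p • z‖ ≤ p := by
  rw [norm_smul, Real.norm_of_nonneg hp0]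
  exact mul_le_of_le_one_right hp0 hz

variable [NormOneClass 𝒜]

theorem norm_finset_prod_le_one {ι : Type*} (s : Finset ι) (z : ι → 𝒜) (hz : ∀ i ∈ s, ‖z i‖ ≤ 1) :
    ‖∏ i ∈ s, z i‖ ≤ 1 :=
  (Finset.norm_prod_le s z).trans (Finset.prod_le_one (fun _ _ => norm_nonneg _) hz)

theorem norm_prod_one_add_sub_le_sq {ι : Type*} (s : Finset ι) (x : ι → 𝒜) {p : ℝ}
    (hp : p ≤ 3 / 2) (hx : ∀ i ∈ s, ‖x i‖ ≤ p) :
    ‖∏ i ∈ s, (1 + x i) - (1 + ∑ i ∈ s, x i)‖ ≤ 3 ^ s.card * p ^ 2 := by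
  classical
  induction s using Finset.induction_on with
  | empty => simpa using sq_nonneg p
  | insert a s ha ih =>
    have hs : ∀ i ∈ s, ‖x i‖ ≤ p := fun i hi => hx i (Finset.mem_insert_of_mem hi)
    have hxa : ‖x a‖ ≤ p := hx a (Finset.mem_insert_self a s)
    have h_one_add : ‖1 + x a‖ ≤ 5 / 2 := (norm_add_le _ _).trans (by rw [norm_one]; linarith)
    have hsum : ‖∑ i ∈ s, x i‖ ≤ s.card * p := by
      simpa using (norm_sum_le _ _).trans (Finset.sum_le_sum hs)
    have hcard : 1 + (s.card : ℝ) * 2 ≤ 3 ^ s.card := by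
      simpa [show (1 : ℝ) + 2 = 3 by norm_num] using
        one_add_mul_le_pow (a := (2 : ℝ)) (by norm_num) s.card
    rw [Finset.prod_insert ha, Finset.sum_insert ha, Finset.card_insert_of_notMem ha]
    calc ‖(1 + x a) * ∏ i ∈ s, (1 + x i) - (1 + (x a + ∑ i ∈ s, x i))‖
        = ‖(1 + x a) * (∏ i ∈ s, (1 + x i) - (1 + ∑ i ∈ s, x i)) + x a * ∑ i ∈ s, x i‖ := by
          ring_nf
      _ ≤ 5 / 2 * (3 ^ s.card * p ^ 2) + p * (s.card * p) :=
          norm_add_le_of_le (norm_mul_le_of_le h_one_add (ih hs)) (norm_mul_le_of_le hxa hsum)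
      _ ≤ 3 ^ (s.card + 1) * p ^ 2 := by
          rw [pow_succ 3]
          nlinarith [mul_le_mul_of_nonneg_right hcard (sq_nonneg p), sq_nonneg p]

theorem exists_inverse_one_sub [CompleteSpace 𝒜] {x : 𝒜} (hx : ‖x‖ ≤ 1 / 2) :
    ∃ y : 𝒜, (1 - x) * y = 1 ∧ ‖y‖ ≤ 2 := by
  have hlt : ‖x‖ < 1 := by linarith
  refine ⟨∑' i : ℕ, x ^ i, mul_neg_geom_series x hlt, ?_⟩
  calc ‖∑' i : ℕ, x ^ i‖ ≤ ‖(1 : 𝒜)‖ - 1 + (1 - ‖x‖)⁻¹ :=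
        tsum_geometric_le_of_norm_lt_one x hlt
    _ ≤ 2 := by
        rw [norm_one, sub_self, zero_add]
        exact inv_le_of_inv_le₀ two_pos (by linarith)

theorem exists_inverse_prod_one_sub [CompleteSpace 𝒜] {ι : Type*} (s : Finset ι) (x : ι → 𝒜)
    (hx : ∀ i, ‖x i‖ ≤ 1 / 2) : ∃ y : 𝒜, (∏ i ∈ s, (1 - x i)) * y = 1 ∧ ‖y‖ ≤ 2 ^ s.card := by
  choose y hy hn using fun i => exists_inverse_one_sub (hx i)
  refine ⟨∏ i ∈ s, y i, ?_, ?_⟩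
  · rw [← Finset.prod_mul_distrib]
    exact Finset.prod_eq_one fun i _ => hy i
  · simpa using (Finset.norm_prod_le _ _).trans
      (Finset.prod_le_prod (fun _ _ => norm_nonneg _) fun i _ => hn i)

theorem norm_prod_sub_one_le_exp {κ : Type*} (s : Finset κ) (x : κ → 𝒜) (e : κ → ℝ)
    (hx : ∀ P ∈ s, ‖x P - 1‖ ≤ e P) :
    ‖∏ P ∈ s, x P - 1‖ ≤ Real.exp (∑ P ∈ s, e P) - 1 := by
  have h := s.norm_prod_one_add_sub_one_le fun P => x P - 1
  simp only [add_sub_cancel] at h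
  exact h.trans (sub_le_sub_right (Real.exp_le_exp.2 (Finset.sum_le_sum hx)) 1)

theorem norm_prod_one_sub_smul_sub_le [NormedAlgebra ℝ 𝒜] {ι : Type*} (s : Finset ι)
    {z : ι → 𝒜} {p : ℝ} (hp0 : 0 ≤ p) (hp : p ≤ 1 / 2) (hz : ∀ i, ‖z i‖ ≤ 1) :
    ‖∏ i ∈ s, (1 - p • z i) - (1 - p • ∑ i ∈ s, z i)‖ ≤ 3 ^ s.card * p ^ 2 := by
  have h := norm_prod_one_add_sub_le_sq s (fun i => -(p • z i)) (p := p) (by linarith)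
    fun i _ => by rw [norm_neg]; exact norm_smul_le_of_norm_le_one hp0 (hz i)
  simpa only [← sub_eq_add_neg, Finset.sum_neg_distrib, ← Finset.smul_sum] using h

end NormedRing

section EulerFactor

/-- A subset of a product, encoded as the family of its fibres over the first factor. -/
def finsetProdEquiv (α β : Type*) [Fintype α] [Fintype β] [DecidableEq α] [DecidableEq β] :
    Finset (α × β) ≃ (α → Finset β) where
  toFun B i := Finset.univ.filter fun b => (i, b) ∈ B
  invFun φ := Finset.univ.filter fun s => s.2 ∈ φ s.1
  left_inv B := by ext ⟨i, b⟩; simp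
  right_inv φ := by ext i b; simp

section Fibres

variable {α β : Type*} [Fintype α] [Fintype β] [DecidableEq α] [DecidableEq β]

theorem mem_finsetProdEquiv {B : Finset (α × β)} {a : α} {b : β} :
    b ∈ finsetProdEquiv α β B a ↔ (a, b) ∈ B := by
  simp [finsetProdEquiv]

theorem prod_eq_prod_finsetProdEquiv {M : Type*} [CommMonoid M] (B : Finset (α × β))
    (z : α × β → M) : ∏ s ∈ B, z s = ∏ a, ∏ b ∈ finsetProdEquiv α β B a, z (a, b) :=
  Finset.prod_finset_product B Finset.univ (finsetProdEquiv α β B)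
    (by rintro ⟨a, b⟩; simp [mem_finsetProdEquiv])

theorem mem_image_fst_iff_finsetProdEquiv_ne_empty {B : Finset (α × β)} {a : α} :
    a ∈ B.image Prod.fst ↔ finsetProdEquiv α β B a ≠ ∅ := by
  simp [← Finset.nonempty_iff_ne_empty, Finset.Nonempty, mem_finsetProdEquiv]

theorem pow_card_image_fst {R : Type*} [CommSemiring R] (p : R) (B : Finset (α × β)) :
    p ^ (B.image Prod.fst).card = ∏ a, if finsetProdEquiv α β B a = ∅ then 1 else p := by
  rw [Finset.prod_ite, Finset.prod_const_one, one_mul, Finset.prod_const]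
  congr 2
  ext a
  rw [mem_image_fst_iff_finsetProdEquiv_ne_empty]
  simp

end Fibres

variable {𝒜 : Type*} [NormedCommRing 𝒜] [NormedAlgebra ℝ 𝒜] {ι : Type*}

/-- Each form `i : ι` carries two slots `(i, false)` and `(i, true)`, one for each factor of a
squared divisor sum. This is the Euler factor, at one prime, of the sieve with density `c C` of the
points where all forms in `C` vanish; the variable `z s` marks the slots whose divisor contains the
prime. -/
noncomputable def eulerFactor [Fintype ι] [DecidableEq ι] (c : Finset ι → ℝ)
    (z : ι × Bool → 𝒜) : 𝒜 :=
  ∑ B : Finset (ι × Bool), ((-1) ^ B.card * c (B.image Prod.fst)) • ∏ s ∈ B, z s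

/-- The product of the inverse local zeta factors of all slots. -/
noncomputable def slotFactor [Fintype ι] (p : ℝ) (z : ι × Bool → 𝒜) : 𝒜 := ∏ s, (1 - p • z s)

/-- The product of the inverse local zeta factors of all pairs of slots of one form. -/
noncomputable def pairFactor [Fintype ι] (p : ℝ) (z : ι × Bool → 𝒜) : 𝒜 :=
  ∏ i, (1 - p • (z (i, false) * z (i, true)))

/-- Densities of a prime of inverse norm `p` that does not divide the modulus: one form vanishes
with density `p`, and several forms vanish together with density at most `e`. -/
structure IsGoodDensity (c : Finset ι → ℝ) (p e : ℝ) : Prop where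
  empty : c ∅ = 1
  singleton : ∀ i, c {i} = p
  abs_le_one : ∀ C, |c C| ≤ 1
  abs_le : ∀ C, 2 ≤ C.card → |c C| ≤ e
  sq_le : p ^ 2 ≤ e

theorem IsGoodDensity.abs_sub_pow_card_le {c : Finset ι → ℝ} {p e : ℝ} (hc : IsGoodDensity c p e)
    (hp0 : 0 ≤ p) (hp : p ≤ 1 / 2) (C : Finset ι) : |c C - p ^ C.card| ≤ 2 * e := by
  have he : 0 ≤ e := (sq_nonneg p).trans hc.sq_le
  rcases Nat.lt_or_ge C.card 2 with hC | hC
  · have h_eq : c C = p ^ C.card := by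
      interval_cases h : C.card
      · rw [Finset.card_eq_zero.1 h, hc.empty, pow_zero]
      · obtain ⟨i, rfl⟩ := Finset.card_eq_one.1 h
        rw [hc.singleton, pow_one]
    rw [h_eq, sub_self, abs_zero]
    positivity
  · have hpow : p ^ C.card ≤ p ^ 2 := pow_le_pow_of_le_one hp0 (by linarith) hC
    calc |c C - p ^ C.card| ≤ |c C| + |p ^ C.card| := abs_sub _ _
      _ ≤ e + e := add_le_add (hc.abs_le C hC) (by
          rw [abs_of_nonneg (by positivity)]; exact hpow.trans hc.sq_le)
      _ = 2 * e := by ring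

variable [Fintype ι]

theorem two_pow_card_slots : (2 : ℝ) ^ Fintype.card (ι × Bool) = 4 ^ Fintype.card ι := by
  rw [Fintype.card_prod, Fintype.card_bool, mul_comm, pow_mul]
  norm_num

theorem exists_inverse_slotFactor [NormOneClass 𝒜] [CompleteSpace 𝒜] {z : ι × Bool → 𝒜} {p : ℝ}
    (hp0 : 0 ≤ p) (hp : p ≤ 1 / 2) (hz : ∀ s, ‖z s‖ ≤ 1) :
    ∃ y : 𝒜, slotFactor p z * y = 1 ∧ ‖y‖ ≤ 4 ^ Fintype.card ι := by
  rw [← two_pow_card_slots]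
  exact exists_inverse_prod_one_sub Finset.univ _ fun s =>
    (norm_smul_le_of_norm_le_one hp0 (hz s)).trans hp

variable [DecidableEq ι]

theorem eulerFactor_sub (c c' : Finset ι → ℝ) (z : ι × Bool → 𝒜) :
    eulerFactor c z - eulerFactor c' z = eulerFactor (fun C => c C - c' C) z := by
  unfold eulerFactor
  simp_rw [← Finset.sum_sub_distrib, ← sub_smul, mul_sub]

theorem eulerFactor_eq_one {c : Finset ι → ℝ} (z : ι × Bool → 𝒜) (h0 : c ∅ = 1)
    (h : ∀ C, C.Nonempty → c C = 0) : eulerFactor c z = 1 := by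
  unfold eulerFactor
  rw [Finset.sum_eq_single ∅]
  · simp [h0]
  · intro B _ hB
    rw [h _ ((Finset.nonempty_iff_ne_empty.2 hB).image _), mul_zero, zero_smul]
  · simp

theorem sum_finset_bool_smul_prod (p : ℝ) (z : Bool → 𝒜) :
    ∑ S : Finset Bool, ((-1) ^ S.card * (if S = ∅ then 1 else p)) • ∏ b ∈ S, z b =
      1 + (-(p • z false) - p • z true + p • (z false * z true)) := by
  have huniv : (Finset.univ : Finset (Finset Bool)) = {∅, {false}, {true}, {false, true}} := by
    decide
  rw [huniv, Finset.sum_insert (by decide), Finset.sum_insert (by decide),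
    Finset.sum_insert (by decide), Finset.sum_singleton, Finset.prod_pair (by decide),
    Finset.card_pair (by decide)]
  simp
  abel

theorem eulerFactor_pow_card (p : ℝ) (z : ι × Bool → 𝒜) :
    eulerFactor (fun C => p ^ C.card) z =
      ∏ i, (1 + (-(p • z (i, false)) - p • z (i, true) + p • (z (i, false) * z (i, true)))) := by
  rw [Finset.prod_congr rfl fun i _ => (sum_finset_bool_smul_prod p fun b => z (i, b)).symm,
    Finset.prod_univ_sum, Fintype.piFinset_univ]
  refine Fintype.sum_equiv (finsetProdEquiv ι Bool) _ _ fun B => ?_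
  have hcard : B.card = ∑ i, (finsetProdEquiv ι Bool B i).card := by
    simpa only [Finset.card_eq_sum_ones] using Finset.sum_finset_product B Finset.univ
      (finsetProdEquiv ι Bool B) (f := fun _ => 1) (by rintro ⟨i, b⟩; simp [mem_finsetProdEquiv])
  simp only [prod_eq_prod_finsetProdEquiv B z, hcard]
  rw [pow_card_image_fst, ← Finset.prod_pow_eq_pow_sum,
    ← Finset.prod_mul_distrib]
  simp only [Algebra.smul_def, Finset.prod_mul_distrib, map_prod, map_mul]

variable [NormOneClass 𝒜] {c : Finset ι → ℝ} {z : ι × Bool → 𝒜} {p e : ℝ}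

theorem norm_eulerFactor_le (hc : ∀ C, |c C| ≤ e) (hz : ∀ s, ‖z s‖ ≤ 1) :
    ‖eulerFactor c z‖ ≤ 4 ^ Fintype.card ι * e := by
  refine (norm_sum_le _ _).trans ((Finset.sum_le_card_nsmul _ _ e fun B _ => ?_).trans_eq ?_)
  · rw [norm_smul, norm_mul, norm_pow, norm_neg, norm_one, one_pow, one_mul, Real.norm_eq_abs]
    exact (mul_le_of_le_one_right (abs_nonneg _)
      (norm_finset_prod_le_one B z fun s _ => hz s)).trans (hc _)
  · rw [Finset.card_univ, Fintype.card_finset, nsmul_eq_mul, Nat.cast_pow, Nat.cast_ofNat,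
      two_pow_card_slots]

theorem norm_eulerFactor_pow_card_sub_le (hp0 : 0 ≤ p) (hp : p ≤ 1 / 2) (hz : ∀ s, ‖z s‖ ≤ 1) :
    ‖eulerFactor (fun C => p ^ C.card) z -
      (1 - p • ∑ s, z s + p • ∑ i, z (i, false) * z (i, true))‖ ≤
        4 ^ Fintype.card ι * (9 * p ^ 2) := by
  have hterm : ∀ i, ‖-(p • z (i, false)) - p • z (i, true) +
      p • (z (i, false) * z (i, true))‖ ≤ 3 * p := fun i => by
    have h₁ := norm_smul_le_of_norm_le_one hp0 (hz (i, false))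
    have h₂ := norm_smul_le_of_norm_le_one hp0 (hz (i, true))
    have h₃ := norm_smul_le_of_norm_le_one hp0 (norm_mul_le_one (hz (i, false)) (hz (i, true)))
    rw [← norm_neg] at h₁
    linarith [norm_add_le_of_le (norm_sub_le_of_le h₁ h₂) h₃]
  have hlinear : 1 + ∑ i, (-(p • z (i, false)) - p • z (i, true) +
      p • (z (i, false) * z (i, true))) =
        1 - p • ∑ s, z s + p • ∑ i, z (i, false) * z (i, true) := by
    rw [Fintype.sum_prod_type]
    simp only [Fintype.sum_bool, Finset.sum_add_distrib, Finset.sum_sub_distrib,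
      Finset.sum_neg_distrib, ← Finset.smul_sum, smul_add]
    abel
  have h := norm_prod_one_add_sub_le_sq Finset.univ _ (by linarith)
    fun i _ => hterm i
  rw [hlinear, ← eulerFactor_pow_card, Finset.card_univ] at h
  calc _ ≤ (3 : ℝ) ^ Fintype.card ι * (3 * p) ^ 2 := h
    _ ≤ 4 ^ Fintype.card ι * (9 * p ^ 2) := by
        rw [mul_pow]
        gcongr <;> norm_num

theorem IsGoodDensity.norm_eulerFactor_sub_le (hc : IsGoodDensity c p e) (hp0 : 0 ≤ p)
    (hp : p ≤ 1 / 2) (hz : ∀ s, ‖z s‖ ≤ 1) :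
    ‖eulerFactor c z - (1 - p • ∑ s, z s + p • ∑ i, z (i, false) * z (i, true))‖ ≤
      11 * 4 ^ Fintype.card ι * e := by
  have hmodel : ‖eulerFactor c z - eulerFactor (fun C => p ^ C.card) z‖ ≤
      4 ^ Fintype.card ι * (2 * e) := by
    rw [eulerFactor_sub]
    exact norm_eulerFactor_le (hc.abs_sub_pow_card_le hp0 hp) hz
  calc _ ≤ 4 ^ Fintype.card ι * (2 * e) + 4 ^ Fintype.card ι * (9 * p ^ 2) := by
        rw [← sub_add_sub_cancel]
        exact norm_add_le_of_le hmodel (norm_eulerFactor_pow_card_sub_le hp0 hp hz)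
    _ ≤ 4 ^ Fintype.card ι * (2 * e) + 4 ^ Fintype.card ι * (9 * e) := by
        gcongr
        exact hc.sq_le
    _ = 11 * 4 ^ Fintype.card ι * e := by ring

theorem norm_mul_sub_le_of_first_order {a b E D N : 𝒜} {K : ℝ} (hp0 : 0 ≤ p) (hp : p ≤ 1 / 2)
    (he : p ^ 2 ≤ e) (hK : 1 ≤ K) (ha : ‖a‖ ≤ K) (hb : ‖b‖ ≤ K) (hE : ‖E‖ ≤ K)
    (hE₁ : ‖E - (1 - p • a + p • b)‖ ≤ 11 * K * e) (hD₁ : ‖D - (1 - p • b)‖ ≤ K * e)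
    (hN₁ : ‖N - (1 - p • a)‖ ≤ K ^ 2 * e) : ‖E * D - N‖ ≤ 40 * K ^ 2 * e := by
  have he0 : 0 ≤ e := (sq_nonneg p).trans he
  have h_one_sub : ‖1 - p • b‖ ≤ 1 + K := by
    refine norm_sub_le_of_le norm_one.le ?_
    rw [norm_smul, Real.norm_of_nonneg hp0]
    nlinarith [norm_nonneg b]
  have hcross : ‖(1 - p • b) * (1 - p • a + p • b) - (1 - p • a)‖ ≤ e * (K * (K + K)) := by
    have h_eq : (1 - p • b) * (1 - p • a + p • b) - (1 - p • a) = p ^ 2 • (b * (a - b)) := by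
      simp only [Algebra.smul_def, map_pow]
      ring
    rw [h_eq, norm_smul, Real.norm_of_nonneg (sq_nonneg p)]
    exact mul_le_mul he (norm_mul_le_of_le hb (norm_sub_le_of_le ha hb)) (norm_nonneg _) he0
  have hsplit : E * D - N = (D - (1 - p • b)) * E + (1 - p • b) * (E - (1 - p • a + p • b)) +
      ((1 - p • b) * (1 - p • a + p • b) - (1 - p • a)) - (N - (1 - p • a)) := by ring
  calc ‖E * D - N‖
      ≤ K * e * K + (1 + K) * (11 * K * e) + e * (K * (K + K)) + K ^ 2 * e := by
        rw [hsplit]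
        exact norm_sub_le_of_le (norm_add_le_of_le (norm_add_le_of_le
          (norm_mul_le_of_le hD₁ hE) (norm_mul_le_of_le h_one_sub hE₁)) hcross) hN₁
    _ = (15 * K ^ 2 + 11 * K) * e := by ring
    _ ≤ 40 * K ^ 2 * e := mul_le_mul_of_nonneg_right (by nlinarith) he0

theorem IsGoodDensity.norm_eulerFactor_mul_pairFactor_sub_le (hc : IsGoodDensity c p e)
    (hp0 : 0 ≤ p) (hp : p ≤ 1 / 2) (hz : ∀ s, ‖z s‖ ≤ 1) :
    ‖eulerFactor c z * pairFactor p z - slotFactor p z‖ ≤ 40 * (4 ^ Fintype.card ι) ^ 2 * e := by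
  have hzz : ∀ i, ‖z (i, false) * z (i, true)‖ ≤ 1 := fun i => norm_mul_le_one (hz _) (hz _)
  have hcard_slots : (Fintype.card (ι × Bool) : ℝ) ≤ 4 ^ Fintype.card ι := by
    rw [← two_pow_card_slots]
    exact_mod_cast Nat.lt_two_pow_self.le
  have hcard : (Fintype.card ι : ℝ) ≤ 4 ^ Fintype.card ι := by
    exact_mod_cast (Nat.lt_pow_self (by norm_num : 1 < 4)).le
  refine norm_mul_sub_le_of_first_order (a := ∑ s, z s) (b := ∑ i, z (i, false) * z (i, true))
    hp0 hp hc.sq_le (one_le_pow₀ (by norm_num)) ?_ ?_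
    (by simpa using norm_eulerFactor_le hc.abs_le_one hz)
    (hc.norm_eulerFactor_sub_le hp0 hp hz) ?_ ?_
  · refine (norm_sum_le _ _).trans ((Finset.sum_le_sum fun s _ => hz s).trans ?_)
    simpa using hcard_slots
  · refine (norm_sum_le _ _).trans ((Finset.sum_le_sum fun i _ => hzz i).trans ?_)
    simpa using hcard
  · refine (norm_prod_one_sub_smul_sub_le Finset.univ hp0 hp hzz).trans ?_
    rw [Finset.card_univ]
    gcongr
    exacts [by norm_num, hc.sq_le]
  · refine (norm_prod_one_sub_smul_sub_le Finset.univ hp0 hp hz).trans ?_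
    rw [Finset.card_univ, Fintype.card_prod, Fintype.card_bool, pow_mul]
    gcongr
    exacts [by norm_num, hc.sq_le]

theorem IsGoodDensity.norm_eulerFactor_mul_pairFactor_mul_sub_one_le (hc : IsGoodDensity c p e)
    (hp0 : 0 ≤ p) (hp : p ≤ 1 / 2) (hz : ∀ s, ‖z s‖ ≤ 1) {y : 𝒜} (hy : slotFactor p z * y = 1)
    (hyn : ‖y‖ ≤ 4 ^ Fintype.card ι) :
    ‖eulerFactor c z * pairFactor p z * y - 1‖ ≤ 40 * 64 ^ Fintype.card ι * e := by
  have h64 : (64 : ℝ) ^ Fintype.card ι = (4 ^ Fintype.card ι) ^ 2 * 4 ^ Fintype.card ι := by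
    rw [← pow_succ, ← pow_mul, mul_comm, pow_mul]
    norm_num
  calc ‖eulerFactor c z * pairFactor p z * y - 1‖
      = ‖(eulerFactor c z * pairFactor p z - slotFactor p z) * y‖ := by rw [sub_mul, hy]
    _ ≤ 40 * (4 ^ Fintype.card ι) ^ 2 * e * 4 ^ Fintype.card ι :=
        norm_mul_le_of_le (hc.norm_eulerFactor_mul_pairFactor_sub_le hp0 hp hz) hyn
    _ = 40 * 64 ^ Fintype.card ι * e := by rw [h64]; ring

end EulerFactor

section EulerProduct

variable {𝒜 : Type*} [NormedCommRing 𝒜] {E : Type*} [NormedAddCommGroup E] [Module 𝒜 E]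
  {ι κ : Type*}

/-- Densities of a sieve with primes `T`: no form vanishes modulo a prime in `S` (a prime dividing
the modulus), and the primes outside `S` have good densities. -/
structure IsSieveDensity (S T : Finset κ) (c : κ → Finset ι → ℝ) (p e : κ → ℝ) : Prop where
  subset : S ⊆ T
  empty : ∀ P ∈ S, c P ∅ = 1
  eq_zero : ∀ P ∈ S, ∀ C : Finset ι, C.Nonempty → c P C = 0
  good : ∀ P ∈ T, P ∉ S → IsGoodDensity (c P) (p P) (e P)

theorem exists_norm_smul_le_of_mem_span [IsBoundedSMul 𝒜 E] {σ : Type*} [Finite σ] {Z : σ → 𝒜}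
    {T : 𝒜} (hT : T ∈ Ideal.span (Set.range fun s => Z s - 1)) :
    ∃ K : ℝ, 0 ≤ K ∧ ∀ (F : E) (A : ℝ), (∀ s, ‖(Z s - 1) • F‖ ≤ A) → ‖T • F‖ ≤ K * A := by
  have := Fintype.ofFinite σ
  obtain ⟨u, rfl⟩ := Ideal.mem_span_range_iff_exists_fun.1 hT
  refine ⟨∑ s, ‖u s‖, Finset.sum_nonneg fun _ _ => norm_nonneg _, fun F A hA => ?_⟩
  rw [Finset.sum_smul, Finset.sum_mul]
  refine norm_sum_le_of_le _ fun s _ => ?_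
  rw [mul_smul]
  exact (norm_smul_le _ _).trans (mul_le_mul_of_nonneg_left (hA s) (norm_nonneg _))

variable [NormedAlgebra ℝ 𝒜] [Fintype ι]

-- Setting all `Z s` equal to `1` turns `pairFactor / slotFactor` into `(1 - p) ^ (-card ι)`.
theorem prod_pairFactor_mul_sub_one_mem_span {Z : ι × Bool → 𝒜} (S : Finset κ) (n : κ → ℕ)
    {p : κ → ℝ} (y : κ → 𝒜) (hy : ∀ P ∈ S, slotFactor (p P) (fun s => Z s ^ n P) * y P = 1) :
    algebraMap ℝ 𝒜 ((∏ P ∈ S, (1 - p P)) ^ Fintype.card ι) *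
      ∏ P ∈ S, (pairFactor (p P) (fun s => Z s ^ n P) * y P) - 1 ∈
        Ideal.span (Set.range fun s => Z s - 1) := by
  set I := Ideal.span (Set.range fun s => Z s - 1)
  have hZ : ∀ s, Ideal.Quotient.mk I (Z s) = 1 := fun s => by
    rw [← map_one (Ideal.Quotient.mk I), Ideal.Quotient.eq]
    exact Ideal.subset_span ⟨s, rfl⟩
  have hslot : ∀ P, Ideal.Quotient.mk I (slotFactor (p P) fun s => Z s ^ n P) =
      Ideal.Quotient.mk I (algebraMap ℝ 𝒜 ((1 - p P) ^ (2 * Fintype.card ι))) := fun P => by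
    simp [slotFactor, Algebra.smul_def, hZ, mul_comm]
  have hpair : ∀ P, Ideal.Quotient.mk I (pairFactor (p P) fun s => Z s ^ n P) =
      Ideal.Quotient.mk I (algebraMap ℝ 𝒜 ((1 - p P) ^ Fintype.card ι)) := fun P => by
    simp [pairFactor, Algebra.smul_def, hZ]
  rw [← Ideal.Quotient.eq, map_one, map_mul, map_prod, ← Finset.prod_pow, map_prod, map_prod,
    ← Finset.prod_mul_distrib]
  refine Finset.prod_eq_one fun P hP => ?_
  have h_inv := congrArg (Ideal.Quotient.mk I) (hy P hP)
  rw [map_mul, hslot, map_one, two_mul, pow_add, map_mul, map_mul] at h_inv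
  rw [map_mul, hpair, ← mul_assoc, h_inv]

variable [DecidableEq ι] {S T : Finset κ} {c : κ → Finset ι → ℝ} {p e : κ → ℝ} {n : κ → ℕ}
  {Z : ι × Bool → 𝒜} {y : κ → 𝒜} {f F : E}

theorem IsSieveDensity.prod_eulerFactor_smul_eq [DecidableEq κ] (hc : IsSieveDensity S T c p e)
    (hy : ∀ P, slotFactor (p P) (fun s => Z s ^ n P) * y P = 1)
    (hfF : (∏ P ∈ T, slotFactor (p P) fun s => Z s ^ n P) • f =
      (∏ P ∈ T, pairFactor (p P) fun s => Z s ^ n P) • F) :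
    (∏ P ∈ T, eulerFactor (c P) fun s => Z s ^ n P) • f =
      ((∏ P ∈ T \ S, (eulerFactor (c P) (fun s => Z s ^ n P) *
        pairFactor (p P) (fun s => Z s ^ n P) * y P)) *
          ∏ P ∈ S, (pairFactor (p P) (fun s => Z s ^ n P) * y P)) • F := by
  have hslot : (∏ P ∈ T, y P) * ∏ P ∈ T, slotFactor (p P) (fun s => Z s ^ n P) = 1 := by
    rw [← Finset.prod_mul_distrib]
    exact Finset.prod_eq_one fun P _ => by rw [mul_comm, hy P]
  have hf : f = (∏ P ∈ T, (pairFactor (p P) (fun s => Z s ^ n P) * y P)) • F := by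
    rw [Finset.prod_mul_distrib, mul_comm, mul_smul, ← hfF, ← mul_smul, hslot, one_smul]
  have hsieved : ∏ P ∈ S, eulerFactor (c P) (fun s => Z s ^ n P) = 1 :=
    Finset.prod_eq_one fun P hP => eulerFactor_eq_one _ (hc.empty P hP) (hc.eq_zero P hP)
  conv_lhs => rw [hf]
  rw [← mul_smul, ← Finset.prod_sdiff hc.subset, hsieved, mul_one, ← Finset.prod_sdiff hc.subset,
    ← mul_assoc, ← Finset.prod_mul_distrib]
  simp only [mul_assoc]

variable [NormOneClass 𝒜]

theorem IsSieveDensity.norm_prod_good_sub_one_le [DecidableEq κ] (hc : IsSieveDensity S T c p e)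
    (hp0 : ∀ P, 0 ≤ p P) (hp : ∀ P, p P ≤ 1 / 2) (hZ : ∀ s, ‖Z s‖ ≤ 1)
    (hy : ∀ P, slotFactor (p P) (fun s => Z s ^ n P) * y P = 1)
    (hyn : ∀ P, ‖y P‖ ≤ 4 ^ Fintype.card ι) {L : ℝ} (hL : ∑ P ∈ T \ S, e P ≤ L) :
    ‖∏ P ∈ T \ S, (eulerFactor (c P) (fun s => Z s ^ n P) *
      pairFactor (p P) (fun s => Z s ^ n P) * y P) - 1‖ ≤
        Real.exp (40 * 64 ^ Fintype.card ι * L) - 1 := by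
  refine (norm_prod_sub_one_le_exp (T \ S) _ (fun P => 40 * 64 ^ Fintype.card ι * e P)
    fun P hP => ?_).trans (sub_le_sub_right (Real.exp_le_exp.2 ?_) 1)
  · obtain ⟨hPT, hPS⟩ := Finset.mem_sdiff.1 hP
    exact (hc.good P hPT hPS).norm_eulerFactor_mul_pairFactor_mul_sub_one_le (hp0 P) (hp P)
      (fun s => (norm_pow_le _ _).trans (pow_le_one₀ (norm_nonneg _) (hZ s))) (hy P) (hyn P)
  · rw [← Finset.mul_sum]
    gcongr

theorem exists_norm_prod_eulerFactor_smul_sub_le [DecidableEq κ] [CompleteSpace 𝒜]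
    [NormedSpace ℝ E] [IsScalarTower ℝ 𝒜 E] [IsBoundedSMul 𝒜 E] {Z : ι × Bool → 𝒜}
    (hZ : ∀ s, ‖Z s‖ ≤ 1) (S : Finset κ) (n : κ → ℕ) (p : κ → ℝ)
    (hp0 : ∀ P, 0 ≤ p P) (hp : ∀ P, p P ≤ 1 / 2) :
    ∃ K : ℝ, 0 ≤ K ∧ ∀ (T : Finset κ) (c : κ → Finset ι → ℝ) (e : κ → ℝ),
      IsSieveDensity S T c p e → ∀ (f F : E) (A A' L : ℝ),
      (∏ P ∈ T, slotFactor (p P) fun s => Z s ^ n P) • f =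
        (∏ P ∈ T, pairFactor (p P) fun s => Z s ^ n P) • F →
      ‖F‖ ≤ A → (∀ s, ‖(Z s - 1) • F‖ ≤ A') → ∑ P ∈ T \ S, e P ≤ L →
      ‖(∏ P ∈ S, (1 - p P)) ^ Fintype.card ι •
          ((∏ P ∈ T, eulerFactor (c P) fun s => Z s ^ n P) • f) - F‖ ≤
        (Real.exp (40 * 64 ^ Fintype.card ι * L) - 1) * A +
          Real.exp (40 * 64 ^ Fintype.card ι * L) * (K * A') := by
  choose y hy hyn using fun P => exists_inverse_slotFactor (hp0 P) (hp P) fun s =>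
    (norm_pow_le (Z s) (n P)).trans (pow_le_one₀ (norm_nonneg _) (hZ s))
  obtain ⟨K, hK0, hK⟩ := exists_norm_smul_le_of_mem_span (E := E)
    (prod_pairFactor_mul_sub_one_mem_span S n (p := p) (Z := Z) y fun P _ => hy P)
  refine ⟨K, hK0, fun T c e hc f F A A' L hfF hF hF' hL => ?_⟩
  set V := (∏ P ∈ S, (1 - p P)) ^ Fintype.card ι
  set H := ∏ P ∈ S, (pairFactor (p P) (fun s => Z s ^ n P) * y P)
  set G := ∏ P ∈ T \ S, (eulerFactor (c P) (fun s => Z s ^ n P) *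
    pairFactor (p P) (fun s => Z s ^ n P) * y P)
  have hG₁ : ‖G - 1‖ ≤ Real.exp (40 * 64 ^ Fintype.card ι * L) - 1 :=
    hc.norm_prod_good_sub_one_le hp0 hp hZ hy hyn hL
  have hG : ‖G‖ ≤ Real.exp (40 * 64 ^ Fintype.card ι * L) := by
    simpa using norm_add_le_of_le hG₁ (norm_one (α := 𝒜)).le
  have hsplit : V • ((∏ P ∈ T, eulerFactor (c P) fun s => Z s ^ n P) • f) - F =
      (G - 1) • F + G • ((algebraMap ℝ 𝒜 V * H - 1) • F) := by
    rw [hc.prod_eulerFactor_smul_eq hy hfF, ← algebraMap_smul 𝒜 V]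
    module
  rw [hsplit]
  exact norm_add_le_of_le
    ((norm_smul_le _ _).trans (mul_le_mul hG₁ hF (norm_nonneg _) ((norm_nonneg _).trans hG₁)))
    ((norm_smul_le _ _).trans (mul_le_mul hG (hK F A' hF') (norm_nonneg _) (Real.exp_nonneg _)))

end EulerProduct

section Translation

open scoped BoundedContinuousFunction

/-- The bounded real functions on a discrete space `G`. This is a copy of `G →ᵇ ℝ` that remembers
only its Banach space structure. -/
def BoundedFunction (G : Type*) [TopologicalSpace G] : Type _ := G →ᵇ ℝ

namespace BoundedFunction

variable {G : Type*} [TopologicalSpace G]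

noncomputable instance : NormedAddCommGroup (BoundedFunction G) :=
  inferInstanceAs (NormedAddCommGroup (G →ᵇ ℝ))

noncomputable instance : NormedSpace ℝ (BoundedFunction G) :=
  inferInstanceAs (NormedSpace ℝ (G →ᵇ ℝ))

instance : CompleteSpace (BoundedFunction G) :=
  inferInstanceAs (CompleteSpace (G →ᵇ ℝ))

instance : FunLike (BoundedFunction G) G ℝ :=
  inferInstanceAs (FunLike (G →ᵇ ℝ) G ℝ)

theorem ext {f g : BoundedFunction G} (h : ∀ x, f x = g x) : f = g :=
  BoundedContinuousFunction.ext h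

theorem abs_apply_le_norm (f : BoundedFunction G) (x : G) : |f x| ≤ ‖f‖ :=
  BoundedContinuousFunction.norm_coe_le_norm (show G →ᵇ ℝ from f) x

theorem norm_le {f : BoundedFunction G} {A : ℝ} (hA : 0 ≤ A) (h : ∀ x, |f x| ≤ A) : ‖f‖ ≤ A :=
  (BoundedContinuousFunction.norm_le hA).2 h

theorem sub_apply (f g : BoundedFunction G) (x : G) : (f - g) x = f x - g x := rfl

theorem smul_apply (r : ℝ) (f : BoundedFunction G) (x : G) : (r • f) x = r * f x := rfl

theorem zero_apply (x : G) : (0 : BoundedFunction G) x = 0 := rfl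

theorem sum_apply {σ : Type*} (s : Finset σ) (f : σ → BoundedFunction G) (x : G) :
    (∑ i ∈ s, f i) x = ∑ i ∈ s, f i x :=
  map_sum ({ toFun := fun f => f x, map_zero' := rfl, map_add' := fun _ _ => rfl } :
    BoundedFunction G →+ ℝ) f s

variable [DiscreteTopology G]

/-- The function `f`, bounded by `A`. -/
noncomputable def ofBound (f : G → ℝ) (A : ℝ) (h : ∀ x, |f x| ≤ A) : BoundedFunction G :=
  BoundedContinuousFunction.ofNormedAddCommGroupDiscrete f A h

theorem ofBound_apply (f : G → ℝ) (A : ℝ) (h : ∀ x, |f x| ≤ A) (x : G) : ofBound f A h x = f x :=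
  rfl

instance [Nonempty G] : Nontrivial (BoundedFunction G) where
  exists_pair_ne := ⟨ofBound (fun _ => 0) 0 (by simp), ofBound (fun _ => 1) 1 (by simp), fun h =>
    zero_ne_one (DFunLike.congr_fun h (Classical.arbitrary G))⟩

end BoundedFunction

variable {G : Type*} [AddCommMonoid G] [TopologicalSpace G] [DiscreteTopology G]

/-- Translation by `v` on the bounded functions on `G`. -/
noncomputable def translateOp (v : G) : BoundedFunction G →L[ℝ] BoundedFunction G :=
  LinearMap.mkContinuous
    { toFun := fun f => BoundedContinuousFunction.compContinuous f
        ⟨fun x => x + v, continuous_of_discreteTopology⟩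
      map_add' := fun _ _ => rfl
      map_smul' := fun _ _ => rfl } 1 fun f => by
        rw [one_mul]
        exact BoundedFunction.norm_le (norm_nonneg f) fun _ => f.abs_apply_le_norm _

theorem translateOp_mul_comm (v w : G) :
    translateOp v * translateOp w = translateOp w * translateOp v := by
  refine ContinuousLinearMap.ext fun f => BoundedFunction.ext fun x => ?_
  change f (x + v + w) = f (x + w + v)
  rw [add_right_comm]

variable (G) in
/-- The closed algebra of operators generated by the translations of `G`. -/
noncomputable def translationSubalgebra :
    Subalgebra ℝ (BoundedFunction G →L[ℝ] BoundedFunction G) :=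
  (Algebra.adjoin ℝ (Set.range translateOp)).topologicalClosure

variable (G) in
/-- The closed algebra generated by the translations of `G`, as a commutative Banach algebra acting
on the bounded functions on `G`. -/
abbrev TranslationAlgebra : Type _ := translationSubalgebra G

theorem translationAlgebra_mul_comm (x y : TranslationAlgebra G) : x * y = y * x := by
  have hcomm := Algebra.isMulCommutative_adjoin ℝ (s := Set.range (translateOp (G := G))) (by
    rintro _ ⟨v, rfl⟩ _ ⟨w, rfl⟩
    exact translateOp_mul_comm v w)
  exact (Subalgebra.commRingTopologicalClosure _ hcomm.is_comm.comm).mul_comm x y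

noncomputable instance : NormedCommRing (TranslationAlgebra G) :=
  { (inferInstance : NormedRing (TranslationAlgebra G)) with
    mul_comm := translationAlgebra_mul_comm }

noncomputable instance : NormedAlgebra ℝ (TranslationAlgebra G) where
  norm_smul_le r x := norm_smul_le r (x : BoundedFunction G →L[ℝ] BoundedFunction G)

instance : CompleteSpace (TranslationAlgebra G) :=
  (Subalgebra.isClosed_topologicalClosure
    (Algebra.adjoin ℝ (Set.range (translateOp (G := G))))).completeSpace_coe

instance : NormOneClass (TranslationAlgebra G) where
  norm_one := norm_one (α := BoundedFunction G →L[ℝ] BoundedFunction G)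

instance : IsBoundedSMul (TranslationAlgebra G) (BoundedFunction G) :=
  IsBoundedSMul.of_norm_smul_le fun x f =>
    (x : BoundedFunction G →L[ℝ] BoundedFunction G).le_opNorm f

instance : IsScalarTower ℝ (TranslationAlgebra G) (BoundedFunction G) where
  smul_assoc _ _ _ := rfl

/-- Translation by `v` as an element of the Banach algebra. -/
noncomputable def translation (v : G) : TranslationAlgebra G :=
  ⟨translateOp v, Subalgebra.le_topologicalClosure _ (Algebra.subset_adjoin ⟨v, rfl⟩)⟩

theorem norm_translation_le (v : G) : ‖translation v‖ ≤ 1 :=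
  (translateOp v).opNorm_le_bound zero_le_one fun f => by
    rw [one_mul]
    exact BoundedFunction.norm_le (norm_nonneg f) fun _ => f.abs_apply_le_norm _

theorem translation_smul_apply (v : G) (f : BoundedFunction G) (x : G) :
    (translation v • f) x = f (x + v) := rfl

theorem translation_zero : translation (0 : G) = 1 :=
  Subtype.ext <| ContinuousLinearMap.ext fun f => BoundedFunction.ext fun x =>
    congrArg f (add_zero x)

theorem translation_add (v w : G) : translation (v + w) = translation v * translation w :=
  Subtype.ext <| ContinuousLinearMap.ext fun f => BoundedFunction.ext fun x =>
    congrArg f (add_assoc x v w).symm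

theorem translation_nsmul (k : ℕ) (v : G) : translation (k • v) = translation v ^ k := by
  induction k with
  | zero => rw [zero_smul, pow_zero, translation_zero]
  | succ k ih => rw [succ_nsmul, pow_succ, translation_add, ih]

theorem translation_sum {σ : Type*} (s : Finset σ) (v : σ → G) :
    translation (∑ i ∈ s, v i) = ∏ i ∈ s, translation (v i) := by
  classical
  induction s using Finset.induction_on with
  | empty => simp [translation_zero]
  | insert a s ha ih => rw [Finset.sum_insert ha, Finset.prod_insert ha, translation_add, ih]

theorem one_sub_translation_smul_apply (v : G) (f : BoundedFunction G) (x : G) :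
    ((1 - translation v) • f) x = f x - f (x + v) := by
  rw [sub_smul, one_smul, BoundedFunction.sub_apply, translation_smul_apply]

theorem prod_one_sub_translation_smul_apply {σ : Type*} [Fintype σ] {v : σ → G}
    {ρ : σ → G → ℝ} (hρ : ∀ i j x, i ≠ j → ρ j (x + v i) = ρ j x) {F : BoundedFunction G}
    (hF : ∀ x, F x = ∏ i, ρ i x) (x : G) :
    ((∏ i, (1 - translation (v i))) • F) x = ∏ i, (ρ i x - ρ i (x + v i)) := by
  classical
  have hpartial : ∀ (S : Finset σ) (x : G), ((∏ i ∈ S, (1 - translation (v i))) • F) x =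
      ∏ i, if i ∈ S then ρ i x - ρ i (x + v i) else ρ i x := fun S => by
    induction S using Finset.induction_on with
    | empty => simp [hF]
    | insert a S ha ih =>
      intro x
      have hne : ∀ i ∈ Finset.univ.erase a, (if i ∈ S then ρ i (x + v a) -
          ρ i (x + v a + v i) else ρ i (x + v a)) =
            if i ∈ S then ρ i x - ρ i (x + v i) else ρ i x := fun i hi => by
        have hia : a ≠ i := (Finset.ne_of_mem_erase hi).symm
        rw [add_right_comm, hρ a i x hia, hρ a i (x + v i) hia]
      have hinsert : ∀ i ∈ Finset.univ.erase a, (if i ∈ insert a S then ρ i x - ρ i (x + v i)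
          else ρ i x) = if i ∈ S then ρ i x - ρ i (x + v i) else ρ i x := fun i hi => by
        simp only [Finset.mem_insert, Finset.ne_of_mem_erase hi, false_or]
      rw [Finset.prod_insert ha, mul_smul, one_sub_translation_smul_apply, ih, ih,
        ← Finset.mul_prod_erase _ _ (Finset.mem_univ a), ← Finset.mul_prod_erase _ _
          (Finset.mem_univ a), ← Finset.mul_prod_erase _ _ (Finset.mem_univ a),
        Finset.prod_congr rfl hne, Finset.prod_congr rfl hinsert, if_neg ha, if_neg ha,
        if_pos (Finset.mem_insert_self a S), sub_mul]
  simpa using hpartial Finset.univ x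

theorem prod_eulerFactor_translation_smul_apply_zero {ι κ : Type*} [Fintype ι] [DecidableEq ι]
    [DecidableEq κ] (T : Finset κ) (n : κ → ℕ) (c : κ → Finset ι → ℝ) (v : ι × Bool → G)
    (f : BoundedFunction G) :
    ((∏ P ∈ T, eulerFactor (c P) fun s => translation (v s) ^ n P) • f) 0 =
      ∑ B : T → Finset (ι × Bool),
        (∏ P : T, ((-1) ^ (B P).card * c P ((B P).image Prod.fst))) *
          f (∑ P : T, n P • ∑ s ∈ B P, v s) := by
  have hterm : ∀ B : T → Finset (ι × Bool),
      ∏ P : T, (((-1 : ℝ) ^ (B P).card * c P ((B P).image Prod.fst)) •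
        ∏ s ∈ B P, translation (v s) ^ n P) =
      (∏ P : T, ((-1 : ℝ) ^ (B P).card * c P ((B P).image Prod.fst))) •
        translation (∑ P : T, n P • ∑ s ∈ B P, v s) := fun B => by
    simp only [Algebra.smul_def, Finset.prod_mul_distrib, map_prod, map_mul, translation_sum,
      translation_nsmul, Finset.prod_pow]
  rw [← Finset.prod_coe_sort]
  unfold eulerFactor
  rw [Finset.prod_univ_sum, Fintype.piFinset_univ, Finset.sum_smul, BoundedFunction.sum_apply]
  refine Finset.sum_congr rfl fun B _ => ?_
  rw [hterm, smul_assoc, BoundedFunction.smul_apply, translation_smul_apply, zero_add]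

end Translation

section Truncation

variable {𝒜 : Type*} [CommRing 𝒜] [Algebra ℝ 𝒜] {E : Type*} [AddCommGroup E] [Module 𝒜 E]
  {κ : Type*} {T : Finset κ} {n : κ → ℕ} {p : κ → ℝ} {N : ℕ}

theorem prod_one_sub_smul_eq
    (hpoly : (X : ℝ[X]) ^ N ∣ ∏ P ∈ T, (1 - C (p P) * X ^ n P) - (1 - X)) {z : 𝒜} {f : E}
    (hf : z ^ N • f = 0) : (∏ P ∈ T, (1 - p P • z ^ n P)) • f = (1 - z) • f := by
  obtain ⟨Q, hQ⟩ := hpoly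
  have hz := congrArg (aeval z) hQ
  simp only [map_sub, map_prod, map_one, map_mul, aeval_C, map_pow, aeval_X] at hz
  simp only [Algebra.smul_def]
  rw [sub_eq_iff_eq_add.1 hz, add_smul, mul_comm, mul_smul, hf, smul_zero, zero_add]

theorem prod_prod_one_sub_smul_eq {σ : Type*}
    (hpoly : (X : ℝ[X]) ^ N ∣ ∏ P ∈ T, (1 - C (p P) * X ^ n P) - (1 - X)) (S : Finset σ)
    (z : σ → 𝒜) (f : E) (hf : ∀ s ∈ S, z s ^ N • f = 0) :
    (∏ P ∈ T, ∏ s ∈ S, (1 - p P • z s ^ n P)) • f = (∏ s ∈ S, (1 - z s)) • f := by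
  classical
  rw [Finset.prod_comm]
  induction S using Finset.induction_on with
  | empty => simp
  | insert a S ha ih =>
    have hvanish : z a ^ N • ((∏ s ∈ S, (1 - z s)) • f) = 0 := by
      rw [smul_comm, hf a (Finset.mem_insert_self _ _), smul_zero]
    rw [Finset.prod_insert ha, Finset.prod_insert ha, mul_smul,
      ih fun s hs => hf s (Finset.mem_insert_of_mem hs), prod_one_sub_smul_eq hpoly hvanish,
      ← mul_smul]

end Truncation

section Cutoff

namespace IsCutoff

variable {χ : ℝ → ℝ}

theorem hasCompactSupport (hχ : IsCutoff χ) : HasCompactSupport χ :=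
  HasCompactSupport.of_support_subset_isCompact isCompact_Icc hχ.support_subset

theorem eqOn_Ioi_zero (hχ : IsCutoff χ) : Set.EqOn χ 0 (Set.Ioi 1) := fun _ hx =>
  Function.notMem_support.1 fun h => (hχ.support_subset h).2.not_gt hx

theorem eq_zero (hχ : IsCutoff χ) {x : ℝ} (hx : 1 ≤ x) : χ x = 0 := by
  have h := hχ.eqOn_Ioi_zero.closure hχ.smooth.continuous continuous_const
  rw [closure_Ioi] at h
  exact h hx

theorem contDiff_deriv (hχ : IsCutoff χ) : ContDiff ℝ ∞ (deriv χ) :=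
  ((contDiff_infty_iff_deriv (f := χ)).1 hχ.smooth).2

theorem differentiable (hχ : IsCutoff χ) : Differentiable ℝ χ :=
  hχ.smooth.differentiable (by simp)

theorem differentiable_deriv (hχ : IsCutoff χ) : Differentiable ℝ (deriv χ) :=
  hχ.contDiff_deriv.differentiable (by simp)

theorem exists_bound (hχ : IsCutoff χ) : ∃ L : ℝ, 1 ≤ L ∧ (∀ x, |χ x| ≤ L) ∧
    (∀ x, |deriv χ x| ≤ L) ∧ ∀ x, |deriv (deriv χ) x| ≤ L := by
  obtain ⟨A, hA⟩ := hχ.hasCompactSupport.exists_bound_of_continuous hχ.smooth.continuous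
  obtain ⟨B, hB⟩ := hχ.hasCompactSupport.deriv.exists_bound_of_continuous
    hχ.contDiff_deriv.continuous
  obtain ⟨C, hC⟩ := hχ.hasCompactSupport.deriv.deriv.exists_bound_of_continuous
    (hχ.contDiff_deriv.continuous_deriv (by simp))
  refine ⟨max 1 (max A (max B C)), le_max_left _ _, fun x => (hA x).trans ?_,
    fun x => (hB x).trans ?_, fun x => (hC x).trans ?_⟩ <;> simp

theorem deriv_eq_zero (hχ : IsCutoff χ) {x : ℝ} (hx : 1 ≤ x) : deriv χ x = 0 := by
  have h := (hχ.eqOn_Ioi_zero.deriv isOpen_Ioi).closure hχ.contDiff_deriv.continuous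
    (by simp only [Pi.zero_def, deriv_const']; exact continuous_const)
  rw [closure_Ioi] at h
  simpa using h hx

open MeasureTheory intervalIntegral in
theorem integral_deriv_sq (hχ : IsCutoff χ) {a : ℝ} (ha : 1 ≤ a) :
    ∫ x in (0 : ℝ)..a, deriv χ x ^ 2 = 1 := by
  rw [← hχ.integral_eq, integral_of_le (by linarith),
    ← Set.Ioc_union_Ioi_eq_Ioi (show (0 : ℝ) ≤ a by linarith)]
  refine (setIntegral_eq_of_subset_of_forall_sdiff_eq_zero
    (measurableSet_Ioc.union measurableSet_Ioi) Set.subset_union_left ?_).symm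
  rintro x ⟨hx | hx, hx'⟩
  · exact absurd hx hx'
  · rw [hχ.deriv_eq_zero (ha.trans (le_of_lt hx)), zero_pow two_ne_zero]

end IsCutoff

theorem abs_sub_le_of_abs_deriv_le {f : ℝ → ℝ} {L : ℝ} (hf : Differentiable ℝ f)
    (hL : ∀ x, |deriv f x| ≤ L) (x y : ℝ) : |f y - f x| ≤ L * |y - x| :=
  convex_univ.norm_image_sub_le_of_norm_deriv_le (fun x _ => hf x) (fun x _ => hL x)
    (Set.mem_univ x) (Set.mem_univ y)

theorem abs_second_difference_le {f : ℝ → ℝ} {L : ℝ} (hf : Differentiable ℝ f)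
    (hf' : Differentiable ℝ (deriv f)) (hL : ∀ x, |deriv (deriv f) x| ≤ L) (x : ℝ) {u : ℝ}
    (hu : 0 ≤ u) : |(f (x + u) - f (x + u + u)) - (f x - f (x + u))| ≤ L * u * u := by
  have hdiff : Differentiable ℝ fun y => f y - f (y + u) :=
    hf.sub (hf.comp (differentiable_id.add_const u))
  have hderiv : ∀ y, |deriv (fun y => f y - f (y + u)) y| ≤ L * u := fun y => by
    have h := abs_sub_le_of_abs_deriv_le hf' hL y (y + u)
    rwa [add_sub_cancel_left, abs_of_nonneg hu, abs_sub_comm,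
      ← ((hf y).hasDerivAt.sub ((hf (y + u)).hasDerivAt.comp_add_const y u)).deriv] at h
  simpa only [add_sub_cancel_left, abs_of_nonneg hu] using
    abs_sub_le_of_abs_deriv_le hdiff hderiv x (x + u)

theorem abs_sq_slope_mul_sub_integral_le {f : ℝ → ℝ} {L : ℝ} (hf : Differentiable ℝ f)
    (hf' : Differentiable ℝ (deriv f)) (h₁ : ∀ x, |deriv f x| ≤ L)
    (h₂ : ∀ x, |deriv (deriv f) x| ≤ L) (x : ℝ) {u : ℝ} (hu : 0 < u) :
    |((f (x + u) - f x) / u) ^ 2 * u - ∫ y in x..(x + u), deriv f y ^ 2| ≤ 2 * L ^ 2 * u * u := by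
  have hL : 0 ≤ L := (abs_nonneg _).trans (h₁ 0)
  obtain ⟨ξ, hξ, hξ'⟩ := exists_deriv_eq_slope f (show x < x + u by linarith)
    hf.continuous.continuousOn hf.differentiableOn
  rw [add_sub_cancel_left] at hξ'
  have hconst : ((f (x + u) - f x) / u) ^ 2 * u = ∫ _y in x..(x + u), deriv f ξ ^ 2 := by
    rw [intervalIntegral.integral_const, add_sub_cancel_left, hξ', smul_eq_mul, mul_comm]
  have hpoint : ∀ y ∈ Set.uIoc x (x + u), ‖deriv f ξ ^ 2 - deriv f y ^ 2‖ ≤ 2 * L ^ 2 * u := by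
    intro y hy
    rw [Set.uIoc_of_le (by linarith)] at hy
    have hadd : |deriv f ξ + deriv f y| ≤ 2 * L :=
      (abs_add_le _ _).trans (by linarith [h₁ ξ, h₁ y])
    have hsub : |deriv f ξ - deriv f y| ≤ L * u := by
      refine (abs_sub_le_of_abs_deriv_le hf' h₂ y ξ).trans (mul_le_mul_of_nonneg_left ?_ hL)
      rw [abs_le]
      constructor <;> linarith [hy.1, hy.2, hξ.1, hξ.2]
    calc ‖deriv f ξ ^ 2 - deriv f y ^ 2‖ ≤ 2 * L * (L * u) := by
          rw [Real.norm_eq_abs, sq_sub_sq, abs_mul]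
          exact mul_le_mul hadd hsub (abs_nonneg _) (by positivity)
      _ = 2 * L ^ 2 * u := by ring
  have hcont : Continuous fun y => deriv f y ^ 2 := hf'.continuous.pow 2
  rw [hconst, ← intervalIntegral.integral_sub (by simp) (hcont.intervalIntegrable _ _)]
  simpa only [add_sub_cancel_left, abs_of_pos hu, Real.norm_eq_abs] using
    intervalIntegral.norm_integral_le_of_norm_le_const hpoint

/-- The forward difference of the rescaled cutoff. -/
noncomputable def cutoffDiff (χ : ℝ → ℝ) (R : ℝ) (n : ℕ) : ℝ :=
  χ (n / R) - χ ((n + 1 : ℕ) / R)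

/-- The autocorrelation of the forward differences of the rescaled cutoff. Its own differences along
the diagonal are the products of forward differences, see `cutoffCorr_sub`. -/
noncomputable def cutoffCorr (χ : ℝ → ℝ) (R : ℝ) (a b : ℕ) : ℝ :=
  ∑ j ∈ Finset.range ⌈R⌉₊, cutoffDiff χ R (a + j) * cutoffDiff χ R (b + j)

section

variable {χ : ℝ → ℝ} {R : ℝ}

theorem cutoffDiff_eq_zero (hχ : IsCutoff χ) (hR : 0 < R) {n : ℕ} (hn : R ≤ n) :
    cutoffDiff χ R n = 0 := by
  have h1 : 1 ≤ (n : ℝ) / R := (one_le_div hR).2 hn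
  have h2 : 1 ≤ ((n + 1 : ℕ) : ℝ) / R := (one_le_div hR).2 (by push_cast; linarith)
  rw [cutoffDiff, hχ.eq_zero h1, hχ.eq_zero h2, sub_zero]

theorem cutoffCorr_sub (hχ : IsCutoff χ) (hR : 0 < R) (a b : ℕ) :
    cutoffCorr χ R a b - cutoffCorr χ R (a + 1) (b + 1) = cutoffDiff χ R a * cutoffDiff χ R b := by
  have h := Finset.sum_range_sub' (fun j => cutoffDiff χ R (a + j) * cutoffDiff χ R (b + j)) ⌈R⌉₊
  have h0 : cutoffDiff χ R (a + ⌈R⌉₊) = 0 := cutoffDiff_eq_zero hχ hR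
    ((Nat.le_ceil R).trans (Nat.cast_le.2 (Nat.le_add_left _ a)))
  rw [h0, zero_mul, sub_zero, add_zero, add_zero, Finset.sum_sub_distrib] at h
  rw [← h, cutoffCorr, cutoffCorr]
  congr 1
  exact Finset.sum_congr rfl fun j _ => by
    rw [add_right_comm a, add_right_comm b, add_assoc, add_assoc]

theorem cutoffCorr_eq_zero_left (hχ : IsCutoff χ) (hR : 0 < R) {a : ℕ} (ha : R ≤ a) (b : ℕ) :
    cutoffCorr χ R a b = 0 :=
  Finset.sum_eq_zero fun j _ => by
    have haj : R ≤ (a + j : ℕ) := ha.trans (Nat.cast_le.2 (Nat.le_add_right a j))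
    rw [cutoffDiff_eq_zero hχ hR haj, zero_mul]

theorem cutoffCorr_comm (a b : ℕ) : cutoffCorr χ R a b = cutoffCorr χ R b a :=
  Finset.sum_congr rfl fun _ _ => mul_comm _ _

variable {L : ℝ}

theorem abs_cutoffDiff_le (hχ : IsCutoff χ) (hR : 1 ≤ R) (h1 : ∀ x, |deriv χ x| ≤ L) (n : ℕ) :
    |cutoffDiff χ R n| ≤ L / R := by
  have h := abs_sub_le_of_abs_deriv_le hχ.differentiable h1 ((n + 1 : ℕ) / R) (n / R)
  refine h.trans (le_of_eq ?_)
  rw [← sub_div, abs_div, abs_of_nonneg (by linarith : 0 ≤ R)]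
  push_cast
  rw [sub_add_cancel_left, abs_neg, abs_one, mul_one_div]

theorem abs_cutoffDiff_succ_sub_le (hχ : IsCutoff χ) (hR : 1 ≤ R)
    (h2 : ∀ x, |deriv (deriv χ) x| ≤ L) (n : ℕ) :
    |cutoffDiff χ R (n + 1) - cutoffDiff χ R n| ≤ L / R ^ 2 := by
  have h := abs_second_difference_le hχ.differentiable hχ.differentiable_deriv h2 (n / R)
    (u := 1 / R) (by positivity)
  have e1 : (n : ℝ) / R + 1 / R = ((n + 1 : ℕ) : ℝ) / R := by push_cast; ring
  have e2 : ((n + 1 : ℕ) : ℝ) / R + 1 / R = ((n + 1 + 1 : ℕ) : ℝ) / R := by push_cast; ring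
  rw [e1, e2] at h
  refine h.trans (le_of_eq ?_)
  field_simp

theorem ceil_le_two_mul (hR : 1 ≤ R) : (⌈R⌉₊ : ℝ) ≤ 2 * R := by
  linarith [Nat.ceil_lt_add_one (by linarith : 0 ≤ R)]

theorem abs_cutoffCorr_le (hχ : IsCutoff χ) (hR : 1 ≤ R) (h1 : ∀ x, |deriv χ x| ≤ L) (a b : ℕ) :
    |cutoffCorr χ R a b| ≤ 2 * L ^ 2 / R := by
  have hL : 0 ≤ L := (abs_nonneg _).trans (h1 0)
  have : 0 < R := by linarith
  calc _ ≤ ∑ _j ∈ Finset.range ⌈R⌉₊, L / R * (L / R) := by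
        refine (Finset.abs_sum_le_sum_abs _ _).trans (Finset.sum_le_sum fun _ _ => ?_)
        rw [abs_mul]
        exact mul_le_mul (abs_cutoffDiff_le hχ hR h1 _) (abs_cutoffDiff_le hχ hR h1 _)
          (abs_nonneg _) (by positivity)
    _ = ⌈R⌉₊ * (L / R * (L / R)) := by simp
    _ ≤ 2 * R * (L / R * (L / R)) :=
        mul_le_mul_of_nonneg_right (ceil_le_two_mul hR) (by positivity)
    _ = _ := by field_simp

theorem abs_cutoffCorr_succ_sub_le (hχ : IsCutoff χ) (hR : 1 ≤ R) (h1 : ∀ x, |deriv χ x| ≤ L)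
    (h2 : ∀ x, |deriv (deriv χ) x| ≤ L) (a b : ℕ) :
    |cutoffCorr χ R (a + 1) b - cutoffCorr χ R a b| ≤ 2 * L ^ 2 / R / R := by
  have hL : 0 ≤ L := (abs_nonneg _).trans (h1 0)
  have : 0 < R := by linarith
  calc _ ≤ ∑ j ∈ Finset.range ⌈R⌉₊, L / R ^ 2 * (L / R) := by
        rw [cutoffCorr, cutoffCorr, ← Finset.sum_sub_distrib]
        refine (Finset.abs_sum_le_sum_abs _ _).trans (Finset.sum_le_sum fun j _ => ?_)
        rw [← sub_mul, abs_mul, add_right_comm]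
        exact mul_le_mul (abs_cutoffDiff_succ_sub_le hχ hR h2 _) (abs_cutoffDiff_le hχ hR h1 _)
          (abs_nonneg _) (by positivity)
    _ = ⌈R⌉₊ * (L / R ^ 2 * (L / R)) := by simp
    _ ≤ 2 * R * (L / R ^ 2 * (L / R)) :=
        mul_le_mul_of_nonneg_right (ceil_le_two_mul hR) (by positivity)
    _ = _ := by field_simp

theorem abs_mul_cutoffDiff_sq_sub_integral_le (hχ : IsCutoff χ) (hR : 1 ≤ R)
    (h1 : ∀ x, |deriv χ x| ≤ L) (h2 : ∀ x, |deriv (deriv χ) x| ≤ L) (j : ℕ) :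
    |R * (cutoffDiff χ R j * cutoffDiff χ R j) -
      ∫ x in ((j : ℝ) / R)..((j + 1 : ℕ) / R), deriv χ x ^ 2| ≤ 2 * L ^ 2 / R * (1 / R) := by
  have hR0 : 0 < R := by linarith
  have h := abs_sq_slope_mul_sub_integral_le hχ.differentiable hχ.differentiable_deriv h1 h2 (j / R)
    (one_div_pos.2 hR0)
  have hend : (j : ℝ) / R + 1 / R = (j + 1 : ℕ) / R := by push_cast; ring
  have hslope : ((χ ((j + 1 : ℕ) / R) - χ (j / R)) / (1 / R)) ^ 2 * (1 / R) =
      R * (cutoffDiff χ R j * cutoffDiff χ R j) := by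
    rw [cutoffDiff]
    field_simp
    ring
  rw [hend, hslope] at h
  exact h.trans_eq (by ring)

open MeasureTheory intervalIntegral in
theorem abs_mul_cutoffCorr_sub_one_le (hχ : IsCutoff χ) (hR : 1 ≤ R)
    (h1 : ∀ x, |deriv χ x| ≤ L) (h2 : ∀ x, |deriv (deriv χ) x| ≤ L) :
    |R * cutoffCorr χ R 0 0 - 1| ≤ 4 * L ^ 2 / R := by
  have hR0 : 0 < R := by linarith
  have hcont : Continuous fun x => deriv χ x ^ 2 := hχ.contDiff_deriv.continuous.pow 2
  have hcells : ∑ j ∈ Finset.range ⌈R⌉₊,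
      ∫ x in ((j : ℝ) / R)..((j + 1 : ℕ) / R), deriv χ x ^ 2 = 1 := by
    rw [sum_integral_adjacent_intervals (a := fun j : ℕ => (j : ℝ) / R) fun _ _ =>
      hcont.intervalIntegrable _ _]
    simpa using hχ.integral_deriv_sq ((one_le_div hR0).2 (Nat.le_ceil R))
  calc |R * cutoffCorr χ R 0 0 - 1|
      = |∑ j ∈ Finset.range ⌈R⌉₊, (R * (cutoffDiff χ R j * cutoffDiff χ R j) -
          ∫ x in ((j : ℝ) / R)..((j + 1 : ℕ) / R), deriv χ x ^ 2)| := by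
        rw [Finset.sum_sub_distrib, hcells, ← Finset.mul_sum]
        simp only [cutoffCorr, zero_add]
    _ ≤ ∑ j ∈ Finset.range ⌈R⌉₊, 2 * L ^ 2 / R * (1 / R) :=
        (Finset.abs_sum_le_sum_abs _ _).trans (Finset.sum_le_sum fun j _ =>
          abs_mul_cutoffDiff_sq_sub_integral_le hχ hR h1 h2 j)
    _ = ⌈R⌉₊ * (2 * L ^ 2 / R * (1 / R)) := by simp
    _ ≤ 2 * R * (2 * L ^ 2 / R * (1 / R)) :=
        mul_le_mul_of_nonneg_right (ceil_le_two_mul hR) (by positivity)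
    _ = 4 * L ^ 2 / R := by field_simp; ring

end

open MeasureTheory in
theorem integral_Ioi_deriv_sq_pos {f : ℝ → ℝ} (hf : ContDiff ℝ ∞ f) (hcs : HasCompactSupport f)
    {a b : ℝ} (hab : a < b) (hne : f a ≠ f b) : 0 < ∫ x in Set.Ioi a, deriv f x ^ 2 := by
  have hcont : Continuous fun x => deriv f x ^ 2 := (hf.continuous_deriv (by simp)).pow 2
  have hintegrable : Integrable fun x => deriv f x ^ 2 :=
    hcont.integrable_of_hasCompactSupport (by
      simp only [sq]
      exact hcs.deriv.mul_left)
  obtain ⟨ξ, hξ, hslope⟩ := exists_deriv_eq_slope f hab hf.continuous.continuousOn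
    (hf.differentiable (by simp)).differentiableOn
  rw [setIntegral_pos_iff_support_of_nonneg_ae (Eventually.of_forall fun x => sq_nonneg _)
    hintegrable.integrableOn]
  refine (hcont.isOpen_support.inter isOpen_Ioi).measure_pos _ ⟨ξ, ?_, hξ.1⟩
  rw [Function.mem_support, hslope]
  exact pow_ne_zero 2 (div_ne_zero (sub_ne_zero.2 hne.symm) (sub_ne_zero.2 hab.ne'))

theorem IsCutoff.of_normalize {f : ℝ → ℝ} (hf : ContDiff ℝ ∞ f)
    (hsupp : Function.support f ⊆ Set.Icc (-1) 1) (hf0 : 0 < f 0)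
    (hpos : 0 < ∫ x in Set.Ioi (0 : ℝ), deriv f x ^ 2) :
    IsCutoff fun x => (√(∫ x in Set.Ioi (0 : ℝ), deriv f x ^ 2))⁻¹ * f x where
  smooth := contDiff_const.mul hf
  support_subset := (Function.support_mul_subset_right _ _).trans hsupp
  pos := mul_pos (inv_pos.2 (Real.sqrt_pos.2 hpos)) hf0
  integral_eq := by
    have hderiv : ∀ x, deriv (fun x => (√(∫ x in Set.Ioi (0 : ℝ), deriv f x ^ 2))⁻¹ * f x) x ^ 2 =
        (∫ x in Set.Ioi (0 : ℝ), deriv f x ^ 2)⁻¹ * deriv f x ^ 2 := fun x => by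
      rw [deriv_const_mul _ ((hf.differentiable (by simp)) x), mul_pow, inv_pow,
        Real.sq_sqrt hpos.le]
    simp_rw [hderiv]
    rw [MeasureTheory.integral_const_mul, inv_mul_cancel₀ hpos.ne']

theorem exists_isCutoff : ∃ χ : ℝ → ℝ, IsCutoff χ := by
  let f : ContDiffBump (0 : ℝ) := ⟨1 / 2, 1, by norm_num, by norm_num⟩
  have hsupp : Function.support f ⊆ Set.Icc (-1) 1 := by
    rw [f.support_eq, Real.ball_eq_Ioo]
    simpa [f] using Set.Ioo_subset_Icc_self (a := (-1 : ℝ)) (b := 1)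
  have hf0 : f 0 = 1 := f.one_of_mem_closedBall (by simp [f])
  have hf2 : f 2 = 0 := Function.notMem_support.1 fun h => by
    have := (hsupp h).2
    norm_num at this
  exact ⟨_, .of_normalize f.contDiff hsupp (hf0 ▸ one_pos)
    (integral_Ioi_deriv_sq_pos f.contDiff f.hasCompactSupport two_pos (by rw [hf0, hf2]; simp))⟩

end Cutoff

section Sieve

variable {ι κ : Type*} {χ : ℝ → ℝ} {R L : ℝ}

theorem abs_prod_cutoffCorr_le (hχ : IsCutoff χ) (hR : 1 ≤ R) (h1 : ∀ x, |deriv χ x| ≤ L)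
    (s : Finset ι) (x : ι × Bool → ℕ) :
    |∏ i ∈ s, cutoffCorr χ R (x (i, false)) (x (i, true))| ≤ (2 * L ^ 2 / R) ^ s.card := by
  rw [Finset.abs_prod, ← Finset.prod_const]
  exact Finset.prod_le_prod (fun _ _ => abs_nonneg _) fun i _ => abs_cutoffCorr_le hχ hR h1 _ _

variable [Fintype ι]

/-- The tensor product over `ι` of the autocorrelations of the cutoff, a function of two groups of
integer variables. -/
noncomputable def tensorCorr (χ : ℝ → ℝ) (R : ℝ) (x : ι × Bool → ℕ) : ℝ :=
  ∏ i, cutoffCorr χ R (x (i, false)) (x (i, true))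

theorem abs_tensorCorr_le (hχ : IsCutoff χ) (hR : 1 ≤ R) (h1 : ∀ x, |deriv χ x| ≤ L)
    (x : ι × Bool → ℕ) : |tensorCorr χ R x| ≤ (2 * L ^ 2 / R) ^ Fintype.card ι :=
  abs_prod_cutoffCorr_le hχ hR h1 Finset.univ x

theorem abs_tensorCorr_add_single_sub_le [DecidableEq ι] (hχ : IsCutoff χ) (hR : 1 ≤ R)
    (h1 : ∀ x, |deriv χ x| ≤ L) (h2 : ∀ x, |deriv (deriv χ) x| ≤ L) (x : ι × Bool → ℕ)
    (s : ι × Bool) :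
    |tensorCorr χ R (x + Pi.single s 1) - tensorCorr χ R x| ≤
      (2 * L ^ 2 / R) ^ Fintype.card ι / R := by
  obtain ⟨i, b⟩ := s
  set y : ι × Bool → ℕ := x + Pi.single (i, b) 1 with hy
  have hother : ∏ j ∈ Finset.univ.erase i, cutoffCorr χ R (y (j, false)) (y (j, true)) =
      ∏ j ∈ Finset.univ.erase i, cutoffCorr χ R (x (j, false)) (x (j, true)) :=
    Finset.prod_congr rfl fun j hj => by simp [hy, Finset.ne_of_mem_erase hj]
  have hpair : |cutoffCorr χ R (y (i, false)) (y (i, true)) -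
      cutoffCorr χ R (x (i, false)) (x (i, true))| ≤ 2 * L ^ 2 / R / R := by
    cases b
    · simpa [hy] using abs_cutoffCorr_succ_sub_le hχ hR h1 h2 (x (i, false)) (x (i, true))
    · rw [cutoffCorr_comm, cutoffCorr_comm (x (i, false))]
      simpa [hy] using abs_cutoffCorr_succ_sub_le hχ hR h1 h2 (x (i, true)) (x (i, false))
  have hcard : Fintype.card ι = (Finset.univ.erase i).card + 1 :=
    (Finset.card_erase_add_one (Finset.mem_univ i)).symm
  rw [tensorCorr, tensorCorr, ← Finset.mul_prod_erase _ _ (Finset.mem_univ i),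
    ← Finset.mul_prod_erase Finset.univ (fun j => cutoffCorr χ R (x (j, false)) (x (j, true)))
      (Finset.mem_univ i), hother, ← sub_mul, abs_mul]
  calc _ ≤ 2 * L ^ 2 / R / R * (2 * L ^ 2 / R) ^ (Finset.univ.erase i).card :=
        mul_le_mul hpair (abs_prod_cutoffCorr_le hχ hR h1 _ x) (abs_nonneg _) (by positivity)
    _ = _ := by rw [hcard, pow_succ]; ring

theorem translation_single_pow_smul_eq_zero {σ : Type*} [Finite σ] [DecidableEq σ] {s : σ} {N : ℕ}
    {f : BoundedFunction (σ → ℕ)} (hf : ∀ x, N ≤ x s → f x = 0) :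
    translation (Pi.single s 1 : σ → ℕ) ^ N • f = 0 := by
  refine BoundedFunction.ext fun x => ?_
  rw [← translation_nsmul, translation_smul_apply, BoundedFunction.zero_apply]
  exact hf _ (by simp)

section

variable [DecidableEq ι] {T : Finset κ} {n : κ → ℕ} {p : κ → ℝ} {N : ℕ}

theorem prod_slotFactor_translation_smul_apply (hχ : IsCutoff χ) (hR : 0 < R) (hRN : R ≤ N)
    (hpoly : (X : ℝ[X]) ^ N ∣ ∏ P ∈ T, (1 - C (p P) * X ^ n P) - (1 - X))
    {f : BoundedFunction (ι × Bool → ℕ)} (hf : ∀ x, f x = ∏ s, χ (x s / R)) (x : ι × Bool → ℕ) :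
    ((∏ P ∈ T, slotFactor (p P) fun s => translation (Pi.single s 1 : ι × Bool → ℕ) ^ n P) • f) x =
      ∏ s, cutoffDiff χ R (x s) := by
  unfold slotFactor
  rw [prod_prod_one_sub_smul_eq hpoly, prod_one_sub_translation_smul_apply
    (ρ := fun s x => χ (x s / R)) (fun s t x hst => by simp [hst.symm]) hf]
  · simp [cutoffDiff]
  · refine fun s _ => translation_single_pow_smul_eq_zero fun x hx => ?_
    rw [hf]
    exact Finset.prod_eq_zero (Finset.mem_univ s)
      (hχ.eq_zero ((one_le_div hR).2 (hRN.trans (Nat.cast_le.2 hx))))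

theorem prod_pairFactor_translation_smul_apply (hχ : IsCutoff χ) (hR : 0 < R) (hRN : R ≤ N)
    (hpoly : (X : ℝ[X]) ^ N ∣ ∏ P ∈ T, (1 - C (p P) * X ^ n P) - (1 - X))
    {F : BoundedFunction (ι × Bool → ℕ)} (hF : ∀ x, F x = tensorCorr χ R x) (x : ι × Bool → ℕ) :
    ((∏ P ∈ T, pairFactor (p P) fun s => translation (Pi.single s 1 : ι × Bool → ℕ) ^ n P) • F) x =
      ∏ s, cutoffDiff χ R (x s) := by
  have hvanish : ∀ i, translation (Pi.single (i, false) 1 : ι × Bool → ℕ) ^ N • F = 0 := fun i =>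
    translation_single_pow_smul_eq_zero fun x hx => by
      rw [hF]
      exact Finset.prod_eq_zero (Finset.mem_univ i)
        (cutoffCorr_eq_zero_left hχ hR (hRN.trans (Nat.cast_le.2 hx)) _)
  obtain ⟨v, hv⟩ : ∃ v : ι → ι × Bool → ℕ,
    ∀ i, v i = Pi.single (i, false) 1 + Pi.single (i, true) 1 := ⟨_, fun _ => rfl⟩
  have hdiff : ∀ i, cutoffCorr χ R (x (i, false)) (x (i, true)) -
      cutoffCorr χ R ((x + v i) (i, false)) ((x + v i) (i, true)) =
        cutoffDiff χ R (x (i, true)) * cutoffDiff χ R (x (i, false)) := fun i => by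
    rw [mul_comm, ← cutoffCorr_sub hχ hR, hv]
    simp
  have hinvariant : ∀ i j (y : ι × Bool → ℕ), i ≠ j →
      cutoffCorr χ R ((y + v i) (j, false)) ((y + v i) (j, true)) =
        cutoffCorr χ R (y (j, false)) (y (j, true)) := fun i j y hij => by
    rw [hv]
    simp [hij.symm]
  have hfactor : ∏ P ∈ T, pairFactor (p P) (fun s =>
      translation (Pi.single s 1 : ι × Bool → ℕ) ^ n P) =
      ∏ P ∈ T, ∏ i, (1 - p P • translation (v i) ^ n P) := by
    unfold pairFactor
    simp_rw [← mul_pow, ← translation_add, ← hv]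
  rw [hfactor, prod_prod_one_sub_smul_eq hpoly Finset.univ (fun i => translation (v i)) F,
    prod_one_sub_translation_smul_apply hinvariant hF, Fintype.prod_prod_type]
  · exact Finset.prod_congr rfl fun i _ => by rw [hdiff, Fintype.prod_bool]
  · intro i _
    rw [hv, translation_add, mul_pow, mul_comm, mul_smul, hvanish, smul_zero]

theorem prod_slotFactor_smul_eq_prod_pairFactor_smul (hχ : IsCutoff χ) (hR : 0 < R) (hRN : R ≤ N)
    (hpoly : (X : ℝ[X]) ^ N ∣ ∏ P ∈ T, (1 - C (p P) * X ^ n P) - (1 - X))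
    {f F : BoundedFunction (ι × Bool → ℕ)} (hf : ∀ x, f x = ∏ s, χ (x s / R))
    (hF : ∀ x, F x = tensorCorr χ R x) :
    (∏ P ∈ T, slotFactor (p P) fun s => translation (Pi.single s 1 : ι × Bool → ℕ) ^ n P) • f =
      (∏ P ∈ T, pairFactor (p P) fun s => translation (Pi.single s 1 : ι × Bool → ℕ) ^ n P) • F :=
  BoundedFunction.ext fun x => by
    rw [prod_slotFactor_translation_smul_apply hχ hR hRN hpoly hf,
      prod_pairFactor_translation_smul_apply hχ hR hRN hpoly hF]

end

/-- The sum over the divisors, in each of the slots `ι × Bool`, that arises from expanding the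
average of a product of squared truncated divisor sums with local densities `c`. -/
noncomputable def sieveSum [DecidableEq ι] [DecidableEq κ] (T : Finset κ) (n : κ → ℕ)
    (c : κ → Finset ι → ℝ) (χ : ℝ → ℝ) (R : ℝ) : ℝ :=
  ∑ B : T → Finset (ι × Bool), (∏ P : T, ((-1) ^ (B P).card * c P ((B P).image Prod.fst))) *
    ∏ s, χ ((∑ P : T, if s ∈ B P then n P else 0 : ℕ) / R)

theorem prod_eulerFactor_smul_apply_zero_eq_sieveSum [DecidableEq ι] [DecidableEq κ] (T : Finset κ)
    (n : κ → ℕ) (c : κ → Finset ι → ℝ) {f : BoundedFunction (ι × Bool → ℕ)}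
    (hf : ∀ x, f x = ∏ s, χ (x s / R)) :
    ((∏ P ∈ T, eulerFactor (c P) fun s => translation (Pi.single s 1 : ι × Bool → ℕ) ^ n P) • f)
      0 = sieveSum T n c χ R := by
  rw [prod_eulerFactor_translation_smul_apply_zero, sieveSum]
  simp only [hf, Finset.sum_apply, Pi.smul_apply, Pi.single_apply, Finset.sum_ite_eq, smul_eq_mul,
    mul_ite, mul_one, mul_zero]

theorem exists_abs_sieveSum_sub_le [DecidableEq ι] [DecidableEq κ] (hχ : IsCutoff χ) (n : κ → ℕ)
    (p : κ → ℝ) (hp0 : ∀ P, 0 ≤ p P) (hp : ∀ P, p P ≤ 1 / 2) :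
    ∃ M : ℝ, 0 ≤ M ∧ ∀ S : Finset κ, ∃ K : ℝ, 0 ≤ K ∧
      ∀ (T : Finset κ) (c : κ → Finset ι → ℝ) (e : κ → ℝ), IsSieveDensity S T c p e →
      ∀ (R L : ℝ) (N : ℕ), 1 ≤ R → R ≤ N →
      (X : ℝ[X]) ^ N ∣ ∏ P ∈ T, (1 - C (p P) * X ^ n P) - (1 - X) → ∑ P ∈ T \ S, e P ≤ L →
      |R ^ Fintype.card ι * (∏ P ∈ S, (1 - p P)) ^ Fintype.card ι * sieveSum T n c χ R -
        (R * cutoffCorr χ R 0 0) ^ Fintype.card ι| ≤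
      (Real.exp (40 * 64 ^ Fintype.card ι * L) - 1) * M +
        Real.exp (40 * 64 ^ Fintype.card ι * L) * (K / R) := by
  obtain ⟨L₀, -, h0, h1, h2⟩ := hχ.exists_bound
  refine ⟨(2 * L₀ ^ 2) ^ Fintype.card ι, by positivity, fun S => ?_⟩
  obtain ⟨K, hK0, hK⟩ := exists_norm_prod_eulerFactor_smul_sub_le
    (E := BoundedFunction (ι × Bool → ℕ))
    (Z := fun s => translation (Pi.single s 1 : ι × Bool → ℕ)) (fun _ => norm_translation_le _)
    S n p hp0 hp
  refine ⟨K * (2 * L₀ ^ 2) ^ Fintype.card ι, by positivity, ?_⟩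
  intro T c e hc R L N hR hRN hpoly hL
  have hR0 : 0 < R := by linarith
  let f : BoundedFunction (ι × Bool → ℕ) := .ofBound (fun x => ∏ s, χ (x s / R)) (∏ _s, L₀)
    fun x => by
      rw [Finset.abs_prod]
      exact Finset.prod_le_prod (fun _ _ => abs_nonneg _) fun s _ => h0 _
  let F : BoundedFunction (ι × Bool → ℕ) := .ofBound (tensorCorr χ R) _
    (abs_tensorCorr_le hχ hR h1)
  have hdiff : ∀ s, ‖(translation (Pi.single s 1 : ι × Bool → ℕ) - 1) • F‖ ≤
      (2 * L₀ ^ 2 / R) ^ Fintype.card ι / R := fun s =>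
    BoundedFunction.norm_le (by positivity) fun x => by
      rw [sub_smul, one_smul, BoundedFunction.sub_apply, translation_smul_apply]
      exact abs_tensorCorr_add_single_sub_le hχ hR h1 h2 x s
  have hbound := (BoundedFunction.abs_apply_le_norm _ 0).trans (hK T c e hc f F _ _ L
    (prod_slotFactor_smul_eq_prod_pairFactor_smul hχ hR0 hRN hpoly
      (BoundedFunction.ofBound_apply _ _ _) (BoundedFunction.ofBound_apply _ _ _))
    (BoundedFunction.norm_le (by positivity) (abs_tensorCorr_le hχ hR h1)) hdiff hL)
  have hF0 : F 0 = cutoffCorr χ R 0 0 ^ Fintype.card ι := by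
    simp [F, BoundedFunction.ofBound_apply, tensorCorr]
  rw [BoundedFunction.sub_apply, BoundedFunction.smul_apply,
    prod_eulerFactor_smul_apply_zero_eq_sieveSum T n c (BoundedFunction.ofBound_apply _ _ _),
    hF0] at hbound
  calc _ = R ^ Fintype.card ι * |(∏ P ∈ S, (1 - p P)) ^ Fintype.card ι * sieveSum T n c χ R -
        cutoffCorr χ R 0 0 ^ Fintype.card ι| := by
        rw [← abs_of_pos (pow_pos hR0 (Fintype.card ι)), ← abs_mul, abs_of_pos (pow_pos hR0 _),
          mul_sub, mul_assoc, mul_pow]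
    _ ≤ _ := mul_le_mul_of_nonneg_left hbound (by positivity)
    _ = _ := by rw [div_pow]; field_simp

end Sieve

/-- The monic irreducible polynomials. -/
abbrev MonicIrr (F : Type*) [Field F] : Type _ := {P : F[X] // P.Monic ∧ Irreducible P}

section Primes

variable {F : Type*} [Field F]

namespace MonicIrr

variable (P Q : MonicIrr F)

theorem monic : P.1.Monic := P.2.1

theorem irreducible : Irreducible P.1 := P.2.2

theorem prime : Prime P.1 := P.2.2.prime

/-- The degree of a monic irreducible polynomial. -/
noncomputable def deg : ℕ := P.1.natDegree

theorem deg_pos : 0 < P.deg := P.irreducible.natDegree_pos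

theorem isCoprime {P Q : MonicIrr F} (h : P ≠ Q) : IsCoprime P.1 Q.1 := by
  rw [P.irreducible.coprime_iff_not_dvd]
  exact fun hd => h (Subtype.ext (eq_of_monic_of_associated P.monic Q.monic
    (P.irreducible.associated_of_dvd Q.irreducible hd)))

theorem prod_dvd_iff (S : Finset (MonicIrr F)) (f : F[X]) :
    ∏ P ∈ S, P.1 ∣ f ↔ ∀ P ∈ S, P.1 ∣ f :=
  ⟨fun h _ hP => (Finset.dvd_prod_of_mem _ hP).trans h,
    Finset.prod_dvd_of_coprime fun _ _ _ _ hPQ => isCoprime hPQ⟩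

theorem dvd_prod_iff (S : Finset (MonicIrr F)) : P.1 ∣ ∏ Q ∈ S, Q.1 ↔ P ∈ S := by
  refine ⟨fun h => ?_, fun h => Finset.dvd_prod_of_mem _ h⟩
  obtain ⟨Q, hQ, hd⟩ := P.prime.exists_mem_finset_dvd h
  by_contra hP
  have hne : P ≠ Q := fun h => hP (h ▸ hQ)
  exact P.irreducible.not_isUnit ((isCoprime hne).isUnit_of_dvd' dvd_rfl hd)

theorem monic_prod (S : Finset (MonicIrr F)) : (∏ P ∈ S, P.1).Monic :=
  monic_prod_of_monic _ _ fun P _ => P.monic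

theorem natDegree_prod (S : Finset (MonicIrr F)) :
    (∏ P ∈ S, P.1).natDegree = ∑ P ∈ S, P.deg :=
  natDegree_prod_of_monic _ _ fun P _ => P.monic

theorem moebius_prod (S : Finset (MonicIrr F)) :
    UniqueFactorizationMonoid.moebius (∏ P ∈ S, P.1) = (-1) ^ S.card := by
  classical
  induction S using Finset.induction_on with
  | empty => simp
  | insert P S hP ih =>
    rw [Finset.prod_insert hP, Finset.card_insert_of_notMem hP, IsRelPrime.moebius_mul, ih,
      P.irreducible.moebius_eq, pow_succ']
    refine (IsCoprime.prod_right fun Q hQ => isCoprime ?_).isRelPrime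
    rintro rfl
    exact hP hQ

theorem exists_dvd {f : F[X]} (hf : ¬ IsUnit f) : ∃ P : MonicIrr F, P.1 ∣ f := by
  obtain ⟨P, hP, hi, hd⟩ := exists_monic_irreducible_factor f hf
  exact ⟨⟨P, hP, hi⟩, hd⟩

end MonicIrr

variable (F) [Fintype F]

open scoped Classical in
/-- The monic irreducible polynomials of degree less than `N`. -/
noncomputable def primesLT (N : ℕ) : Finset (MonicIrr F) :=
  (polysLT F N).subtype fun P => P.Monic ∧ Irreducible P

variable {F}

theorem mem_primesLT {N : ℕ} {P : MonicIrr F} : P ∈ primesLT F N ↔ P.deg < N := by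
  classical
  rw [primesLT, Finset.mem_subtype, mem_polysLT, degree_eq_natDegree P.monic.ne_zero, Nat.cast_lt]
  rfl

theorem primesLT_mono {M N : ℕ} (h : M ≤ N) : primesLT F M ⊆ primesLT F N := fun _ hP =>
  mem_primesLT.2 ((mem_primesLT.1 hP).trans_le h)

theorem polyPrimorial_eq (w : ℕ) : polyPrimorial F w = ∏ P ∈ primesLT F w, P.1 := by
  classical
  rw [polyPrimorial, primesLT, Finset.prod_subtype_eq_prod_filter (fun x : F[X] => x)]

theorem card_polysLT (N : ℕ) : (polysLT F N).card = Fintype.card F ^ N := by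
  classical
  rw [polysLT, Finset.card_image_of_injective, Finset.card_univ, Fintype.card_fun, Fintype.card_fin]
  exact fun a b h => (degreeLTEquiv F N).symm.injective (Subtype.ext h)

theorem two_le_card : 2 ≤ Fintype.card F := Fintype.one_lt_card

/-- The inverse of the norm `|P| = q ^ deg P`. -/
noncomputable def invNorm (P : MonicIrr F) : ℝ := ((Fintype.card F : ℝ) ^ P.deg)⁻¹

theorem invNorm_pos (P : MonicIrr F) : 0 < invNorm P :=
  inv_pos.2 (pow_pos (Nat.cast_pos.2 Fintype.card_pos) _)

theorem invNorm_le_half_pow (P : MonicIrr F) : invNorm P ≤ (1 / 2) ^ P.deg := by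
  have h2 : (2 : ℝ) ≤ Fintype.card F := Nat.ofNat_le_cast.2 two_le_card
  rw [invNorm, one_div, inv_pow]
  gcongr

theorem invNorm_le_half (P : MonicIrr F) : invNorm P ≤ 1 / 2 :=
  (invNorm_le_half_pow P).trans (pow_le_of_le_one (by norm_num) (by norm_num) P.deg_pos.ne')

theorem sub_X_pow_mem_polysLT {f : F[X]} (hf : f.Monic) :
    f - X ^ f.natDegree ∈ polysLT F f.natDegree := by
  have hdeg : f.degree = f.natDegree := degree_eq_natDegree hf.ne_zero
  rw [mem_polysLT, ← hdeg]
  exact degree_sub_lt_left (by rw [hdeg, degree_X_pow]) hf.ne_zero (by simp [hf.leadingCoeff])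

theorem card_filter_deg_le (U : Finset (MonicIrr F)) (n : ℕ) :
    (U.filter fun P => P.deg = n).card ≤ Fintype.card F ^ n := by
  rw [← card_polysLT n]
  refine Finset.card_le_card_of_injOn (fun P => P.1 - X ^ n) (fun P hP => ?_)
    fun P _ Q _ h => Subtype.ext (sub_left_injective h)
  obtain rfl : P.deg = n := (Finset.mem_filter.1 hP).2
  exact sub_X_pow_mem_polysLT P.monic

theorem sum_filter_deg_invNorm_sq_le (U : Finset (MonicIrr F)) (n : ℕ) :
    ∑ P ∈ U with P.deg = n, invNorm P ^ 2 ≤ (1 / 2) ^ n := by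
  have : (0 : ℝ) < Fintype.card F := Nat.cast_pos.2 Fintype.card_pos
  have h2 : (2 : ℝ) ≤ Fintype.card F := Nat.ofNat_le_cast.2 two_le_card
  have hcard : ((U.filter fun P => P.deg = n).card : ℝ) ≤ (Fintype.card F : ℝ) ^ n :=
    mod_cast card_filter_deg_le U n
  calc ∑ P ∈ U with P.deg = n, invNorm P ^ 2
      = ∑ P ∈ U with P.deg = n, ((Fintype.card F : ℝ) ^ n)⁻¹ ^ 2 :=
        Finset.sum_congr rfl fun P hP => by rw [invNorm, (Finset.mem_filter.1 hP).2]
    _ = (U.filter fun P => P.deg = n).card * ((Fintype.card F : ℝ) ^ n)⁻¹ ^ 2 := by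
        rw [Finset.sum_const, nsmul_eq_mul]
    _ ≤ (Fintype.card F : ℝ) ^ n * ((Fintype.card F : ℝ) ^ n)⁻¹ ^ 2 := by gcongr
    _ = ((Fintype.card F : ℝ) ^ n)⁻¹ := by field_simp
    _ ≤ (1 / 2) ^ n := by rw [one_div, inv_pow]; gcongr

theorem sum_invNorm_sq_le (U : Finset (MonicIrr F)) (w : ℕ) (hU : ∀ P ∈ U, w ≤ P.deg) :
    ∑ P ∈ U, invNorm P ^ 2 ≤ 2 * (1 / 2) ^ w := by
  have hmaps : ∀ P ∈ U, P.deg ∈ Finset.Ico w (U.sup MonicIrr.deg + 1) := fun P hP =>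
    Finset.mem_Ico.2 ⟨hU P hP, Nat.lt_succ_of_le (Finset.le_sup hP)⟩
  rw [← Finset.sum_fiberwise_of_maps_to hmaps]
  calc _ ≤ ∑ n ∈ Finset.Ico w (U.sup MonicIrr.deg + 1), (1 / 2 : ℝ) ^ n :=
        Finset.sum_le_sum fun n _ => sum_filter_deg_invNorm_sq_le U n
    _ ≤ (1 / 2) ^ w / (1 - 1 / 2) := geom_sum_Ico_le_of_lt_one (by norm_num) (by norm_num)
    _ = 2 * (1 / 2) ^ w := by ring

end Primes

section PrimeProduct

variable {F : Type*} [Field F] [Fintype F]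

theorem natDegree_X_pow_add_of_mem_polysLT {n : ℕ} {g : F[X]} (hg : g ∈ polysLT F n) :
    (X ^ n + g).natDegree = n :=
  natDegree_eq_of_degree_eq_some <| by
    rw [degree_add_eq_left_of_degree_lt (by simpa using mem_polysLT.1 hg), degree_X_pow]

theorem monic_X_pow_add_of_mem_polysLT {n : ℕ} {g : F[X]} (hg : g ∈ polysLT F n) :
    (X ^ n + g).Monic :=
  monic_X_pow_add (mem_polysLT.1 hg)

open scoped Classical in
theorem card_filter_dvd_X_pow_add {D : F[X]} (hD : D.Monic) (n : ℕ) :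
    ((polysLT F n).filter fun g => D ∣ X ^ n + g).card =
      if D.natDegree ≤ n then Fintype.card F ^ (n - D.natDegree) else 0 := by
  split_ifs with h
  · have hdeg : ∀ {E : F[X]}, E.Monic →
        ((D * E).natDegree = n ↔ E.natDegree = n - D.natDegree) := fun hE => by
      rw [hD.natDegree_mul hE]
      omega
    rw [← card_polysLT (F := F)]
    refine (Finset.card_bij (fun g _ => D * (X ^ (n - D.natDegree) + g) - X ^ n) (fun g hg => ?_)
      (fun g _ g' _ h => add_left_cancel (mul_left_cancel₀ hD.ne_zero (sub_left_injective h)))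
      fun g hg => ?_).symm
    · have hmonic := monic_X_pow_add_of_mem_polysLT hg
      have hn := (hdeg hmonic).2 (natDegree_X_pow_add_of_mem_polysLT hg)
      have hmem := sub_X_pow_mem_polysLT (hD.mul hmonic)
      rw [hn] at hmem
      exact Finset.mem_filter.2 ⟨hmem, by rw [add_sub_cancel]; exact dvd_mul_right _ _⟩
    · obtain ⟨hg, E, hE⟩ := Finset.mem_filter.1 hg
      have hmonic : E.Monic := hD.of_mul_monic_left (hE ▸ monic_X_pow_add_of_mem_polysLT hg)
      have hn := (hdeg hmonic).1 (hE ▸ natDegree_X_pow_add_of_mem_polysLT hg)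
      have hmem := sub_X_pow_mem_polysLT hmonic
      rw [hn] at hmem
      exact ⟨E - X ^ (n - D.natDegree), hmem, by rw [add_sub_cancel, ← hE, add_sub_cancel_left]⟩
  · rw [Finset.card_eq_zero, Finset.filter_eq_empty_iff]
    intro g hg hd
    exact h ((natDegree_le_of_dvd hd (monic_X_pow_add_of_mem_polysLT hg).ne_zero).trans_eq
      (natDegree_X_pow_add_of_mem_polysLT hg))

open scoped Classical in
theorem filter_dvd_primesLT_eq_empty_iff {f : F[X]} (hf : f.Monic) {N : ℕ} (hN : f.natDegree < N) :
    ((primesLT F N).filter fun P => P.1 ∣ f) = ∅ ↔ f = 1 := by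
  rw [Finset.filter_eq_empty_iff, ← hf.isUnit_iff]
  refine ⟨fun h => by_contra fun hu => ?_, fun hu P _ hP =>
    P.irreducible.not_isUnit (isUnit_of_dvd_unit hP hu)⟩
  obtain ⟨P, hP⟩ := MonicIrr.exists_dvd hu
  exact h (mem_primesLT.2 ((natDegree_le_of_dvd hP hf.ne_zero).trans_lt hN)) hP

open scoped Classical in
theorem sum_powerset_primesLT_of_forall_dvd {f : F[X]} (hf : f.Monic) {N : ℕ}
    (hN : f.natDegree < N) :
    ∑ S ∈ (primesLT F N).powerset, (if ∀ P ∈ S, P.1 ∣ f then (-1 : ℝ) ^ S.card else 0) =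
      if f = 1 then 1 else 0 := by
  have hfilter : (primesLT F N).powerset.filter (fun S => ∀ P ∈ S, P.1 ∣ f) =
      ((primesLT F N).filter fun P => P.1 ∣ f).powerset := by
    ext S
    simp only [Finset.mem_filter, Finset.mem_powerset, Finset.subset_iff, forall_and]
  have hsum := congrArg (Int.cast (R := ℝ)) (Finset.sum_powerset_neg_one_pow_card
    (x := (primesLT F N).filter fun P => P.1 ∣ f))
  rw [← Finset.sum_filter, hfilter]
  simpa [filter_dvd_primesLT_eq_empty_iff hf hN] using hsum

/-- Möbius inversion, summed over the monic polynomials of degree `n`. -/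
theorem sum_powerset_primesLT_mul_pow {N n : ℕ} (hn : n < N) :
    ∑ S ∈ (primesLT F N).powerset, (-1 : ℝ) ^ S.card *
      (if ∑ P ∈ S, P.deg ≤ n then (Fintype.card F : ℝ) ^ (n - ∑ P ∈ S, P.deg) else 0) =
      if n = 0 then 1 else 0 := by
  classical
  have hcount : ∀ S ∈ (primesLT F N).powerset, (-1 : ℝ) ^ S.card *
      (if ∑ P ∈ S, P.deg ≤ n then (Fintype.card F : ℝ) ^ (n - ∑ P ∈ S, P.deg) else 0) =
      ∑ g ∈ polysLT F n, if ∀ P ∈ S, P.1 ∣ X ^ n + g then (-1 : ℝ) ^ S.card else 0 := fun S _ => by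
    have hcard := congrArg (Nat.cast (R := ℝ))
      (card_filter_dvd_X_pow_add (MonicIrr.monic_prod S) n)
    push_cast [MonicIrr.natDegree_prod] at hcard
    rw [← hcard, ← Finset.sum_filter, Finset.sum_const, nsmul_eq_mul, mul_comm]
    simp only [MonicIrr.prod_dvd_iff]
  have hinner : ∀ g ∈ polysLT F n, ∑ S ∈ (primesLT F N).powerset,
      (if ∀ P ∈ S, P.1 ∣ X ^ n + g then (-1 : ℝ) ^ S.card else 0) =
      if n = 0 then 1 else 0 := fun g hg => by
    have hmonic := monic_X_pow_add_of_mem_polysLT hg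
    have hdeg := natDegree_X_pow_add_of_mem_polysLT hg
    rw [sum_powerset_primesLT_of_forall_dvd hmonic (by rwa [hdeg])]
    exact if_congr (by rw [← hmonic.natDegree_eq_zero, hdeg]) rfl rfl
  rw [Finset.sum_congr rfl hcount, Finset.sum_comm, Finset.sum_congr rfl hinner, Finset.sum_const,
    card_polysLT]
  split_ifs with h0 <;> simp [h0]

theorem coeff_prod_one_sub_invNorm (T : Finset (MonicIrr F)) (d : ℕ) :
    (∏ P ∈ T, (1 - C (invNorm P) * X ^ P.deg)).coeff d =
      ∑ S ∈ T.powerset, if ∑ P ∈ S, P.deg = d then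
        (-1 : ℝ) ^ S.card * ((Fintype.card F : ℝ) ^ d)⁻¹ else 0 := by
  classical
  rw [Finset.prod_sub, finsetSum_coeff]
  refine Finset.sum_congr rfl fun S _ => ?_
  have hsign : ((-1 : ℝ[X]) ^ S.card) = C ((-1) ^ S.card) := by simp
  rw [Finset.prod_const_one, mul_one, Finset.prod_mul_distrib, Finset.prod_pow_eq_pow_sum,
    ← map_prod, hsign, ← mul_assoc, ← C_mul, coeff_C_mul_X_pow]
  simp only [eq_comm (a := d)]
  split_ifs with h
  · rw [← h, ← Finset.prod_pow_eq_pow_sum, ← Finset.prod_inv_distrib]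
    rfl
  · rfl

theorem sum_range_coeff_prod_one_sub_invNorm {N n : ℕ} (hn : n < N) :
    ∑ d ∈ Finset.range (n + 1),
      (∏ P ∈ primesLT F N, (1 - C (invNorm P) * X ^ P.deg)).coeff d = if n = 0 then 1 else 0 := by
  have hq : (Fintype.card F : ℝ) ≠ 0 := Nat.cast_ne_zero.2 Fintype.card_ne_zero
  have hterm : ∀ S ∈ (primesLT F N).powerset, (∑ d ∈ Finset.range (n + 1),
      if ∑ P ∈ S, P.deg = d then (-1 : ℝ) ^ S.card * ((Fintype.card F : ℝ) ^ d)⁻¹ else 0) =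
      ((Fintype.card F : ℝ) ^ n)⁻¹ * ((-1 : ℝ) ^ S.card *
        if ∑ P ∈ S, P.deg ≤ n then (Fintype.card F : ℝ) ^ (n - ∑ P ∈ S, P.deg) else 0) := by
    intro S _
    rw [Finset.sum_ite_eq]
    simp only [Finset.mem_range, Nat.lt_succ_iff]
    split_ifs with h
    · rw [pow_sub₀ _ hq h]
      field_simp
    · simp
  simp only [coeff_prod_one_sub_invNorm]
  rw [Finset.sum_comm, Finset.sum_congr rfl hterm, ← Finset.mul_sum,
    sum_powerset_primesLT_mul_pow hn]
  split_ifs with h0 <;> simp [h0]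

/-- The zeta function of `F[X]` is `1 / (1 - q u)`, so its Euler product, normalized by `u = X / q`,
agrees with `1 - X` up to the degree of the truncation. -/
theorem X_pow_dvd_prod_primesLT (N : ℕ) :
    (X : ℝ[X]) ^ N ∣ ∏ P ∈ primesLT F N, (1 - C (invNorm P) * X ^ P.deg) - (1 - X) := by
  have hsum := fun n => sum_range_coeff_prod_one_sub_invNorm (F := F) (N := N) (n := n)
  rw [X_pow_dvd_iff]
  intro d hd
  rw [coeff_sub, coeff_sub, coeff_one, coeff_X]
  rcases d with _ | _ | n
  · have h0 := hsum 0 hd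
    simp_all
  · have h1 := hsum 1 hd
    have h0 := hsum 0 (by omega)
    rw [Finset.sum_range_succ, h0] at h1
    simp at h1 ⊢
    linarith
  · have h1 := hsum (n + 2) hd
    have h0 := hsum (n + 1) (by omega)
    rw [Finset.sum_range_succ, h0] at h1
    simpa using h1

end PrimeProduct

section DivisorSums

variable {F : Type*} [Field F] [Fintype F]

open scoped Classical in
theorem prod_filter_dvd_primesLT {d : F[X]} (hd : d.Monic) (hsq : Squarefree d) {N : ℕ}
    (hN : d.natDegree < N) : ∏ P ∈ (primesLT F N).filter fun P => P.1 ∣ d, P.1 = d := by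
  set S := (primesLT F N).filter fun P => P.1 ∣ d
  obtain ⟨h, hh⟩ := (MonicIrr.prod_dvd_iff S d).2 fun P hP => (Finset.mem_filter.1 hP).2
  have hunit : IsUnit h := by
    by_contra hu
    obtain ⟨P, hP⟩ := MonicIrr.exists_dvd hu
    have hPd : P.1 ∣ d := hP.trans (Dvd.intro_left _ hh.symm)
    have hPS : P ∈ S := Finset.mem_filter.2
      ⟨mem_primesLT.2 ((natDegree_le_of_dvd hPd hd.ne_zero).trans_lt hN), hPd⟩
    exact P.irreducible.not_isUnit (hsq P.1 (hh ▸ mul_dvd_mul ((P.dvd_prod_iff S).2 hPS) hP))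
  rw [hh, ((MonicIrr.monic_prod S).of_mul_monic_left (hh ▸ hd)).eq_one_of_isUnit hunit, mul_one]

open scoped Classical in
theorem divisorSum_eq_sum_powerset {χ : ℝ → ℝ} (hχ : IsCutoff χ) {R : ℝ} (hR : 0 < R) {N : ℕ}
    (hN : R ≤ N) (f : F[X]) :
    divisorSum χ R f = ∑ S ∈ ((primesLT F N).filter fun P => P.1 ∣ f).powerset,
      (-1) ^ S.card * χ ((∑ P ∈ S, P.deg : ℕ) / R) := by
  unfold divisorSum
  symm
  refine Finset.sum_bij_ne_zero (fun S _ _ => ∏ P ∈ S, P.1) (fun S hS h0 => ?_)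
    (fun S _ _ S' _ _ h => ?_) (fun d hd h0 => ?_) fun S _ _ => ?_
  · have hdeg : ((∑ P ∈ S, P.deg : ℕ) : ℝ) < R := by
      by_contra h
      exact h0 (by rw [hχ.eq_zero ((one_le_div hR).2 (not_lt.1 h)), mul_zero])
    have hmonic := MonicIrr.monic_prod S
    refine Finset.mem_filter.2 ⟨mem_polysLT.2 ?_, hmonic, ?_, ?_⟩
    · rw [degree_eq_natDegree hmonic.ne_zero, MonicIrr.natDegree_prod, Nat.cast_lt]
      exact Nat.lt_ceil.2 hdeg
    · rw [MonicIrr.prod_dvd_iff]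
      exact fun P hP => (Finset.mem_filter.1 (Finset.mem_powerset.1 hS hP)).2
    · rwa [MonicIrr.natDegree_prod]
  · ext P
    rw [← MonicIrr.dvd_prod_iff, ← MonicIrr.dvd_prod_iff, h]
  · obtain ⟨-, hmonic, hdf, hdR⟩ := Finset.mem_filter.1 hd
    have hsq : Squarefree d := by
      by_contra h
      exact h0 (by rw [UniqueFactorizationMonoid.moebius_of_not_squarefree h, Int.cast_zero,
        zero_mul])
    have hprod := prod_filter_dvd_primesLT hmonic hsq (Nat.cast_lt.1 (hdR.trans_le hN))
    refine ⟨(primesLT F N).filter fun P => P.1 ∣ d, Finset.mem_powerset.2 fun P hP => ?_, ?_, hprod⟩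
    · obtain ⟨hPN, hPd⟩ := Finset.mem_filter.1 hP
      exact Finset.mem_filter.2 ⟨hPN, hPd.trans hdf⟩
    · rw [← hprod, MonicIrr.moebius_prod, MonicIrr.natDegree_prod] at h0
      exact_mod_cast h0
  · rw [MonicIrr.moebius_prod, MonicIrr.natDegree_prod]
    push_cast
    rfl

end DivisorSums

section Expectations

theorem expect_comp_surjective {G H : Type*} [AddGroup G] [AddGroup H] [Fintype G] [Fintype H]
    (θ : G →+ H) (hθ : Function.Surjective θ) (f : H → ℝ) : 𝔼 g, f (θ g) = 𝔼 h, f h := by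
  have h1 : ∀ h : H, 𝔼 g, f (h + θ g) = 𝔼 g, f (θ g) := by
    intro h
    obtain ⟨g₀, rfl⟩ := hθ h
    exact Fintype.expect_equiv (Equiv.addLeft g₀) _ _ fun g => by simp
  have h2 : ∀ g : G, 𝔼 h, f (h + θ g) = 𝔼 h, f h := fun g =>
    Fintype.expect_equiv (Equiv.addRight (θ g)) _ _ fun h => by simp
  calc 𝔼 g, f (θ g) = 𝔼 h : H, 𝔼 g, f (h + θ g) := by
        rw [Finset.expect_congr rfl fun h _ => h1 h, Fintype.expect_const]
    _ = 𝔼 g, 𝔼 h : H, f (h + θ g) := Finset.expect_comm _ _ _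
    _ = _ := by rw [Finset.expect_congr rfl fun g _ => h2 g, Fintype.expect_const]

theorem expect_pi_prod {σ : Type*} [Fintype σ] [DecidableEq σ] {κ : σ → Type*}
    [∀ i, Fintype (κ i)] (φ : ∀ i, κ i → ℝ) :
    𝔼 x : (∀ i, κ i), ∏ i, φ i (x i) = ∏ i, 𝔼 y, φ i y := by
  simp only [Fintype.expect_eq_sum_div_card]
  rw [Finset.prod_div_distrib, Finset.prod_univ_sum, Fintype.piFinset_univ, Fintype.card_pi]
  push_cast
  rfl

theorem expect_translate {G : Type*} [AddGroup G] [Fintype G] {H : Type*} [Fintype H] [Nonempty H]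
    (θ : H → G) (f : G → ℝ) : 𝔼 x, f x = 𝔼 x, 𝔼 y, f (x + θ y) := by
  rw [Finset.expect_comm]
  have h : ∀ y, 𝔼 x, f (x + θ y) = 𝔼 x, f x := fun y =>
    Fintype.expect_equiv (Equiv.addRight (θ y)) _ _ fun x => by simp
  rw [Finset.expect_congr rfl fun y _ => h y, Fintype.expect_const]

end Expectations

section FiniteFieldForms

variable {k ι κ : Type*} [Field k] [Fintype κ]

theorem mulVec_surjective_of_linearIndependent [Finite ι] {A : Matrix ι κ k}
    (hA : LinearIndependent k A.row) : Function.Surjective A.mulVec := by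
  have := Fintype.ofFinite ι
  rw [← Matrix.coe_mulVecLin, ← LinearMap.range_eq_top]
  refine Submodule.eq_top_of_finrank_eq ?_
  rw [Module.finrank_fintype_fun_eq_card]
  exact hA.rank_matrix

open scoped Classical in
theorem expect_ite_affine_eq_zero [Fintype k] [Fintype ι] [DecidableEq κ] {A : Matrix ι κ k}
    (hA : LinearIndependent k A.row) (c : ι → k) :
    (𝔼 v : κ → k, if ∀ i, ∑ j, A i j * v j + c i = 0 then (1 : ℝ) else 0) =
      (Fintype.card k : ℝ)⁻¹ ^ Fintype.card ι := by
  have hiff : ∀ x : ι → k, (∀ i, x i + c i = 0) ↔ x = -c := fun x => by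
    simp only [funext_iff, Pi.neg_apply, eq_neg_iff_add_eq_zero (G := k)]
  refine (expect_comp_surjective A.mulVecLin.toAddMonoidHom
    (mulVec_surjective_of_linearIndependent hA)
    fun x => if ∀ i, x i + c i = 0 then (1 : ℝ) else 0).trans ?_
  simp only [hiff, Fintype.expect_eq_sum_div_card, Finset.sum_ite_eq', Finset.mem_univ, if_true,
    Fintype.card_fun, Nat.cast_pow, one_div, inv_pow]

end FiniteFieldForms

section Residues

variable {F : Type*} [Field F]

instance (P : MonicIrr F) : Fact (Irreducible P.1) := ⟨P.irreducible⟩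

instance [Finite F] (P : MonicIrr F) : Finite (AdjoinRoot P.1) :=
  haveI := P.monic.finite_adjoinRoot
  Module.finite_of_finite F

instance [Finite F] (H : ℕ) : Finite (degreeLT F H) :=
  Finite.of_equiv _ (degreeLTEquiv F H).symm.toEquiv

section Fintype

variable [Fintype F]

noncomputable instance (P : MonicIrr F) : Fintype (AdjoinRoot P.1) := Fintype.ofFinite _

theorem inv_card_adjoinRoot (P : MonicIrr F) :
    (Fintype.card (AdjoinRoot P.1) : ℝ)⁻¹ = invNorm P := by
  have := P.monic.finite_adjoinRoot
  rw [invNorm, Module.card_eq_pow_finrank (K := F), (AdjoinRoot.powerBasis' P.monic).finrank]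
  push_cast
  rfl

noncomputable instance (H : ℕ) : Fintype (degreeLT F H) := Fintype.ofFinite _

theorem card_degreeLT (H : ℕ) : Fintype.card (degreeLT F H) = Fintype.card F ^ H := by
  rw [Fintype.card_congr (degreeLTEquiv F H).toEquiv, Fintype.card_fun, Fintype.card_fin]

end Fintype

variable {σ κ : Type*} {P : σ → MonicIrr F}

theorem exists_mem_degreeLT_forall_mk_eq (hP : Function.Injective P) {U : Finset σ} {H : ℕ}
    (hU : ∑ i ∈ U, (P i).deg ≤ H) (x : ∀ i : U, AdjoinRoot (P i).1) :
    ∃ y : degreeLT F H, ∀ i : U, AdjoinRoot.mk (P i).1 (y : F[X]) = x i := by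
  choose g hg using fun i : U => AdjoinRoot.mk_surjective (x i)
  set D := ∏ i ∈ U, (P i).1
  have hmonic : D.Monic := monic_prod_of_monic _ _ fun i _ => (P i).monic
  have hdeg : D.natDegree ≤ H := by
    rw [natDegree_prod_of_monic _ _ fun i _ => (P i).monic]
    exact hU
  obtain ⟨r, hr⟩ := Ideal.exists_forall_sub_mem_ideal (I := fun i : U => Ideal.span {(P i).1})
    (fun i i' h => (Ideal.isCoprime_span_singleton_iff _ _).2
      (MonicIrr.isCoprime fun h' => h (Subtype.ext (hP h')))) g
  refine ⟨⟨r %ₘ D, mem_degreeLT.2 ((degree_modByMonic_lt _ hmonic).trans_le ?_)⟩, fun i => ?_⟩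
  · rw [degree_eq_natDegree hmonic.ne_zero]
    exact_mod_cast hdeg
  · have hsub : r %ₘ D - g i = (r - g i) - D * (r /ₘ D) := by
      linear_combination modByMonic_add_div r D
    rw [← hg i, AdjoinRoot.mk_eq_mk, hsub]
    exact dvd_sub (Ideal.mem_span_singleton.1 (hr i))
      ((Finset.dvd_prod_of_mem _ i.2).mul_right _)

theorem expect_prod_mk [Fintype F] [Fintype κ] [DecidableEq κ] (hP : Function.Injective P)
    {U : Finset σ} {H : ℕ} (hU : ∑ i ∈ U, (P i).deg ≤ H)
    (φ : ∀ i, (κ → AdjoinRoot (P i).1) → ℝ) :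
    𝔼 y : κ → degreeLT F H, ∏ i ∈ U, φ i (fun j => AdjoinRoot.mk (P i).1 (y j : F[X])) =
      ∏ i ∈ U, 𝔼 v, φ i v := by
  classical
  let θ : (κ → degreeLT F H) →+ (∀ i : U, κ → AdjoinRoot (P i).1) :=
    { toFun := fun y i j => AdjoinRoot.mk (P i).1 (y j : F[X])
      map_zero' := by ext; simp
      map_add' := fun y z => by ext; simp }
  have hθ : Function.Surjective θ := fun v => by
    choose y hy using fun j => exists_mem_degreeLT_forall_mk_eq hP hU fun i => v i j
    exact ⟨y, funext₂ fun i j => hy j i⟩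
  have hprod := expect_comp_surjective θ hθ fun x => ∏ i : U, φ i (x i)
  rw [expect_pi_prod fun i : U => φ i] at hprod
  rw [← Finset.prod_coe_sort, ← hprod]
  exact Finset.expect_congr rfl fun y _ => (Finset.prod_coe_sort U _).symm

end Residues

section LocalDensity

variable {F ι κ : Type*} [Field F] [Fintype F] [Fintype κ] [DecidableEq κ]

open scoped Classical in
/-- The density of the common zeros modulo `P` of the affine forms `∑ j, a i j * x j + c i`,
`i ∈ C`. -/
noncomputable def localDensity (a : ι → κ → F[X]) (c : ι → F[X]) (P : MonicIrr F) (C : Finset ι) :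
    ℝ :=
  𝔼 v : κ → AdjoinRoot P.1,
    if ∀ i ∈ C, ∑ j, AdjoinRoot.mk P.1 (a i j) * v j + AdjoinRoot.mk P.1 (c i) = 0 then 1 else 0

variable {a : ι → κ → F[X]} {c : ι → F[X]} {P : MonicIrr F}

theorem localDensity_empty : localDensity a c P ∅ = 1 := by
  simp only [localDensity, Finset.notMem_empty, false_imp_iff, implies_true, if_true,
    Fintype.expect_const]

theorem localDensity_nonneg (C : Finset ι) : 0 ≤ localDensity a c P C :=
  Finset.expect_nonneg fun v _ => by split_ifs <;> simp

theorem localDensity_anti {C C' : Finset ι} (h : C ⊆ C') :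
    localDensity a c P C' ≤ localDensity a c P C := by
  refine Finset.expect_le_expect fun v _ => ?_
  split_ifs with h1 h2 h2
  · exact le_rfl
  · exact absurd (fun i hi => h1 i (h hi)) h2
  · exact zero_le_one
  · exact le_rfl

theorem localDensity_le_one (C : Finset ι) : localDensity a c P C ≤ 1 :=
  (localDensity_anti (Finset.empty_subset C)).trans_eq localDensity_empty

theorem localDensity_eq_zero {C : Finset ι} {i : ι} (hi : i ∈ C) (ha : ∀ j, P.1 ∣ a i j)
    (hc : ¬ P.1 ∣ c i) : localDensity a c P C = 0 := by
  refine Finset.expect_eq_zero fun v _ => if_neg fun h => hc ?_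
  simpa only [AdjoinRoot.mk_eq_zero.2 (ha _), zero_mul, Finset.sum_const_zero, zero_add,
    AdjoinRoot.mk_eq_zero] using h i hi

theorem localDensity_of_linearIndepOn {C : Finset ι}
    (h : LinearIndepOn (AdjoinRoot P.1) (fun i j => AdjoinRoot.mk P.1 (a i j)) (C : Set ι)) :
    localDensity a c P C = invNorm P ^ C.card := by
  classical
  have hind := expect_ite_affine_eq_zero
    (A := Matrix.of fun (i : C) j => AdjoinRoot.mk P.1 (a i j)) h
    fun i => AdjoinRoot.mk P.1 (c i)
  rw [inv_card_adjoinRoot, Fintype.card_coe] at hind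
  simpa only [localDensity, Matrix.of_apply, Subtype.forall] using hind

theorem localDensity_singleton {i : ι} (hi : ∃ j, ¬ P.1 ∣ a i j) :
    localDensity a c P {i} = invNorm P := by
  obtain ⟨j, hj⟩ := hi
  rw [localDensity_of_linearIndepOn, Finset.card_singleton, pow_one]
  rw [Finset.coe_singleton, linearIndepOn_singleton_iff]
  exact fun h => hj (AdjoinRoot.mk_eq_zero.1 (congrFun h j))

theorem localDensity_pair [DecidableEq ι] {i i' : ι}
    (h : ∃ j j', ¬ P.1 ∣ a i j * a i' j' - a i j' * a i' j) :
    localDensity a c P {i, i'} = invNorm P ^ 2 := by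
  obtain ⟨j, j', hj⟩ := h
  have hne : i ≠ i' := by
    rintro rfl
    exact hj (by rw [mul_comm, sub_self]; exact dvd_zero _)
  rw [localDensity_of_linearIndepOn, Finset.card_pair hne]
  rw [Finset.coe_pair, LinearIndepOn.pair_iff _ hne]
  intro s t hst
  have hminor : AdjoinRoot.mk P.1 (a i j * a i' j' - a i j' * a i' j) ≠ 0 := by
    rwa [Ne, AdjoinRoot.mk_eq_zero]
  rw [map_sub, map_mul, map_mul] at hminor
  have hsj := congrFun hst j
  have hsj' := congrFun hst j'
  simp only [Pi.add_apply, Pi.smul_apply, smul_eq_mul, Pi.zero_apply] at hsj hsj'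
  constructor <;> refine (mul_eq_zero.1 ?_).resolve_right hminor
  · linear_combination AdjoinRoot.mk P.1 (a i' j') * hsj - AdjoinRoot.mk P.1 (a i' j) * hsj'
  · linear_combination AdjoinRoot.mk P.1 (a i j) * hsj' - AdjoinRoot.mk P.1 (a i j') * hsj

theorem isGoodDensity_localDensity [DecidableEq ι] {e : ℝ} (ha : ∀ i, ∃ j, ¬ P.1 ∣ a i j)
    (he : invNorm P ^ 2 ≤ e) (hpair : ∀ i i', i ≠ i' → localDensity a c P {i, i'} ≤ e) :
    IsGoodDensity (localDensity a c P) (invNorm P) e where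
  empty := localDensity_empty
  singleton i := localDensity_singleton (ha i)
  abs_le_one C := by
    rw [abs_of_nonneg (localDensity_nonneg C)]
    exact localDensity_le_one C
  abs_le C hC := by
    obtain ⟨i, hi, i', hi', hne⟩ := Finset.one_lt_card.1 hC
    rw [abs_of_nonneg (localDensity_nonneg C)]
    exact (localDensity_anti (by simp [Finset.insert_subset_iff, hi, hi'])).trans (hpair i i' hne)
  sq_le := he

end LocalDensity

section Transpose

variable {α β : Type*} [Fintype α] [Fintype β] [DecidableEq α]

theorem sum_filter_nonempty_le (B : β → Finset α) (n : β → ℕ) :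
    ∑ y with (B y).Nonempty, n y ≤ ∑ x, ∑ y, if x ∈ B y then n y else 0 := by
  rw [Finset.sum_comm, Finset.sum_filter]
  refine Finset.sum_le_sum fun y _ => ?_
  split_ifs with hy
  · obtain ⟨x, hx⟩ := hy
    exact (if_pos hx).ge.trans (Finset.single_le_sum
      (f := fun x => if x ∈ B y then n y else 0) (fun _ _ => Nat.zero_le _) (Finset.mem_univ x))
  · exact Nat.zero_le _

variable [DecidableEq β]

/-- A relation between two finite types, seen as a family of subsets of either one. -/
def transposeEquiv (α β : Type*) [Fintype α] [Fintype β] [DecidableEq α] [DecidableEq β] :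
    (α → Finset β) ≃ (β → Finset α) where
  toFun S y := Finset.univ.filter fun x => y ∈ S x
  invFun B x := Finset.univ.filter fun y => x ∈ B y
  left_inv S := by ext x y; simp
  right_inv B := by ext y x; simp

theorem mem_transposeEquiv {S : α → Finset β} {x : α} {y : β} :
    x ∈ transposeEquiv α β S y ↔ y ∈ S x := by
  simp [transposeEquiv]

theorem sum_ite_mem_transposeEquiv (S : α → Finset β) (n : β → ℕ) (x : α) :
    ∑ y, (if x ∈ transposeEquiv α β S y then n y else 0) = ∑ y ∈ S x, n y := by
  simp only [mem_transposeEquiv, Finset.sum_ite_mem, Finset.univ_inter]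

theorem sum_card_transposeEquiv (S : α → Finset β) :
    ∑ y, (transposeEquiv α β S y).card = ∑ x, (S x).card := by
  simp only [Finset.card_eq_sum_ones, ← sum_ite_mem_transposeEquiv S fun _ => 1]
  rw [Finset.sum_comm]
  exact Finset.sum_congr rfl fun y _ => by rw [Finset.sum_ite_mem, Finset.univ_inter]

end Transpose

section BoxAverage

variable {F : Type*} [Field F] [Fintype F] {ι κ : Type*}

open scoped Classical in
theorem divisorSum_eq_sum_finset {χ : ℝ → ℝ} (hχ : IsCutoff χ) {R : ℝ} (hR : 0 < R) {N : ℕ}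
    (hN : R ≤ N) (f : F[X]) :
    divisorSum χ R f = ∑ S : Finset (primesLT F N), (if ∀ P ∈ S, P.1.1 ∣ f then 1 else 0) *
      ((-1) ^ S.card * χ ((∑ P ∈ S, P.1.deg : ℕ) / R)) := by
  simp only [divisorSum_eq_sum_powerset hχ hR hN, ite_mul, one_mul, zero_mul]
  rw [← Finset.sum_filter]
  symm
  refine Finset.sum_bij (fun S _ => S.map (Function.Embedding.subtype _)) (fun S hS => ?_)
    (fun S _ S' _ h => Finset.map_injective _ h) (fun S hS => ?_) fun S _ => ?_
  · refine Finset.mem_powerset.2 fun P hP => ?_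
    obtain ⟨Q, hQ, rfl⟩ := Finset.mem_map.1 hP
    exact Finset.mem_filter.2 ⟨Q.2, (Finset.mem_filter.1 hS).2 Q hQ⟩
  · have hS' := Finset.mem_powerset.1 hS
    refine ⟨S.subtype _, Finset.mem_filter.2 ⟨Finset.mem_univ _, fun P hP => ?_⟩, ?_⟩
    · exact (Finset.mem_filter.1 (hS' (Finset.mem_subtype.1 hP))).2
    · rw [Finset.subtype_map]
      exact Finset.filter_true_of_mem fun P hP => (Finset.mem_filter.1 (hS' hP)).1
  · rw [Finset.card_map, Finset.sum_map]
    rfl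

open scoped Classical in
theorem prod_divisorSum_sq_eq_sum [Fintype ι] [DecidableEq ι] [DecidableEq (MonicIrr F)]
    {χ : ℝ → ℝ} (hχ : IsCutoff χ) {R : ℝ} (hR : 0 < R) {N : ℕ} (hN : R ≤ N) (f : ι → F[X]) :
    ∏ i, divisorSum χ R (f i) ^ 2 = ∑ B : primesLT F N → Finset (ι × Bool),
      (if ∀ P, ∀ i ∈ (B P).image Prod.fst, P.1.1 ∣ f i then 1 else 0) *
        ((∏ P, (-1) ^ (B P).card) *
          ∏ s, χ ((∑ P : primesLT F N, if s ∈ B P then P.1.deg else 0 : ℕ) / R)) := by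
  have hsq : ∏ i, divisorSum χ R (f i) ^ 2 = ∏ s : ι × Bool, divisorSum χ R (f s.1) := by
    rw [Fintype.prod_prod_type]
    exact Finset.prod_congr rfl fun i _ => by rw [Fintype.prod_bool, sq]
  rw [hsq, Finset.prod_congr rfl fun s _ => divisorSum_eq_sum_finset hχ hR hN (f s.1),
    Finset.prod_univ_sum, Fintype.piFinset_univ]
  refine Fintype.sum_equiv (transposeEquiv _ _) _ _ fun S => ?_
  have hiff : (∀ s, ∀ P ∈ S s, P.1.1 ∣ f s.1) ↔
      ∀ P, ∀ i ∈ (transposeEquiv _ _ S P).image Prod.fst, P.1.1 ∣ f i := by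
    simp only [Finset.forall_mem_image, mem_transposeEquiv]
    exact ⟨fun h P s => h s P, fun h s P => h P (x := s)⟩
  rw [Finset.prod_mul_distrib, Finset.prod_mul_distrib, Finset.prod_pow_eq_pow_sum,
    Finset.prod_pow_eq_pow_sum, sum_card_transposeEquiv]
  simp only [sum_ite_mem_transposeEquiv S fun P => P.1.deg]
  refine mul_eq_mul_right_iff.2 (Or.inl ?_)
  split_ifs with h
  · exact Finset.prod_eq_one fun s _ => if_pos (hiff.2 h s)
  · obtain ⟨s, hs⟩ := not_forall.1 (mt hiff.1 h)
    exact Finset.prod_eq_zero (Finset.mem_univ s) (if_neg hs)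

variable [Fintype κ] [DecidableEq κ]

open scoped Classical in
theorem expect_ite_forall_dvd (a : ι → κ → F[X]) (c : ι → F[X]) {T : Finset (MonicIrr F)} {H : ℕ}
    (C : T → Finset ι) (hC : ∑ P with (C P).Nonempty, P.1.deg ≤ H) :
    (𝔼 y : κ → degreeLT F H, if ∀ P, ∀ i ∈ C P, P.1.1 ∣ ∑ j, a i j * (y j : F[X]) + c i
      then (1 : ℝ) else 0) = ∏ P : T, localDensity a c P.1 (C P) := by
  have hiff : ∀ (P : T) (y : κ → degreeLT F H), (∀ i ∈ C P, ∑ j, AdjoinRoot.mk P.1.1 (a i j) *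
      AdjoinRoot.mk P.1.1 (y j : F[X]) + AdjoinRoot.mk P.1.1 (c i) = 0) ↔
      ∀ i ∈ C P, P.1.1 ∣ ∑ j, a i j * (y j : F[X]) + c i := fun P y => by
    simp only [← AdjoinRoot.mk_eq_zero, map_add, map_sum, map_mul]
  have hprod := expect_prod_mk (κ := κ) (P := fun P : T => P.1) Subtype.val_injective hC fun P v =>
    if ∀ i ∈ C P, ∑ j, AdjoinRoot.mk P.1.1 (a i j) * v j + AdjoinRoot.mk P.1.1 (c i) = 0
      then (1 : ℝ) else 0
  have hsub : ∏ P with (C P).Nonempty, localDensity a c P.1 (C P) =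
      ∏ P : T, localDensity a c P.1 (C P) := by
    refine Finset.prod_subset (Finset.filter_subset _ _) fun P _ hP => ?_
    rw [Finset.not_nonempty_iff_eq_empty.1 fun h => hP (Finset.mem_filter.2 ⟨Finset.mem_univ P, h⟩),
      localDensity_empty]
  rw [← hsub]
  refine Eq.trans (Finset.expect_congr rfl fun y _ => ?_) hprod
  simp only [hiff, Finset.prod_ite_zero, Finset.prod_const_one, Finset.mem_filter, Finset.mem_univ,
    true_and]
  exact if_congr (forall_congr' fun P => ⟨fun h _ => h, fun h i hi => h ⟨i, hi⟩ i hi⟩) rfl rfl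

theorem expect_prod_divisorSum_sq [Fintype ι] [DecidableEq ι] {χ : ℝ → ℝ} (hχ : IsCutoff χ)
    {R : ℝ} (hR : 0 < R) {N H : ℕ} (hN : R ≤ N) (hH : 2 * Fintype.card ι * R ≤ H)
    (a : ι → κ → F[X]) (c : ι → F[X]) [DecidableEq (MonicIrr F)] :
    𝔼 y : κ → degreeLT F H, ∏ i, divisorSum χ R (∑ j, a i j * (y j : F[X]) + c i) ^ 2 =
      sieveSum (primesLT F N) MonicIrr.deg (localDensity a c) χ R := by
  classical
  simp only [prod_divisorSum_sq_eq_sum hχ hR hN]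
  rw [Finset.expect_sum_comm, sieveSum]
  refine Finset.sum_congr rfl fun B _ => ?_
  rw [← Finset.expect_mul, Finset.prod_mul_distrib, mul_left_comm, mul_assoc]
  refine mul_eq_mul_left_iff.2 (Or.inl ?_)
  refine mul_eq_mul_right_iff.2 (or_iff_not_imp_right.2 fun hz => ?_)
  convert expect_ite_forall_dvd a c (fun P => (B P).image Prod.fst) ?_
  have hlt : ∀ s, ((∑ P : primesLT F N, if s ∈ B P then P.1.deg else 0 : ℕ) : ℝ) ≤ R := fun s => by
    by_contra h
    exact hz (Finset.prod_eq_zero (Finset.mem_univ s)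
      (hχ.eq_zero ((one_le_div hR).2 (not_le.1 h).le)))
  simp only [Finset.image_nonempty]
  rw [← Nat.cast_le (α := ℝ)]
  calc ((∑ P with (B P).Nonempty, P.1.deg : ℕ) : ℝ)
      ≤ ∑ s, ((∑ P : primesLT F N, if s ∈ B P then P.1.deg else 0 : ℕ) : ℝ) := by
        exact_mod_cast sum_filter_nonempty_le B fun P => P.1.deg
    _ ≤ ∑ _s : ι × Bool, R := Finset.sum_le_sum fun s _ => hlt s
    _ = 2 * Fintype.card ι * R := by
        simp only [Finset.sum_const, Finset.card_univ, Fintype.card_prod, Fintype.card_bool,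
          nsmul_eq_mul]
        push_cast
        ring
    _ ≤ H := hH

end BoxAverage

section Totient

variable {F : Type*} [Field F] [Fintype F]

theorem polyPrimorial_monic (w : ℕ) : (polyPrimorial F w).Monic := by
  rw [polyPrimorial_eq]
  exact MonicIrr.monic_prod _

theorem dvd_polyPrimorial_iff {P : MonicIrr F} {w : ℕ} : P.1 ∣ polyPrimorial F w ↔ P.deg < w := by
  rw [polyPrimorial_eq, P.dvd_prod_iff, mem_primesLT]

theorem isCoprime_polyPrimorial_iff {g : F[X]} {w : ℕ} :
    IsCoprime g (polyPrimorial F w) ↔ ∀ P ∈ primesLT F w, ¬ P.1 ∣ g := by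
  rw [polyPrimorial_eq, IsCoprime.prod_right_iff]
  exact forall₂_congr fun P _ => by rw [isCoprime_comm, P.irreducible.coprime_iff_not_dvd]

theorem polyNorm_polyPrimorial (w : ℕ) :
    polyNorm (polyPrimorial F w) = (Fintype.card F : ℝ) ^ (polyPrimorial F w).natDegree := by
  rw [polyNorm, if_neg (polyPrimorial_monic w).ne_zero]

open scoped Classical in
theorem polyTotient_eq_card {W : F[X]} (hW : W ≠ 0) :
    polyTotient W = ((polysLT F W.natDegree).filter fun g => IsCoprime g W).card := by
  rw [polyTotient, ← Set.ncard_coe_finset]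
  congr 1
  ext f
  rw [Finset.mem_coe, Finset.mem_filter, mem_polysLT, ← degree_eq_natDegree hW]
  rfl

theorem expect_degreeLT (H : ℕ) (f : F[X] → ℝ) :
    𝔼 g : degreeLT F H, f g = (∑ g ∈ polysLT F H, f g) / (Fintype.card F : ℝ) ^ H := by
  rw [Fintype.expect_eq_sum_div_card, card_degreeLT, Nat.cast_pow,
    Finset.sum_subtype (polysLT F H) (p := (· ∈ degreeLT F H))
      fun g => by rw [mem_polysLT, mem_degreeLT]]

open scoped Classical in
theorem expect_ite_ne_zero (P : MonicIrr F) :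
    (𝔼 v : Unit → AdjoinRoot P.1, if v () = 0 then (0 : ℝ) else 1) = 1 - invNorm P := by
  have hzero := expect_ite_affine_eq_zero (A := (1 : Matrix Unit Unit (AdjoinRoot P.1)))
    (Matrix.linearIndependent_rows_iff_isUnit.2 isUnit_one) 0
  simp only [Finset.univ_unique, PUnit.default_eq_unit, Finset.sum_singleton, Matrix.one_apply_eq,
    one_mul, Pi.zero_apply, add_zero, forall_const, Fintype.card_unit, pow_one,
    inv_card_adjoinRoot] at hzero
  rw [← hzero, ← Fintype.expect_one (ι := Unit → AdjoinRoot P.1) (M := ℝ),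
    ← Finset.expect_sub_distrib]
  exact Finset.expect_congr rfl fun v _ => by split_ifs <;> simp

open scoped Classical in
theorem expect_ite_forall_not_dvd (U : Finset (MonicIrr F)) {H : ℕ}
    (hU : ∑ P ∈ U, P.deg ≤ H) :
    (𝔼 g : degreeLT F H, if ∀ P ∈ U, ¬ P.1 ∣ (g : F[X]) then (1 : ℝ) else 0) =
      ∏ P ∈ U, (1 - invNorm P) := by
  have hprod := expect_prod_mk (κ := Unit) (P := fun P : MonicIrr F => P) Function.injective_id hU
    fun P v => if v () = 0 then (0 : ℝ) else 1
  simp only [expect_ite_ne_zero, AdjoinRoot.mk_eq_zero] at hprod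
  rw [← hprod, ← Fintype.expect_equiv (Equiv.funUnique Unit (degreeLT F H)) _ _ fun _ => rfl]
  refine Finset.expect_congr rfl fun y _ => ?_
  simp only [← ite_not (_ ∣ _), Finset.prod_ite_zero, Finset.prod_const_one]
  rfl

theorem polyTotient_div_polyNorm (w : ℕ) :
    (polyTotient (polyPrimorial F w) : ℝ) / polyNorm (polyPrimorial F w) =
      ∏ P ∈ primesLT F w, (1 - invNorm P) := by
  classical
  rw [← expect_ite_forall_not_dvd (H := (polyPrimorial F w).natDegree) _
    (by rw [polyPrimorial_eq, MonicIrr.natDegree_prod])]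
  simp only [← isCoprime_polyPrimorial_iff]
  rw [expect_degreeLT _ fun g => if IsCoprime g (polyPrimorial F w) then (1 : ℝ) else 0,
    polyTotient_eq_card (polyPrimorial_monic w).ne_zero, polyNorm_polyPrimorial,
    Finset.sum_boole]

end Totient

section BoxEstimate

variable {F : Type*} [Field F] [Fintype F]

/-- The local densities of the forms `W * (∑ j, a i j * x j + c i) + b` (the `W`-trick), where `W`
is the primorial of `w`. -/
noncomputable def wTrickDensity {ι κ : Type*} [Fintype κ] [DecidableEq κ] (w : ℕ) (b : F[X])
    (a : ι → κ → F[X]) (c : ι → F[X]) (P : MonicIrr F) : Finset ι → ℝ :=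
  localDensity (fun i j => polyPrimorial F w * a i j) (fun i => polyPrimorial F w * c i + b) P

section

variable {ι κ : Type*} [Fintype κ] [DecidableEq κ] {a : ι → κ → F[X]} {c : ι → F[X]} {b : F[X]}
  {w : ℕ} {P : MonicIrr F}

theorem not_dvd_polyPrimorial_mul (hP : w ≤ P.deg) {f : F[X]} (hf : ¬ P.1 ∣ f) :
    ¬ P.1 ∣ polyPrimorial F w * f :=
  P.prime.not_dvd_mul (dvd_polyPrimorial_iff.not.2 hP.not_gt) hf

theorem isGoodDensity_wTrickDensity [DecidableEq ι] {e : ℝ} (hP : w ≤ P.deg)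
    (ha : ∀ i, ∃ j, ¬ P.1 ∣ a i j) (he : invNorm P ^ 2 ≤ e)
    (hpair : ∀ i i', i ≠ i' → wTrickDensity w b a c P {i, i'} ≤ e) :
    IsGoodDensity (wTrickDensity w b a c P) (invNorm P) e :=
  isGoodDensity_localDensity
    (fun i => (ha i).imp fun _ => not_dvd_polyPrimorial_mul hP) he hpair

theorem isSieveDensity_wTrickDensity {N : ℕ} {e : MonicIrr F → ℝ} (hwN : w ≤ N)
    (hb : IsCoprime b (polyPrimorial F w))
    (hgood : ∀ P ∈ primesLT F N, w ≤ P.deg →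
      IsGoodDensity (wTrickDensity w b a c P) (invNorm P) (e P)) :
    IsSieveDensity (primesLT F w) (primesLT F N) (wTrickDensity w b a c) invNorm e where
  subset := primesLT_mono hwN
  empty _ _ := localDensity_empty
  eq_zero P hP C hC := by
    have hW : P.1 ∣ polyPrimorial F w := dvd_polyPrimorial_iff.2 (mem_primesLT.1 hP)
    obtain ⟨i, hi⟩ := hC
    refine localDensity_eq_zero hi (fun j => hW.mul_right _) ?_
    rw [dvd_add_right (hW.mul_right _)]
    exact isCoprime_polyPrimorial_iff.1 hb P hP
  good P hPN hPw := hgood P hPN (not_lt.1 (mem_primesLT.not.1 hPw))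

theorem expect_prod_sieveWeight [Fintype ι] [DecidableEq ι] [DecidableEq (MonicIrr F)] {χ : ℝ → ℝ}
    (hχ : IsCutoff χ) {R : ℝ} (hR : 0 < R) {N H : ℕ} (hN : R ≤ N)
    (hH : 2 * Fintype.card ι * R ≤ H) :
    𝔼 y : κ → degreeLT F H, ∏ i, sieveWeight χ R (polyPrimorial F w) b
        (∑ j, a i j * (y j : F[X]) + c i) =
      R ^ Fintype.card ι * (∏ P ∈ primesLT F w, (1 - invNorm P)) ^ Fintype.card ι *
        sieveSum (primesLT F N) MonicIrr.deg (wTrickDensity w b a c) χ R := by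
  have hform : ∀ i (y : κ → degreeLT F H),
      polyPrimorial F w * (∑ j, a i j * (y j : F[X]) + c i) + b =
        ∑ j, polyPrimorial F w * a i j * (y j : F[X]) + (polyPrimorial F w * c i + b) :=
    fun i y => by simp only [mul_add, Finset.mul_sum, mul_assoc, add_assoc]
  unfold wTrickDensity
  rw [← expect_prod_divisorSum_sq hχ hR hN hH, Finset.mul_expect]
  simp only [sieveWeight, hform, polyTotient_div_polyNorm, Finset.prod_mul_distrib,
    Finset.prod_const, Finset.card_univ]

end

/-- The shape of the relative error of a box average of sieve weights: `L` bounds the contribution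
of the primes that do not divide the modulus and `κ` that of the finitely many which do. -/
noncomputable def sieveError (A κ L : ℝ) : ℝ := A * (Real.exp (A * L) - 1) + Real.exp (A * L) * κ

theorem sieveError_mono {A A' κ κ' L : ℝ} (hA : 0 ≤ A) (hL : 0 ≤ L) (hκ : 0 ≤ κ) (hAA' : A ≤ A')
    (hκκ' : κ ≤ κ') : sieveError A κ L ≤ sieveError A' κ' L := by
  have hexp : Real.exp (A * L) ≤ Real.exp (A' * L) := Real.exp_le_exp.2 (by gcongr)
  have hone : 1 ≤ Real.exp (A * L) := Real.one_le_exp (by positivity)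
  unfold sieveError
  gcongr
  linarith

theorem sieveError_add_le {A κ κ' L : ℝ} (hA : 0 ≤ A) (hL : 0 ≤ L) (hκ' : 0 ≤ κ') :
    sieveError A κ L + κ' ≤ sieveError A (κ + κ') L := by
  have hone : 1 ≤ Real.exp (A * L) := Real.one_le_exp (by positivity)
  unfold sieveError
  nlinarith

theorem exists_abs_mul_cutoffCorr_pow_sub_one_le {χ : ℝ → ℝ} (hχ : IsCutoff χ) (m : ℕ) :
    ∃ D : ℝ, 0 ≤ D ∧ ∀ R : ℝ, 1 ≤ R → |(R * cutoffCorr χ R 0 0) ^ m - 1| ≤ D / R := by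
  obtain ⟨L, -, -, h1, h2⟩ := hχ.exists_bound
  refine ⟨4 * L ^ 2 * m * (1 + 4 * L ^ 2) ^ (m - 1), by positivity, fun R hR => ?_⟩
  have hclose := abs_mul_cutoffCorr_sub_one_le hχ hR h1 h2
  have hle : |R * cutoffCorr χ R 0 0| ≤ 1 + 4 * L ^ 2 := by
    have := abs_sub_abs_le_abs_sub (R * cutoffCorr χ R 0 0) 1
    have := div_le_self (by positivity : 0 ≤ 4 * L ^ 2) hR
    rw [abs_one] at *
    linarith
  calc |(R * cutoffCorr χ R 0 0) ^ m - 1|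
      = |(R * cutoffCorr χ R 0 0) ^ m - 1 ^ m| := by rw [one_pow]
    _ ≤ |R * cutoffCorr χ R 0 0 - 1| * m * max |R * cutoffCorr χ R 0 0| |1| ^ (m - 1) :=
        abs_pow_sub_pow_le _ _ _
    _ ≤ 4 * L ^ 2 / R * m * (1 + 4 * L ^ 2) ^ (m - 1) := by
        gcongr
        exact max_le hle (by rw [abs_one]; linarith [sq_nonneg L])
    _ = 4 * L ^ 2 * m * (1 + 4 * L ^ 2) ^ (m - 1) / R := by ring

/-- The estimate, uniform with constants `A` and `K`, for the average of a product of `m` sieve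
weights along affine forms over a box of side `H`. -/
def BoxEstimate (F : Type*) [Field F] [Fintype F] (χ : ℝ → ℝ) (m : ℕ) (A : ℝ) (K : ℕ → ℝ) : Prop :=
  ∀ ⦃n H N w : ℕ⦄ ⦃a : Fin m → Fin n → F[X]⦄ ⦃c : Fin m → F[X]⦄ ⦃b : F[X]⦄ ⦃R L : ℝ⦄
    ⦃e : MonicIrr F → ℝ⦄, 1 ≤ R → R ≤ N → w ≤ N → 2 * m * R ≤ H → 0 ≤ L →
    IsCoprime b (polyPrimorial F w) →
    (∀ P ∈ primesLT F N, w ≤ P.deg →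
      IsGoodDensity (wTrickDensity w b a c P) (invNorm P) (e P)) →
    ∑ P ∈ primesLT F N with w ≤ P.deg, e P ≤ L →
    |(𝔼 y : Fin n → degreeLT F H, ∏ i, sieveWeight χ R (polyPrimorial F w) b
      (∑ j, a i j * (y j : F[X]) + c i)) - 1| ≤ sieveError A (K w / R) L

theorem BoxEstimate.mono {χ : ℝ → ℝ} {m : ℕ} {A A' : ℝ} {K K' : ℕ → ℝ}
    (h : BoxEstimate F χ m A K) (hA : 0 ≤ A) (hK : ∀ w, 0 ≤ K w) (hAA' : A ≤ A') (hKK' : K ≤ K') :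
    BoxEstimate F χ m A' K' := by
  intro n H N w a c b R L e hR hRN hwN hH hL hb hgood he
  have hR0 : 0 ≤ R := by linarith
  exact (h hR hRN hwN hH hL hb hgood he).trans
    (sieveError_mono hA hL (div_nonneg (hK w) hR0) hAA' (div_le_div_of_nonneg_right (hKK' w) hR0))

theorem exists_boxEstimate (F : Type*) [Field F] [Fintype F] {χ : ℝ → ℝ} (hχ : IsCutoff χ) (m : ℕ) :
    ∃ (A : ℝ) (K : ℕ → ℝ), 0 ≤ A ∧ (∀ w, 0 ≤ K w) ∧ BoxEstimate F χ m A K := by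
  classical
  obtain ⟨M, hM0, hM⟩ := exists_abs_sieveSum_sub_le (ι := Fin m) hχ (MonicIrr.deg (F := F)) invNorm
    (fun P => (invNorm_pos P).le) invNorm_le_half
  choose K hK0 hK using fun w => hM (primesLT F w)
  obtain ⟨D, hD0, hD⟩ := exists_abs_mul_cutoffCorr_pow_sub_one_le hχ m
  refine ⟨40 * 64 ^ m + M, fun w => K w + D, by positivity, fun w => add_nonneg (hK0 w) hD0, ?_⟩
  intro n H N w a c b R L e hR hRN hwN hH hL hb hgood he
  have hR0 : 0 < R := by linarith
  have hset : primesLT F N \ primesLT F w = {P ∈ primesLT F N | w ≤ P.deg} := by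
    ext P
    rw [Finset.mem_sdiff, Finset.mem_filter, mem_primesLT (N := w), not_lt]
  have hmain := hK w _ _ e (isSieveDensity_wTrickDensity hwN hb hgood) R L N hR hRN
    (X_pow_dvd_prod_primesLT N) (by rwa [hset])
  rw [← expect_prod_sieveWeight hχ hR0 hRN (by rwa [Fintype.card_fin]), Fintype.card_fin] at hmain
  have hexp : Real.exp (40 * 64 ^ m * L) ≤ Real.exp ((40 * 64 ^ m + M) * L) :=
    Real.exp_le_exp.2 (by gcongr; linarith)
  have hone : 1 ≤ Real.exp (40 * 64 ^ m * L) := Real.one_le_exp (by positivity)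
  have hKR : 0 ≤ K w / R := div_nonneg (hK0 w) hR0.le
  calc _ ≤ _ := abs_sub_le _ ((R * cutoffCorr χ R 0 0) ^ m) 1
    _ ≤ sieveError (40 * 64 ^ m + M) (K w / R) L + D / R := by
        refine add_le_add (hmain.trans ?_) (hD R hR)
        rw [mul_comm _ M]
        unfold sieveError
        gcongr
        exact le_add_of_nonneg_left (by positivity)
    _ ≤ sieveError (40 * 64 ^ m + M) ((K w + D) / R) L := by
        rw [add_div]
        exact sieveError_add_le (by positivity) hL (by positivity)

theorem exists_forall_le_boxEstimate (F : Type*) [Field F] [Fintype F] {χ : ℝ → ℝ}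
    (hχ : IsCutoff χ) (m₀ : ℕ) : ∃ (A : ℝ) (K : ℕ → ℝ), 0 ≤ A ∧ (∀ w, 0 ≤ K w) ∧
      ∀ m ≤ m₀, BoxEstimate F χ m A K := by
  choose A K hA hK hAK using exists_boxEstimate F hχ
  refine ⟨∑ m ∈ Finset.range (m₀ + 1), A m, fun w => ∑ m ∈ Finset.range (m₀ + 1), K m w,
    Finset.sum_nonneg fun m _ => hA m, fun w => Finset.sum_nonneg fun m _ => hK m w, fun m hm => ?_⟩
  have hmem : m ∈ Finset.range (m₀ + 1) := Finset.mem_range.2 (Nat.lt_succ_of_le hm)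
  exact (hAK m).mono (hA m) (hK m) (Finset.single_le_sum (fun m _ => hA m) hmem)
    fun w => Finset.single_le_sum (f := fun m => K m w) (fun m _ => hK m w) hmem

end BoxEstimate

section FiniteFieldModel

variable {F : Type*} [Field F]

namespace FieldChoice

variable (M : FieldChoice F) (N : ℕ+)

theorem rep_add (x y : M.FqN N) : M.rep N (x + y) = M.rep N x + M.rep N y :=
  map_add (AdjoinRoot.modByMonicHom (M.monic N)) x y

theorem rep_sub (x y : M.FqN N) : M.rep N (x - y) = M.rep N x - M.rep N y :=
  map_sub (AdjoinRoot.modByMonicHom (M.monic N)) x y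

theorem degree_f : (M.f N).degree = ((N : ℕ) : WithBot ℕ) := by
  rw [degree_eq_natDegree (M.monic N).ne_zero, M.natDegree_eq]

theorem rep_mk {p : F[X]} (hp : p.degree < ((N : ℕ) : WithBot ℕ)) :
    M.rep N (AdjoinRoot.mk (M.f N) p) = p := by
  rw [rep, AdjoinRoot.modByMonicHom_mk, (modByMonic_eq_self_iff (M.monic N)).2]
  rwa [degree_f]

theorem rep_injective : Function.Injective (M.rep N) :=
  (AdjoinRoot.mk_leftInverse (M.monic N)).injective

theorem degree_rep_lt (x : M.FqN N) : (M.rep N x).degree < ((N : ℕ) : WithBot ℕ) := by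
  obtain ⟨p, rfl⟩ := AdjoinRoot.mk_surjective x
  rw [rep, AdjoinRoot.modByMonicHom_mk, ← M.degree_f N]
  exact degree_modByMonic_lt _ (M.monic N)

theorem embed_mul_mk {r : RatFunc F} {g a : F[X]} (hg : g ≠ 0) (hgN : g.natDegree < N)
    (h : r * algebraMap F[X] (RatFunc F) g = algebraMap F[X] (RatFunc F) a) :
    M.embed N r * AdjoinRoot.mk (M.f N) g = AdjoinRoot.mk (M.f N) a := by
  have hden : algebraMap F[X] (RatFunc F) r.denom ≠ 0 := RatFunc.algebraMap_ne_zero r.denom_ne_zero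
  have hcross : r.num * g = a * r.denom := by
    apply RatFunc.algebraMap_injective F
    rw [map_mul, map_mul, ← h, (div_eq_iff hden).1 (RatFunc.num_div_denom r)]
    ring
  have hdvd : r.denom ∣ g := (RatFunc.isCoprime_num_denom r).symm.dvd_of_dvd_mul_left
    ⟨a, by rw [hcross, mul_comm]⟩
  have hmk : AdjoinRoot.mk (M.f N) r.denom ≠ 0 := by
    rw [Ne, AdjoinRoot.mk_eq_zero]
    intro hf
    exact absurd (natDegree_le_of_dvd (hf.trans hdvd) hg) (by rw [M.natDegree_eq]; omega)
  rw [embed, div_mul_eq_mul_div, div_eq_iff hmk, ← map_mul, ← map_mul, hcross]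

end FieldChoice

theorem abs_expect_sub_le {α : Type*} [Fintype α] [Nonempty α] {f : α → ℝ} {t η : ℝ}
    (h : ∀ x, |f x - t| ≤ η) : |(𝔼 x, f x) - t| ≤ η := by
  rw [← Fintype.expect_const (ι := α) t, ← Finset.expect_sub_distrib]
  exact ((Finset.abs_expect_le _ _).trans (Finset.expect_le_expect fun x _ => h x)).trans_eq
    (Fintype.expect_const _)

end FiniteFieldModel

section LinearForms

variable {F ι κ : Type*} [Field F]

theorem degree_mul_lt_of_natDegree_le {a y : F[X]} {D H N : ℕ} (ha : a.natDegree ≤ D)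
    (hy : y.degree < (H : WithBot ℕ)) (hN : D + H ≤ N) : (a * y).degree < (N : WithBot ℕ) :=
  calc (a * y).degree = a.degree + y.degree := degree_mul
    _ ≤ D + y.degree := by gcongr; exact degree_le_of_natDegree_le ha
    _ < D + H := WithBot.add_lt_add_left (WithBot.coe_ne_bot (a := D)) hy
    _ ≤ N := mod_cast hN

theorem exists_minor_ne_zero {K : Type*} [Field K] {u v : κ → K} (hv : v ≠ 0)
    (h : ∀ c : K, u ≠ c • v) : ∃ j j', u j * v j' - u j' * v j ≠ 0 := by
  by_contra! hc
  obtain ⟨j', hj'⟩ := Function.ne_iff.1 hv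
  refine h (u j' / v j') (funext fun j => ?_)
  rw [Pi.smul_apply, smul_eq_mul, div_mul_eq_mul_div, eq_div_iff hj', ← sub_eq_zero]
  exact hc j j'

theorem MonicIrr.not_dvd_of_natDegree_lt (P : MonicIrr F) {f : F[X]} (hf : f ≠ 0)
    (h : f.natDegree < P.deg) : ¬ P.1 ∣ f := fun hd =>
  (natDegree_le_of_dvd hd hf).not_gt h

/-- `g` is a common denominator of the entries `L i j = a i j / g`, and all the degrees are at most
`D`. -/
structure ClearsDenominators (L : ι → κ → RatFunc F) (D : ℕ) (g : F[X]) (a : ι → κ → F[X]) :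
    Prop where
  ne_zero : g ≠ 0
  natDegree_den_le : g.natDegree ≤ D
  natDegree_num_le : ∀ i j, (a i j).natDegree ≤ D
  mul_eq : ∀ i j, L i j * algebraMap F[X] (RatFunc F) g = algebraMap F[X] (RatFunc F) (a i j)

theorem exists_clearsDenominators [Fintype ι] [Fintype κ] {k₀ : ℕ} {L : ι → κ → RatFunc F}
    (hL : ∀ i j, L i j ∈ smallRatFunc F k₀) :
    ∃ g a, ClearsDenominators L (Fintype.card ι * Fintype.card κ * k₀) g a := by
  classical
  choose A G hA hG hG0 hAG using hL
  have hprod : ∀ S : Finset (ι × κ), (∏ s ∈ S, G s.1 s.2).natDegree ≤ S.card * k₀ := fun S =>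
    (natDegree_prod_le _ _).trans
      (Finset.sum_le_card_nsmul _ _ k₀ fun s _ => natDegree_le_of_degree_le (hG s.1 s.2).le)
  have hcard : (Finset.univ : Finset (ι × κ)).card = Fintype.card ι * Fintype.card κ := by
    rw [Finset.card_univ, Fintype.card_prod]
  refine ⟨∏ s : ι × κ, G s.1 s.2, fun i j => A i j * ∏ s ∈ Finset.univ.erase (i, j), G s.1 s.2,
    Finset.prod_ne_zero_iff.2 fun s _ => hG0 _ _, hcard ▸ hprod _, fun i j => ?_, fun i j => ?_⟩
  · calc _ ≤ _ := natDegree_mul_le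
      _ ≤ k₀ + (Finset.univ.erase (i, j)).card * k₀ :=
        add_le_add (natDegree_le_of_degree_le (hA i j).le) (hprod _)
      _ = ((Finset.univ.erase (i, j)).card + 1) * k₀ := by ring
      _ = _ := by rw [Finset.card_erase_add_one (Finset.mem_univ _), hcard]
  · have hne : algebraMap F[X] (RatFunc F) (G i j) ≠ 0 := RatFunc.algebraMap_ne_zero (hG0 i j)
    rw [← Finset.mul_prod_erase _ _ (Finset.mem_univ (i, j)), hAG, map_mul, map_mul]
    field_simp

namespace ClearsDenominators

variable {L : ι → κ → RatFunc F} {D : ℕ} {g : F[X]} {a : ι → κ → F[X]}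

theorem exists_not_dvd (h : ClearsDenominators L D g a) {i : ι} (hi : L i ≠ 0) {P : MonicIrr F}
    (hP : D < P.deg) : ∃ j, ¬ P.1 ∣ a i j := by
  obtain ⟨j, hj⟩ := Function.ne_iff.1 hi
  refine ⟨j, P.not_dvd_of_natDegree_lt (fun h0 => ?_) ((h.natDegree_num_le i j).trans_lt hP)⟩
  have hmul := h.mul_eq i j
  rw [h0, map_zero] at hmul
  exact mul_ne_zero hj (RatFunc.algebraMap_ne_zero h.ne_zero) hmul

theorem exists_minor_not_dvd (h : ClearsDenominators L D g a) {i i' : ι} (hi' : L i' ≠ 0)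
    (hne : ∀ c : RatFunc F, L i ≠ c • L i') {P : MonicIrr F} (hP : 2 * D < P.deg) :
    ∃ j j', ¬ P.1 ∣ a i j * a i' j' - a i j' * a i' j := by
  obtain ⟨j, j', hj⟩ := exists_minor_ne_zero hi' hne
  have hdeg : ∀ x y, (a i x * a i' y).natDegree ≤ 2 * D := fun x y =>
    natDegree_mul_le.trans
      ((add_le_add (h.natDegree_num_le i x) (h.natDegree_num_le i' y)).trans_eq (two_mul D).symm)
  refine ⟨j, j', P.not_dvd_of_natDegree_lt (fun h0 => hj ?_)
    (((natDegree_sub_le _ _).trans (max_le (hdeg _ _) (hdeg _ _))).trans_lt hP)⟩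
  have hg : algebraMap F[X] (RatFunc F) g ≠ 0 := RatFunc.algebraMap_ne_zero h.ne_zero
  have hmul := congrArg (algebraMap F[X] (RatFunc F)) h0
  simp only [map_sub, map_mul, map_zero, ← h.mul_eq] at hmul
  refine mul_right_cancel₀ (mul_ne_zero hg hg) ?_
  linear_combination hmul

theorem rep_form_add [Fintype κ] (h : ClearsDenominators L D g a) {M : FieldChoice F} {N : ℕ+}
    {H : ℕ} (hDN : D < N) (hHN : D + H ≤ N) (x : κ → M.FqN N) (y : κ → degreeLT F H) (i : ι)
    (d : M.FqN N) :
    M.rep N (∑ j, M.embed N (L i j) * (x j + AdjoinRoot.mk (M.f N) (g * (y j : F[X]))) + d) =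
      ∑ j, a i j * (y j : F[X]) + M.rep N (∑ j, M.embed N (L i j) * x j + d) := by
  have hmul : ∀ j, M.embed N (L i j) * AdjoinRoot.mk (M.f N) (g * (y j : F[X])) =
      AdjoinRoot.mk (M.f N) (a i j * (y j : F[X])) := fun j => by
    rw [map_mul, ← mul_assoc,
      M.embed_mul_mk N h.ne_zero (h.natDegree_den_le.trans_lt hDN) (h.mul_eq i j), map_mul]
  have hdeg : (∑ j, a i j * (y j : F[X])).degree < ((N : ℕ) : WithBot ℕ) :=
    (degree_sum_le _ _).trans_lt ((Finset.sup_lt_iff (WithBot.bot_lt_coe _)).2 fun j _ =>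
      degree_mul_lt_of_natDegree_le (h.natDegree_num_le i j) (mem_degreeLT.1 (y j).2) hHN)
  rw [← M.rep_mk N hdeg, ← M.rep_add, map_sum]
  simp only [mul_add, hmul, Finset.sum_add_distrib]
  congr 1
  ring

end ClearsDenominators

variable [Fintype F]

instance (H : ℕ) : Nonempty (degreeLT F H) := ⟨0⟩

theorem BoxEstimate.abs_expect_linearForms_sub_one_le {χ : ℝ → ℝ} {A : ℝ} {K : ℕ → ℝ}
    {m n k₀ w : ℕ} (hbox : BoxEstimate F χ m A K) {M : FieldChoice F} {N : ℕ+} {R : ℝ} {b : F[X]}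
    (hR : 1 ≤ R) (hRN : R ≤ N) (hwN : w ≤ N) (hw : 2 * (m * n * k₀) < w)
    (hN : 2 * m * R + m * n * k₀ ≤ N) (hb : IsCoprime b (polyPrimorial F w))
    {L : Fin m → Fin n → RatFunc F} (hL : ∀ i j, L i j ∈ smallRatFunc F k₀) (hL0 : ∀ i, L i ≠ 0)
    (hprop : ∀ i i', i ≠ i' → ∀ c : RatFunc F, L i ≠ c • L i') (d : Fin m → M.FqN N) :
    |(𝔼 x : Fin n → M.FqN N, ∏ i, sieveWeight χ R (polyPrimorial F w) b
      (M.rep N (∑ j, M.embed N (L i j) * x j + d i))) - 1| ≤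
        sieveError A (K w / R) (2 * (1 / 2) ^ w) := by
  obtain ⟨g, a, ha⟩ := exists_clearsDenominators hL
  simp only [Fintype.card_fin] at ha
  set D := m * n * k₀
  have hDN : D < N := by omega
  obtain ⟨H, hH⟩ := Nat.exists_eq_add_of_le hDN.le
  have hmH : 2 * m * R ≤ H := by
    have : (N : ℝ) = m * n * k₀ + H := mod_cast hH
    linarith
  rw [expect_translate fun (y : Fin n → degreeLT F H) j =>
    AdjoinRoot.mk (M.f N) (g * (y j : F[X]))]
  refine abs_expect_sub_le fun x => ?_
  simp only [Pi.add_apply, ha.rep_form_add hDN hH.ge]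
  refine hbox hR hRN hwN hmH (by positivity) hb (e := fun P => invNorm P ^ 2) (fun P _ hP => ?_)
    (sum_invNorm_sq_le _ w fun P hP => (Finset.mem_filter.1 hP).2)
  have hdeg : 2 * D < P.deg := hw.trans_le hP
  refine isGoodDensity_wTrickDensity hP (fun i => ha.exists_not_dvd (hL0 i) (by omega)) le_rfl
    fun i i' hii' => (localDensity_pair ?_).le
  obtain ⟨j, j', hj⟩ := ha.exists_minor_not_dvd (hL0 i') (hprop i i' hii') hdeg
  refine ⟨j, j', ?_⟩
  convert not_dvd_polyPrimorial_mul hP (not_dvd_polyPrimorial_mul hP hj) using 2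
  ring

end LinearForms

section Correlations

variable {F : Type*} [Field F] [Fintype F]

open scoped Classical in
/-- The sum of the inverse norms of the primes of degree less than `N` that divide `f`. -/
noncomputable def invNormSum (N : ℕ) (f : F[X]) : ℝ :=
  ∑ P ∈ primesLT F N with P.1 ∣ f, invNorm P

theorem invNormSum_nonneg (N : ℕ) (f : F[X]) : 0 ≤ invNormSum N f :=
  Finset.sum_nonneg fun P _ => (invNorm_pos P).le

theorem wTrickDensity_pair_le_invNorm {ι κ : Type*} [Fintype κ] [DecidableEq κ] [DecidableEq ι]
    {a : ι → κ → F[X]} {c : ι → F[X]} {b : F[X]} {w : ℕ} {P : MonicIrr F} {i i' : ι}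
    (hP : w ≤ P.deg) (ha : ∃ j, ¬ P.1 ∣ a i j) : wTrickDensity w b a c P {i, i'} ≤ invNorm P :=
  (localDensity_anti (Finset.singleton_subset_iff.2 (Finset.mem_insert_self i {i'}))).trans_eq
    (localDensity_singleton (ha.imp fun _ => not_dvd_polyPrimorial_mul hP))

theorem wTrickDensity_pair_eq_zero {ι κ : Type*} [Fintype κ] [DecidableEq κ] [DecidableEq ι]
    {a : κ → F[X]} {c : ι → F[X]} {b : F[X]} {w : ℕ} {P : MonicIrr F} {i i' : ι}
    (hP : w ≤ P.deg) (hc : ¬ P.1 ∣ c i - c i') :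
    wTrickDensity w b (fun _ => a) c P {i, i'} = 0 := by
  refine Finset.expect_eq_zero fun v _ => if_neg fun hv => not_dvd_polyPrimorial_mul hP hc ?_
  have hi := hv i (Finset.mem_insert_self i {i'})
  have hi' := hv i' (Finset.mem_insert_of_mem (Finset.mem_singleton_self i'))
  rw [← AdjoinRoot.mk_eq_zero]
  simp only [map_add, map_mul, map_sub] at hi hi' ⊢
  linear_combination hi - hi'

open scoped Classical in
/-- A bound for the local densities at `P` of the pairs among the translates `y + c i`. -/
noncomputable def shiftError {l : ℕ} (c : Fin l → F[X]) (P : MonicIrr F) : ℝ :=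
  invNorm P ^ 2 + ∑ i, ∑ j ∈ Finset.Ioi i, if P.1 ∣ c i - c j then invNorm P else 0

section

variable {l : ℕ} (c : Fin l → F[X]) (P : MonicIrr F)

open scoped Classical in
theorem shiftError_summand_nonneg (i j : Fin l) :
    0 ≤ if P.1 ∣ c i - c j then invNorm P else 0 := by
  split_ifs
  exacts [(invNorm_pos P).le, le_rfl]

theorem sq_invNorm_le_shiftError : invNorm P ^ 2 ≤ shiftError c P :=
  le_add_of_nonneg_right <| Finset.sum_nonneg fun i _ => Finset.sum_nonneg fun j _ =>
    shiftError_summand_nonneg c P i j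

variable {c P} in
theorem invNorm_le_shiftError {i j : Fin l} (hij : i < j) (hd : P.1 ∣ c i - c j) :
    invNorm P ≤ shiftError c P := by
  classical
  refine le_add_of_nonneg_of_le (sq_nonneg _) ?_
  calc invNorm P = if P.1 ∣ c i - c j then invNorm P else 0 := (if_pos hd).symm
    _ ≤ ∑ j ∈ Finset.Ioi i, if P.1 ∣ c i - c j then invNorm P else 0 :=
        Finset.single_le_sum (fun j _ => shiftError_summand_nonneg c P i j) (Finset.mem_Ioi.2 hij)
    _ ≤ _ :=
        Finset.single_le_sum (f := fun i => ∑ j ∈ Finset.Ioi i, _)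
          (fun i _ => Finset.sum_nonneg fun j _ => shiftError_summand_nonneg c P i j)
          (Finset.mem_univ i)

theorem sum_shiftError_le (N w : ℕ) :
    ∑ P ∈ primesLT F N with w ≤ P.deg, shiftError c P ≤
      2 + ∑ i, ∑ j ∈ Finset.Ioi i, invNormSum N (c i - c j) := by
  classical
  simp only [shiftError]
  rw [Finset.sum_add_distrib, Finset.sum_comm]
  refine add_le_add ?_ (Finset.sum_le_sum fun i _ => ?_)
  · refine (sum_invNorm_sq_le _ w fun P hP => (Finset.mem_filter.1 hP).2).trans ?_
    linarith [pow_le_one₀ (n := w) (by norm_num : (0 : ℝ) ≤ 1 / 2) (by norm_num)]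
  · rw [Finset.sum_comm]
    refine Finset.sum_le_sum fun j _ => ?_
    rw [← Finset.sum_filter]
    exact Finset.sum_le_sum_of_subset_of_nonneg
      (Finset.filter_subset_filter _ (Finset.filter_subset _ _)) fun P _ _ => (invNorm_pos P).le

variable {P} in
theorem isGoodDensity_wTrickDensity_shifts {b : F[X]} {w : ℕ} (hP : w ≤ P.deg) :
    IsGoodDensity (wTrickDensity w b (fun _ (_ : Fin 1) => 1) c P) (invNorm P)
      (shiftError c P) := by
  have hone : ∃ _j : Fin 1, ¬ P.1 ∣ 1 := ⟨0, P.prime.not_dvd_one⟩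
  refine isGoodDensity_wTrickDensity hP (fun _ => hone) (sq_invNorm_le_shiftError c P)
    fun i i' hii' => ?_
  wlog hlt : i < i' generalizing i i'
  · rw [Finset.pair_comm]
    exact this i' i hii'.symm (lt_of_le_of_ne (not_lt.1 hlt) hii'.symm)
  by_cases hd : P.1 ∣ c i - c i'
  · exact (wTrickDensity_pair_le_invNorm hP hone).trans (invNorm_le_shiftError hlt hd)
  · rw [wTrickDensity_pair_eq_zero hP hd]
    exact (sq_nonneg _).trans (sq_invNorm_le_shiftError c P)

end

theorem one_add_sieveError_le {A κ L : ℝ} (hA : 0 ≤ A) (hL : 0 ≤ L) :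
    1 + sieveError A κ L ≤ Real.exp (A * L) * (1 + A + κ) := by
  have hone : 1 ≤ Real.exp (A * L) := Real.one_le_exp (by positivity)
  unfold sieveError
  linarith

theorem BoxEstimate.expect_correlation_le {χ : ℝ → ℝ} {A : ℝ} {K : ℕ → ℝ} {l w : ℕ}
    (hbox : BoxEstimate F χ l A K) (hA : 0 ≤ A) {M : FieldChoice F} {N : ℕ+} {R : ℝ} {b : F[X]}
    (hR : 1 ≤ R) (hRN : R ≤ N) (hwN : w ≤ N) (hN : 2 * l * R ≤ N)
    (hb : IsCoprime b (polyPrimorial F w)) (h : Fin l → M.FqN N) :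
    (𝔼 x : M.FqN N, ∏ i, sieveWeight χ R (polyPrimorial F w) b (M.rep N (x + h i))) ≤
      Real.exp (A * (2 + ∑ i, ∑ j ∈ Finset.Ioi i, invNormSum N (M.rep N (h i - h j)))) *
        (1 + A + K w / R) := by
  set S := ∑ i, ∑ j ∈ Finset.Ioi i, invNormSum N (M.rep N (h i - h j))
  have hS0 : 0 ≤ S :=
    Finset.sum_nonneg fun i _ => Finset.sum_nonneg fun j _ => invNormSum_nonneg _ _
  have hL : 0 ≤ 2 + S := by linarith
  suffices hbound : |(𝔼 x : M.FqN N,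
      ∏ i, sieveWeight χ R (polyPrimorial F w) b (M.rep N (x + h i))) - 1| ≤
        sieveError A (K w / R) (2 + S) by
    linarith [(abs_le.1 hbound).2, one_add_sieveError_le (κ := K w / R) hA hL]
  let θ : (Fin 1 → degreeLT F (N : ℕ)) → M.FqN N := fun y => AdjoinRoot.mk (M.f N) (y 0 : F[X])
  rw [expect_translate θ]
  refine abs_expect_sub_le fun x => ?_
  have hform (y : Fin 1 → degreeLT F (N : ℕ)) (i) : M.rep N (x + θ y + h i) =
      ∑ j, (1 : F[X]) * (y j : F[X]) + M.rep N (x + h i) := by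
    rw [add_right_comm, add_comm, M.rep_add, M.rep_mk N (mem_degreeLT.1 (y 0).2),
      Fin.sum_univ_one, one_mul]
  have hdiff (i j) : M.rep N (x + h i) - M.rep N (x + h j) = M.rep N (h i - h j) := by
    rw [← M.rep_sub, add_sub_add_left_eq_sub]
  simp only [hform]
  refine hbox hR hRN hwN hN hL hb
    (fun P _ hP => isGoodDensity_wTrickDensity_shifts (fun i => M.rep N (x + h i)) hP) ?_
  simpa only [hdiff] using sum_shiftError_le (fun i => M.rep N (x + h i)) N w

end Correlations

section Moments

variable {F : Type*} [Field F] [Fintype F]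

theorem MonicIrr.card_adjoinRoot (P : MonicIrr F) :
    Fintype.card (AdjoinRoot P.1) = Fintype.card F ^ P.deg := by
  have := P.monic.finite_adjoinRoot
  rw [Module.card_eq_pow_finrank (K := F), (AdjoinRoot.powerBasis' P.monic).finrank]
  rfl

theorem MonicIrr.dvd_X_pow_card_sub_X (P : MonicIrr F) :
    P.1 ∣ X ^ Fintype.card F ^ P.deg - X := by
  rw [← AdjoinRoot.mk_eq_zero, map_sub, map_pow, ← P.card_adjoinRoot, FiniteField.pow_card,
    sub_self]

theorem card_filter_deg_mul_le (U : Finset (MonicIrr F)) {n : ℕ} (hn : 0 < n) :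
    (U.filter fun P => P.deg = n).card * n ≤ Fintype.card F ^ n := by
  have hcard : 1 < Fintype.card F := two_le_card
  have hdvd : ∏ P ∈ U with P.deg = n, P.1 ∣ X ^ Fintype.card F ^ n - X := by
    rw [MonicIrr.prod_dvd_iff]
    intro P hP
    rw [← (Finset.mem_filter.1 hP).2]
    exact P.dvd_X_pow_card_sub_X
  have hdeg := natDegree_le_of_dvd hdvd (FiniteField.X_pow_card_pow_sub_X_ne_zero F hn.ne' hcard)
  rw [MonicIrr.natDegree_prod, FiniteField.X_pow_card_pow_sub_X_natDegree_eq F hn.ne' hcard] at hdeg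
  rwa [Finset.sum_congr rfl fun P hP => (Finset.mem_filter.1 hP).2, Finset.sum_const,
    smul_eq_mul] at hdeg

theorem sum_filter_deg_invNorm_le (U : Finset (MonicIrr F)) {n : ℕ} (hn : 0 < n) :
    ∑ P ∈ U with P.deg = n, invNorm P ≤ (n : ℝ)⁻¹ := by
  have : (0 : ℝ) < Fintype.card F := Nat.cast_pos.2 Fintype.card_pos
  have hterm : ∀ P ∈ U.filter (fun P => P.deg = n), invNorm P = ((Fintype.card F : ℝ) ^ n)⁻¹ :=
    fun P hP => by rw [invNorm, (Finset.mem_filter.1 hP).2]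
  rw [Finset.sum_congr rfl hterm, Finset.sum_const, nsmul_eq_mul, ← div_eq_mul_inv,
    div_le_iff₀ (by positivity), inv_mul_eq_div, le_div_iff₀ (Nat.cast_pos.2 hn)]
  exact_mod_cast card_filter_deg_mul_le U hn

theorem sum_invNorm_primesLT_le (N : ℕ) :
    ∑ P ∈ primesLT F N, invNorm P ≤ 1 + Real.log N := by
  have hmaps : ∀ P ∈ primesLT F N, P.deg ∈ Finset.Icc 1 N := fun P hP =>
    Finset.mem_Icc.2 ⟨P.deg_pos, (mem_primesLT.1 hP).le⟩
  calc ∑ P ∈ primesLT F N, invNorm P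
      = ∑ n ∈ Finset.Icc 1 N, ∑ P ∈ primesLT F N with P.deg = n, invNorm P :=
        (Finset.sum_fiberwise_of_maps_to hmaps _).symm
    _ ≤ ∑ n ∈ Finset.Icc 1 N, (n : ℝ)⁻¹ := Finset.sum_le_sum fun n hn =>
        sum_filter_deg_invNorm_le _ (Finset.mem_Icc.1 hn).1
    _ = (harmonic N : ℝ) := by rw [harmonic_eq_sum_Icc]; push_cast; rfl
    _ ≤ 1 + Real.log N := harmonic_le_one_add_log N

open scoped Classical in
theorem card_filter_dvd_mul_le {D : F[X]} (hD : D ≠ 0) (N : ℕ) :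
    {h ∈ (polysLT F N).erase 0 | D ∣ h}.card * Fintype.card F ^ D.natDegree ≤
      Fintype.card F ^ N := by
  rcases lt_or_ge N D.natDegree with hlt | hle
  · rw [Finset.filter_false_of_mem, Finset.card_empty, zero_mul]
    · exact Nat.zero_le _
    intro h hh hDh
    obtain ⟨hh0, hhN⟩ := Finset.mem_erase.1 hh
    rw [mem_polysLT, degree_eq_natDegree hh0, Nat.cast_lt] at hhN
    exact (natDegree_le_of_dvd hDh hh0).not_gt (hhN.trans hlt)
  · obtain ⟨e, rfl⟩ := Nat.exists_eq_add_of_le' hle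
    rw [pow_add, ← card_polysLT e]
    refine Nat.mul_le_mul_right _ (Finset.card_le_card_of_surjOn (fun g => D * g) fun h hh => ?_)
    obtain ⟨hh, g, rfl⟩ := Finset.mem_filter.1 hh
    obtain ⟨hh0, hhN⟩ := Finset.mem_erase.1 hh
    have hg := right_ne_zero_of_mul hh0
    refine ⟨g, ?_, rfl⟩
    rw [mem_polysLT, degree_eq_natDegree hh0, Nat.cast_lt, natDegree_mul hD hg] at hhN
    rw [Finset.mem_coe, mem_polysLT, degree_eq_natDegree hg, Nat.cast_lt]
    omega

theorem prod_invNorm (S : Finset (MonicIrr F)) :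
    ∏ P ∈ S, invNorm P = ((Fintype.card F : ℝ) ^ (∏ P ∈ S, P.1).natDegree)⁻¹ := by
  rw [MonicIrr.natDegree_prod, ← Finset.prod_pow_eq_pow_sum, ← Finset.prod_inv_distrib]
  rfl

open scoped Classical in
theorem card_filter_prod_dvd_le (S : Finset (MonicIrr F)) (N : ℕ) :
    ({h ∈ (polysLT F N).erase 0 | ∏ P ∈ S, P.1 ∣ h}.card : ℝ) ≤
      (∏ P ∈ S, invNorm P) * (Fintype.card F : ℝ) ^ N := by
  have : (0 : ℝ) < Fintype.card F := Nat.cast_pos.2 Fintype.card_pos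
  rw [prod_invNorm, inv_mul_eq_div, le_div_iff₀ (by positivity)]
  exact_mod_cast card_filter_dvd_mul_le (MonicIrr.monic_prod S).ne_zero N

theorem exp_sub_one_le {c x : ℝ} (hc : 0 ≤ c) (hx0 : 0 ≤ x) (hx : x ≤ 1) :
    Real.exp (c * x) - 1 ≤ c * Real.exp c * x := by
  have h1 := Real.add_one_le_exp (-(c * x))
  have h2 : Real.exp (c * x) * Real.exp (-(c * x)) = 1 := by rw [← Real.exp_add]; simp
  have h3 : Real.exp (c * x) ≤ Real.exp c := Real.exp_le_exp.2 (by nlinarith)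
  have h4 := Real.exp_pos (c * x)
  have h5 : 0 ≤ c * x := by positivity
  nlinarith

open scoped Classical in
theorem exp_mul_invNormSum (c : ℝ) (N : ℕ) (h : F[X]) :
    Real.exp (c * invNormSum N h) = ∑ S ∈ (primesLT F N).powerset,
      if ∏ P ∈ S, P.1 ∣ h then ∏ P ∈ S, (Real.exp (c * invNorm P) - 1) else 0 := by
  have hprod : Real.exp (c * invNormSum N h) =
      ∏ P ∈ primesLT F N, (1 + if P.1 ∣ h then Real.exp (c * invNorm P) - 1 else 0) := by
    rw [invNormSum, Finset.mul_sum, Real.exp_sum, Finset.prod_filter]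
    refine Finset.prod_congr rfl fun P _ => ?_
    split_ifs <;> ring
  simp only [hprod, Finset.prod_one_add, Finset.prod_ite_zero, MonicIrr.prod_dvd_iff]

theorem prod_one_add_exp_sub_one_mul_le {c : ℝ} (hc : 0 ≤ c) (U : Finset (MonicIrr F)) :
    ∏ P ∈ U, (1 + (Real.exp (c * invNorm P) - 1) * invNorm P) ≤
      Real.exp (c * Real.exp c * 2) := by
  have hterm (P : MonicIrr F) : 1 + (Real.exp (c * invNorm P) - 1) * invNorm P ≤
      Real.exp (c * Real.exp c * invNorm P ^ 2) := by
    have hP := exp_sub_one_le hc (invNorm_pos P).le (by linarith [invNorm_le_half P])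
    have := mul_le_mul_of_nonneg_right hP (invNorm_pos P).le
    linarith [Real.add_one_le_exp (c * Real.exp c * invNorm P ^ 2)]
  have hnonneg (P : MonicIrr F) : 0 ≤ 1 + (Real.exp (c * invNorm P) - 1) * invNorm P := by
    have hP := invNorm_pos P
    have := mul_nonneg (sub_nonneg.2 (Real.one_le_exp (mul_nonneg hc hP.le))) hP.le
    linarith
  refine (Finset.prod_le_prod (fun P _ => hnonneg P) fun P _ => hterm P).trans ?_
  rw [← Real.exp_sum, ← Finset.mul_sum]
  refine Real.exp_le_exp.2 (mul_le_mul_of_nonneg_left ?_ (by positivity))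
  simpa only [pow_zero, mul_one] using sum_invNorm_sq_le U 0 fun P _ => Nat.zero_le _

open scoped Classical in
theorem sum_exp_invNormSum_le {c : ℝ} (hc : 0 ≤ c) (N : ℕ) :
    ∑ h ∈ (polysLT F N).erase 0, Real.exp (c * invNormSum N h) ≤
      Real.exp (c * Real.exp c * 2) * (Fintype.card F : ℝ) ^ N := by
  have hnonneg (P : MonicIrr F) : 0 ≤ Real.exp (c * invNorm P) - 1 :=
    sub_nonneg.2 (Real.one_le_exp (mul_nonneg hc (invNorm_pos P).le))
  simp only [exp_mul_invNormSum]
  rw [Finset.sum_comm]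
  calc _ ≤ ∑ S ∈ (primesLT F N).powerset,
        (∏ P ∈ S, (Real.exp (c * invNorm P) - 1) * invNorm P) * (Fintype.card F : ℝ) ^ N := by
        refine Finset.sum_le_sum fun S _ => ?_
        rw [← Finset.sum_filter, Finset.sum_const, nsmul_eq_mul, Finset.prod_mul_distrib, mul_comm,
          mul_assoc]
        exact mul_le_mul_of_nonneg_left (card_filter_prod_dvd_le S N)
          (Finset.prod_nonneg fun P _ => hnonneg P)
    _ = (∏ P ∈ primesLT F N, (1 + (Real.exp (c * invNorm P) - 1) * invNorm P)) *
          (Fintype.card F : ℝ) ^ N := by rw [← Finset.sum_mul, Finset.prod_one_add]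
    _ ≤ _ := mul_le_mul_of_nonneg_right (prod_one_add_exp_sub_one_mul_le hc _) (by positivity)

theorem exists_exp_log_le_pow {c : ℝ} (hc : 0 ≤ c) :
    ∃ B : ℝ, 0 ≤ B ∧ ∀ N : ℕ, 0 < N → Real.exp (c * (1 + Real.log N)) ≤ B * 2 ^ N := by
  have hlog2 : 0 < Real.log 2 := Real.log_pos one_lt_two
  set η := Real.log 2 / (c + 1) with hη
  have hη0 : 0 < η := by positivity
  have hcη : c * η ≤ Real.log 2 := by
    rw [hη, mul_div_assoc', div_le_iff₀ (by positivity)]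
    linarith
  refine ⟨Real.exp (c - c * Real.log η), (Real.exp_pos _).le, fun N hN => ?_⟩
  have hN' : (0 : ℝ) < N := Nat.cast_pos.2 hN
  have hlog : Real.log N ≤ η * N - Real.log η := by
    have := Real.log_le_self (mul_pos hη0 hN').le
    rw [Real.log_mul hη0.ne' hN'.ne'] at this
    linarith
  have hpow : (2 : ℝ) ^ N = Real.exp (N * Real.log 2) := by
    rw [Real.exp_nat_mul, Real.exp_log two_pos]
  rw [hpow, ← Real.exp_add, Real.exp_le_exp]
  calc c * (1 + Real.log N) ≤ c * (1 + (η * N - Real.log η)) := by gcongr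
    _ = c - c * Real.log η + N * (c * η) := by ring
    _ ≤ c - c * Real.log η + N * Real.log 2 := by gcongr

theorem FieldChoice.card_FqN (M : FieldChoice F) (N : ℕ+) :
    Fintype.card (M.FqN N) = Fintype.card F ^ (N : ℕ) := by
  have := (M.monic N).finite_adjoinRoot
  rw [Module.card_eq_pow_finrank (K := F), (AdjoinRoot.powerBasis' (M.monic N)).finrank,
    AdjoinRoot.powerBasis'_dim, M.natDegree_eq]

theorem FieldChoice.expect_rep (M : FieldChoice F) (N : ℕ+) (f : F[X] → ℝ) :
    𝔼 x : M.FqN N, f (M.rep N x) = (∑ h ∈ polysLT F N, f h) / (Fintype.card F : ℝ) ^ (N : ℕ) := by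
  rw [Fintype.expect_eq_sum_div_card, M.card_FqN, Nat.cast_pow]
  congr 1
  exact Finset.sum_bij (fun x _ => M.rep N x) (fun x _ => mem_polysLT.2 (M.degree_rep_lt N x))
    (fun x _ y _ h => M.rep_injective N h)
    (fun h hh => ⟨AdjoinRoot.mk (M.f N) h, Finset.mem_univ _, M.rep_mk N (mem_polysLT.1 hh)⟩)
    fun _ _ => rfl

theorem exists_expect_exp_invNormSum_le (F : Type*) [Field F] [Fintype F] {c : ℝ} (hc : 0 ≤ c) :
    ∃ B : ℝ, ∀ (M : FieldChoice F) (N : ℕ+),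
      (𝔼 x : M.FqN N, Real.exp (c * invNormSum N (M.rep N x))) ≤ B := by
  classical
  obtain ⟨B, hB0, hB⟩ := exists_exp_log_le_pow hc
  have hq : (2 : ℝ) ≤ Fintype.card F := Nat.ofNat_le_cast.2 two_le_card
  refine ⟨Real.exp (c * Real.exp c * 2) + B, fun M N => ?_⟩
  have hmem : (0 : F[X]) ∈ polysLT F N := by
    rw [mem_polysLT, degree_zero]
    exact WithBot.bot_lt_coe _
  have hzero : invNormSum N (0 : F[X]) ≤ 1 + Real.log N := by
    rw [invNormSum, Finset.filter_true_of_mem fun P _ => dvd_zero _]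
    exact sum_invNorm_primesLT_le N
  rw [M.expect_rep N fun h => Real.exp (c * invNormSum N h), div_le_iff₀ (by positivity), add_mul,
    ← Finset.sum_erase_add _ _ hmem]
  refine add_le_add (sum_exp_invNormSum_le hc N) ?_
  calc _ ≤ Real.exp (c * (1 + Real.log N)) := by gcongr
    _ ≤ B * 2 ^ (N : ℕ) := hB N N.pos
    _ ≤ _ := by gcongr

end Moments

section CorrelationWeights

variable {F : Type*} [Field F] [Fintype F]

theorem exp_pair_sum_le {l l₀ : ℕ} (hl : 2 ≤ l) (hl₀ : l ≤ l₀) {c : ℝ} (hc : 0 ≤ c)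
    {s : Fin l → Fin l → ℝ} (hs : ∀ i j, 0 ≤ s i j) :
    Real.exp (c * ∑ i, ∑ j ∈ Finset.Ioi i, s i j) ≤
      ∑ i, ∑ j ∈ Finset.Ioi i, Real.exp (c * l₀ ^ 2 * s i j) := by
  classical
  rw [Finset.sum_sigma', Finset.sum_sigma']
  set T := (Finset.univ : Finset (Fin l)).sigma fun i => Finset.Ioi i with hT
  have hne : T.Nonempty := ⟨⟨⟨0, by omega⟩, ⟨1, by omega⟩⟩, by simp [hT]⟩
  have hcard : (T.card : ℝ) ≤ l₀ ^ 2 := by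
    have : T.card ≤ l ^ 2 := by simpa [sq] using Finset.card_le_univ T
    exact_mod_cast this.trans (Nat.pow_le_pow_left hl₀ 2)
  obtain ⟨t, ht, hmax⟩ := Finset.exists_max_image T (fun t => s t.1 t.2) hne
  have hsum : ∑ t ∈ T, s t.1 t.2 ≤ l₀ ^ 2 * s t.1 t.2 :=
    (Finset.sum_le_card_nsmul _ _ _ hmax).trans <| by
      rw [nsmul_eq_mul]
      exact mul_le_mul_of_nonneg_right hcard (hs _ _)
  calc Real.exp (c * ∑ t ∈ T, s t.1 t.2)
      ≤ Real.exp (c * l₀ ^ 2 * s t.1 t.2) := by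
        rw [mul_assoc]
        exact Real.exp_le_exp.2 (mul_le_mul_of_nonneg_left hsum hc)
    _ ≤ _ := Finset.single_le_sum (f := fun t : (_ : Fin l) × Fin l =>
        Real.exp (c * l₀ ^ 2 * s t.1 t.2)) (fun t _ => (Real.exp_pos _).le) ht

theorem le_pair_sum {l : ℕ} (hl : 2 ≤ l) {s : Fin l → Fin l → ℝ} (hs : ∀ i j, 0 ≤ s i j) {B : ℝ}
    (hB : ∀ i j, B ≤ s i j) : B ≤ ∑ i, ∑ j ∈ Finset.Ioi i, s i j := by
  have hpair : (⟨1, by omega⟩ : Fin l) ∈ Finset.Ioi (⟨0, by omega⟩ : Fin l) := by simp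
  calc B ≤ s ⟨0, by omega⟩ ⟨1, by omega⟩ := hB _ _
    _ ≤ ∑ j ∈ Finset.Ioi ⟨0, by omega⟩, s ⟨0, by omega⟩ j :=
        Finset.single_le_sum (fun j _ => hs _ j) hpair
    _ ≤ _ := Finset.single_le_sum (f := fun i => ∑ j ∈ Finset.Ioi i, s i j)
        (fun i _ => Finset.sum_nonneg fun j _ => hs i j) (Finset.mem_univ _)

theorem expect_prod_shift_le {G : Type*} [AddCommGroup G] [Fintype G] {f : G → ℝ}
    (hf : ∀ x, 0 ≤ f x) {l l₀ : ℕ} (hl : l ≤ l₀) (h : Fin l → G) :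
    (𝔼 x, ∏ i, f (x + h i)) ≤ (1 + ∑ y, f y) ^ l₀ := by
  have hsum : 0 ≤ ∑ y, f y := Finset.sum_nonneg fun y _ => hf y
  have hle (x : G) : f x ≤ 1 + ∑ y, f y :=
    (Finset.single_le_sum (fun y _ => hf y) (Finset.mem_univ x)).trans (by linarith)
  refine Finset.expect_le Finset.univ_nonempty fun x _ => ?_
  calc ∏ i, f (x + h i) ≤ ∏ _i : Fin l, (1 + ∑ y, f y) :=
        Finset.prod_le_prod (fun i _ => hf _) fun i _ => hle _
    _ = (1 + ∑ y, f y) ^ l := by rw [Finset.prod_const, Finset.card_univ, Fintype.card_fin]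
    _ ≤ (1 + ∑ y, f y) ^ l₀ := pow_le_pow_right₀ (by linarith) hl

theorem exists_forall_le_of_eventually_le {u : ℕ+ → ℝ} {N₀ : ℕ+} {B : ℝ}
    (h : ∀ N, N₀ ≤ N → u N ≤ B) : ∃ C, ∀ N, u N ≤ C := by
  obtain ⟨C, hC⟩ := ((Finset.Iio N₀).image u).exists_le
  refine ⟨max B C, fun N => ?_⟩
  rcases le_or_gt N₀ N with hN | hN
  · exact (h N hN).trans (le_max_left B C)
  · exact (hC _ (Finset.mem_image_of_mem u (Finset.mem_Iio.2 hN))).trans (le_max_right B C)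

variable (M : FieldChoice F) {ν : ∀ N : ℕ+, M.FqN N → ℝ} {D c : ℝ} {N₀ : ℕ+} {l₀ : ℕ}

/-- The weights `τ` of the correlation condition: an exponential of `invNormSum` for large `N`, and
a crude bound for the finitely many other `N`. -/
noncomputable def correlationWeight (ν : ∀ N : ℕ+, M.FqN N → ℝ) (D c : ℝ) (N₀ : ℕ+) (l₀ : ℕ)
    (N : ℕ+) (x : M.FqN N) : ℝ :=
  if N₀ ≤ N then D * Real.exp (c * l₀ ^ 2 * invNormSum N (M.rep N x)) else (1 + ∑ y, ν N y) ^ l₀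

theorem correlationWeight_nonneg (hν : ∀ N x, 0 ≤ ν N x) (hD : 0 ≤ D) (N : ℕ+) (x : M.FqN N) :
    0 ≤ correlationWeight M ν D c N₀ l₀ N x := by
  have hsum : 0 ≤ ∑ y, ν N y := Finset.sum_nonneg fun y _ => hν N y
  unfold correlationWeight
  split_ifs <;> positivity

theorem exists_expect_correlationWeight_rpow_le (hD : 0 ≤ D) (hc : 0 ≤ c) {p : ℝ} (hp : 0 ≤ p) :
    ∃ C : ℝ, ∀ N : ℕ+, (𝔼 x : M.FqN N, correlationWeight M ν D c N₀ l₀ N x ^ p) ≤ C := by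
  obtain ⟨B, hB⟩ := exists_expect_exp_invNormSum_le F (c := p * (c * l₀ ^ 2)) (by positivity)
  refine exists_forall_le_of_eventually_le (N₀ := N₀) (B := D ^ p * B) fun N hN => ?_
  refine le_trans (le_of_eq ?_) (mul_le_mul_of_nonneg_left (hB M N) (Real.rpow_nonneg hD p))
  rw [Finset.mul_expect]
  refine Finset.expect_congr rfl fun x _ => ?_
  rw [correlationWeight, if_pos hN, Real.mul_rpow hD (Real.exp_pos _).le, ← Real.exp_mul]
  congr 2
  ring

theorem correlationCondition_of_eventually (hν : ∀ N x, 0 ≤ ν N x) (hD : 0 ≤ D) (hc : 0 ≤ c)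
    (h : ∀ N : ℕ+, N₀ ≤ N → ∀ l : ℕ, l ≤ l₀ → ∀ h : Fin l → M.FqN N,
      (𝔼 x : M.FqN N, ∏ i, ν N (x + h i)) ≤
        D * Real.exp (c * ∑ i, ∑ j ∈ Finset.Ioi i, invNormSum N (M.rep N (h i - h j)))) :
    CorrelationCondition M l₀ ν := by
  refine ⟨correlationWeight M ν D c N₀ l₀, correlationWeight_nonneg M hν hD, fun p hp =>
    exists_expect_correlationWeight_rpow_le M hD hc (by linarith), fun N l hl hl₀ g => ?_⟩
  rcases le_or_gt N₀ N with hN | hN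
  · refine (h N hN l hl₀ g).trans ?_
    simp only [correlationWeight, if_pos hN, ← Finset.mul_sum]
    exact mul_le_mul_of_nonneg_left
      (exp_pair_sum_le hl hl₀ hc fun i j => invNormSum_nonneg N (M.rep N (g i - g j))) hD
  · refine (expect_prod_shift_le (hν N) hl₀ g).trans
      (le_pair_sum hl (fun i j => correlationWeight_nonneg M hν hD N _) fun i j => ?_)
    rw [correlationWeight, if_neg hN.not_ge]

end CorrelationWeights

section PrimeCounting

variable {F : Type*} [Field F] [Fintype F]

open scoped Classical in
theorem ncard_degree_lt (s : Set F[X]) (N : ℕ) :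
    {f ∈ s | f.degree < (N : WithBot ℕ)}.ncard = ((polysLT F N).filter (· ∈ s)).card := by
  rw [← Set.ncard_coe_finset]
  congr 1
  ext f
  rw [Finset.mem_coe, Finset.mem_filter, mem_polysLT, and_comm]
  rfl

/-- The minimal polynomials of the elements of the field with `q ^ n` elements are irreducible, and
each has at most `n` roots. -/
theorem FieldChoice.card_pow_le_mul_ncard (M : FieldChoice F) (n : ℕ+) :
    Fintype.card F ^ (n : ℕ) ≤
      n * {f ∈ irreducibles F | f.degree < ((n + 1 : ℕ) : WithBot ℕ)}.ncard := by
  classical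
  have := (M.monic n).finite_adjoinRoot
  have hintegral (y : M.FqN n) : IsIntegral F y := Algebra.IsIntegral.isIntegral y
  have hdeg (y : M.FqN n) : (minpoly F y).natDegree ≤ n := by
    refine (minpoly.natDegree_le y).trans_eq ?_
    rw [(AdjoinRoot.powerBasis' (M.monic n)).finrank, AdjoinRoot.powerBasis'_dim, M.natDegree_eq]
  rw [ncard_degree_lt, ← M.card_FqN n, ← Finset.card_univ]
  refine Finset.card_le_mul_card_image_of_maps_to (f := fun y => minpoly F y) (fun y _ => ?_) _
    fun p hp => ?_
  · refine Finset.mem_filter.2 ⟨mem_polysLT.2 ?_, minpoly.irreducible (hintegral y)⟩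
    rw [degree_eq_natDegree (minpoly.ne_zero (hintegral y)), Nat.cast_lt]
    exact Nat.lt_succ_of_le (hdeg y)
  · obtain ⟨hpdeg, hpirr⟩ := Finset.mem_filter.1 hp
    have hp0 : p ≠ 0 := Irreducible.ne_zero hpirr
    rw [mem_polysLT, degree_eq_natDegree hp0, Nat.cast_lt, Nat.lt_succ_iff] at hpdeg
    calc _ ≤ (p.map (algebraMap F (M.FqN n))).roots.toFinset.card := by
          refine Finset.card_le_card fun y hy => ?_
          obtain rfl : minpoly F y = p := (Finset.mem_filter.1 hy).2
          rw [Multiset.mem_toFinset, mem_roots (map_ne_zero hp0), IsRoot.def, eval_map_algebraMap,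
            minpoly.aeval]
      _ ≤ (p.map (algebraMap F (M.FqN n))).natDegree :=
          (Multiset.toFinset_card_le _).trans (card_roots' _)
      _ ≤ n := natDegree_map_le.trans hpdeg

theorem FieldChoice.pow_div_le_ncard (M : FieldChoice F) {n : ℕ} (hn : 0 < n) :
    (Fintype.card F : ℝ) ^ n / n ≤
      {f ∈ irreducibles F | f.degree < ((n + 1 : ℕ) : WithBot ℕ)}.ncard := by
  rw [div_le_iff₀' (Nat.cast_pos.2 hn)]
  exact_mod_cast M.card_pow_le_mul_ncard ⟨n, hn⟩

theorem eventually_mul_pow_half_le {q : ℕ} (hq : 2 ≤ q) {ε : ℝ} (hε : 0 < ε) :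
    ∀ᶠ N : ℕ in atTop, (q : ℝ) ^ (N / 2) ≤ ε / (4 * q * N) * (q : ℝ) ^ N := by
  have hq2 : (2 : ℝ) ≤ q := Nat.ofNat_le_cast.2 hq
  have hlim : ∀ᶠ m : ℕ in atTop, (m : ℝ) ^ 1 * (1 / 2) ^ m < ε / (8 * q) :=
    (tendsto_pow_const_mul_const_pow_of_abs_lt_one 1
      (by rw [abs_of_pos] <;> norm_num : |(1 / 2 : ℝ)| < 1)).eventually_lt_const (by positivity)
  have htop : Tendsto (fun N : ℕ => N - N / 2) atTop atTop :=
    tendsto_atTop.2 fun a => (eventually_ge_atTop (2 * a)).mono fun N hN => by omega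
  filter_upwards [htop.eventually hlim, eventually_gt_atTop 0] with N hN hN0
  obtain ⟨m, hm⟩ : ∃ m, m = N - N / 2 := ⟨_, rfl⟩
  rw [← hm, pow_one, one_div, inv_pow, ← div_eq_mul_inv, div_lt_div_iff₀ (by positivity)
    (by positivity)] at hN
  have : (0 : ℝ) < N := Nat.cast_pos.2 hN0
  have hNm : (N : ℝ) ≤ 2 * m := by exact_mod_cast (by omega : N ≤ 2 * m)
  have hsplit : (q : ℝ) ^ N = (q : ℝ) ^ (N / 2) * (q : ℝ) ^ m := by rw [← pow_add]; congr 1; omega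
  rw [hsplit, div_mul_eq_mul_div, le_div_iff₀ (by positivity), mul_left_comm ε]
  refine mul_le_mul_of_nonneg_left ?_ (by positivity)
  calc (4 : ℝ) * q * N ≤ 4 * q * (2 * m) := by gcongr
    _ = m * (8 * q) := by ring
    _ ≤ ε * 2 ^ m := hN.le
    _ ≤ ε * (q : ℝ) ^ m := by gcongr

/-- After the polynomials of degree less than `N / 2` are discarded, the elements of `A` still make
up a proportion `ε / (4 * q * N)` of the polynomials of degree less than `N`. -/
def IsDenseAt (A : Set F[X]) (ε : ℝ) (N : ℕ) : Prop :=
  (Fintype.card F : ℝ) ^ (N / 2) + ε / (4 * Fintype.card F * N) * (Fintype.card F : ℝ) ^ N ≤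
    {f ∈ A | f.degree < (N : WithBot ℕ)}.ncard

theorem FieldChoice.frequently_isDenseAt (M : FieldChoice F) {A : Set F[X]} {ε : ℝ} (hε : 0 < ε)
    (h : ε ≤ relUpperDensity A) : ∃ᶠ N : ℕ in atTop, IsDenseAt A ε N := by
  have : (0 : ℝ) < Fintype.card F := Nat.cast_pos.2 Fintype.card_pos
  have hfreq := frequently_lt_of_lt_limsup
    (isCoboundedUnder_le_of_le atTop (x := 0) fun N => by positivity)
    ((half_lt_self hε).trans_le h)
  refine (hfreq.and_eventually ((eventually_mul_pow_half_le (two_le_card (F := F)) hε).and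
    (eventually_ge_atTop 2))).mono fun N ⟨hdens, hhalf, hN⟩ => ?_
  obtain ⟨n, rfl⟩ := Nat.exists_eq_add_of_le' (one_le_two.trans hN)
  have hn : 0 < n := by omega
  have hn' : (0 : ℝ) < n := Nat.cast_pos.2 hn
  have hirr := M.pow_div_le_ncard hn
  rw [lt_div_iff₀ ((by positivity : 0 < (Fintype.card F : ℝ) ^ n / n).trans_le hirr)] at hdens
  have hmain : 2 * (ε / (4 * Fintype.card F * ((n + 1 : ℕ) : ℝ)) * (Fintype.card F : ℝ) ^ (n + 1)) ≤
      ε / 2 * {f ∈ irreducibles F | f.degree < ((n + 1 : ℕ) : WithBot ℕ)}.ncard :=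
    calc _ = ε / 2 * ((Fintype.card F : ℝ) ^ n / (n + 1)) := by push_cast; field_simp; ring
      _ ≤ ε / 2 * ((Fintype.card F : ℝ) ^ n / n) := by gcongr; linarith
      _ ≤ _ := by gcongr
  rw [IsDenseAt]
  linarith

end PrimeCounting

section Residues

variable {F : Type*} [Field F]

theorem degree_divByMonic_lt_of_degree_lt {W f : F[X]} (hW : W.Monic) {N : ℕ}
    (hf : f.degree < ((N + W.natDegree : ℕ) : WithBot ℕ)) :
    (f /ₘ W).degree < (N : WithBot ℕ) := by
  rcases eq_or_ne (f /ₘ W) 0 with h0 | h0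
  · rw [h0, degree_zero]
    exact WithBot.bot_lt_coe _
  have hle : W.degree ≤ f.degree := not_lt.1 fun h => h0 ((divByMonic_eq_zero_iff hW).2 h)
  rw [← degree_add_divByMonic hW hle, degree_eq_natDegree hW.ne_zero, degree_eq_natDegree h0] at hf
  rw [degree_eq_natDegree h0]
  norm_cast at hf ⊢
  omega

variable [Fintype F]

theorem totientRatio_pos (w : ℕ) :
    0 < (polyTotient (polyPrimorial F w) : ℝ) / polyNorm (polyPrimorial F w) := by
  rw [polyTotient_div_polyNorm]
  exact Finset.prod_pos fun P _ => by linarith [invNorm_le_half P]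

theorem totientRatio_le_one (w : ℕ) :
    (polyTotient (polyPrimorial F w) : ℝ) / polyNorm (polyPrimorial F w) ≤ 1 := by
  rw [polyTotient_div_polyNorm]
  exact Finset.prod_le_one (fun P _ => by linarith [invNorm_le_half P])
    fun P _ => by linarith [invNorm_pos P]

theorem polyTotient_polyPrimorial_pos (w : ℕ) : 0 < polyTotient (polyPrimorial F w) :=
  Nat.pos_of_ne_zero fun h => by simpa [h] using totientRatio_pos (F := F) w

theorem isCoprime_polyPrimorial_of_irreducible {f : F[X]} (hf : Irreducible f) {w : ℕ}
    (h : w ≤ f.natDegree) : IsCoprime f (polyPrimorial F w) := by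
  refine isCoprime_polyPrimorial_iff.2 fun P hP hd => (mem_primesLT.1 hP).not_ge (h.trans_eq ?_)
  exact (natDegree_eq_of_degree_eq (degree_eq_degree_of_associated
    (P.irreducible.associated_of_dvd hf hd))).symm

theorem card_filter_natDegree_lt_le (s : Finset F[X]) (T : ℕ) :
    {f ∈ s | f.natDegree < T}.card ≤ Fintype.card F ^ T := by
  rw [← card_polysLT T]
  exact Finset.card_le_card fun f hf => mem_polysLT.2
    (degree_le_natDegree.trans_lt (Nat.cast_lt.2 (Finset.mem_filter.1 hf).2))

open scoped Classical in
theorem card_filter_modByMonic_eq_le {W : F[X]} (hW : W.Monic) (N : ℕ) (p : F[X] → Prop)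
    (c : F[X]) :
    {f ∈ polysLT F (N + W.natDegree) | p f ∧ f %ₘ W = c}.card ≤
      {h ∈ polysLT F N | p (W * h + c)}.card := by
  have hdiv {f : F[X]} (hf : f %ₘ W = c) : W * (f /ₘ W) + c = f := by
    rw [← hf, add_comm, modByMonic_add_div]
  refine Finset.card_le_card_of_injOn (fun f => f /ₘ W) (fun f hf => ?_) fun f hf g hg hfg => ?_
  · obtain ⟨hdeg, hp, hfc⟩ := Finset.mem_filter.1 hf
    refine Finset.mem_filter.2 ⟨mem_polysLT.2
      (degree_divByMonic_lt_of_degree_lt hW (mem_polysLT.1 hdeg)), ?_⟩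
    rwa [hdiv hfc]
  · rw [← hdiv (Finset.mem_filter.1 hf).2.2, ← hdiv (Finset.mem_filter.1 hg).2.2]
    exact congrArg (W * · + c) hfg

open scoped Classical in
theorem ncard_degree_lt_le_pow_add (A : Set F[X]) (E T : ℕ) :
    {f ∈ A | f.degree < (E : WithBot ℕ)}.ncard ≤
      Fintype.card F ^ T + {f ∈ polysLT F E | f ∈ A ∧ T ≤ f.natDegree}.card := by
  rw [ncard_degree_lt, ← Finset.card_filter_add_card_filter_not (fun f => f.natDegree < T)]
  refine add_le_add (card_filter_natDegree_lt_le _ T) (Finset.card_le_card fun f hf => ?_)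
  simpa only [Finset.mem_filter, not_lt, and_assoc] using hf

open scoped Classical in
theorem exists_residue_card_le {A : Set F[X]} (hA : A ⊆ irreducibles F) {w T : ℕ} (hT : w ≤ T)
    (N : ℕ) :
    ∃ b : F[X], b.degree < (polyPrimorial F w).degree ∧ IsCoprime b (polyPrimorial F w) ∧
      {f ∈ A | f.degree < ((N + (polyPrimorial F w).natDegree : ℕ) : WithBot ℕ)}.ncard ≤
        Fintype.card F ^ T + polyTotient (polyPrimorial F w) *
          {h ∈ polysLT F N | polyPrimorial F w * h + b ∈ A ∧
            T ≤ (polyPrimorial F w * h + b).natDegree}.card := by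
  have hpos := polyTotient_polyPrimorial_pos (F := F) w
  have hWm := polyPrimorial_monic (F := F) w
  set W := polyPrimorial F w
  set B := {g ∈ polysLT F W.natDegree | IsCoprime g W}
  have hBcard : B.card = polyTotient W := by
    rw [polyTotient_eq_card hWm.ne_zero]
  set S := {f ∈ polysLT F (N + W.natDegree) | f ∈ A ∧ T ≤ f.natDegree} with hS
  have hmaps : ∀ f ∈ S, f %ₘ W ∈ B := fun f hf => by
    obtain ⟨-, hfA, hfT⟩ := Finset.mem_filter.1 hf
    refine Finset.mem_filter.2 ⟨mem_polysLT.2 ?_, ?_⟩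
    · rw [← degree_eq_natDegree hWm.ne_zero]
      exact degree_modByMonic_lt f hWm
    · rw [modByMonic_eq_sub_mul_div, sub_eq_add_neg, ← mul_neg]
      exact (isCoprime_polyPrimorial_of_irreducible (hA hfA) (hT.trans hfT)).add_mul_left_left _
  obtain ⟨b, hbB, hb⟩ : ∃ b ∈ B, S.card ≤ B.card * {f ∈ S | f %ₘ W = b}.card :=
    Finset.exists_le_of_sum_le (Finset.card_pos.1 (hBcard ▸ hpos)) <| by
      rw [← Finset.mul_sum, ← Finset.card_eq_sum_card_fiberwise hmaps, Finset.sum_const,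
        smul_eq_mul]
  obtain ⟨hbdeg, hbW⟩ := Finset.mem_filter.1 hbB
  rw [mem_polysLT, ← degree_eq_natDegree hWm.ne_zero] at hbdeg
  refine ⟨b, hbdeg, hbW, (ncard_degree_lt_le_pow_add A _ T).trans (Nat.add_le_add_left ?_ _)⟩
  rw [hBcard, hS, Finset.filter_filter] at hb
  refine hb.trans (Nat.mul_le_mul_left _ ?_)
  convert card_filter_modByMonic_eq_le hWm N (fun f => f ∈ A ∧ T ≤ f.natDegree) b

end Residues

section Majorant

variable {F : Type*} [Field F] [Fintype F]

theorem divisorSum_of_irreducible (χ : ℝ → ℝ) {R : ℝ} (hR : 0 < R) {f : F[X]} (hf : Irreducible f)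
    (h : R ≤ f.natDegree) : divisorSum χ R f = χ 0 := by
  classical
  have hdivisors :
      {d ∈ polysLT F ⌈R⌉₊ | d.Monic ∧ d ∣ f ∧ (d.natDegree : ℝ) < R} = {1} := by
    ext d
    rw [Finset.mem_filter, Finset.mem_singleton]
    constructor
    · rintro ⟨-, hm, hd, hlt⟩
      rcases hf.dvd_iff.1 hd with hu | ha
      · exact hm.eq_one_of_isUnit hu
      · rw [natDegree_eq_of_degree_eq (degree_eq_degree_of_associated ha)] at h
        exact absurd hlt h.not_gt
    · rintro rfl
      refine ⟨mem_polysLT.2 ?_, monic_one, one_dvd _, by rwa [natDegree_one, Nat.cast_zero]⟩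
      rw [degree_one]
      exact_mod_cast Nat.ceil_pos.2 hR
  rw [divisorSum]
  exact (Finset.sum_congr (by convert hdivisors) fun _ _ => rfl).trans (by simp)

theorem sieveWeight_nonneg (χ : ℝ → ℝ) {R : ℝ} (hR : 0 ≤ R) (w : ℕ) (b h : F[X]) :
    0 ≤ sieveWeight χ R (polyPrimorial F w) b h :=
  mul_nonneg (mul_nonneg hR (totientRatio_pos w).le) (sq_nonneg _)

/-- The value of the sieve weight at the arguments that give primes of degree at least `R`. -/
noncomputable def primeWeight (F : Type*) [Field F] [Fintype F] (χ : ℝ → ℝ) (R : ℝ) (w : ℕ) : ℝ :=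
  R * ((polyTotient (polyPrimorial F w) : ℝ) / polyNorm (polyPrimorial F w)) * χ 0 ^ 2

theorem primeWeight_nonneg (χ : ℝ → ℝ) {R : ℝ} (hR : 0 ≤ R) (w : ℕ) : 0 ≤ primeWeight F χ R w :=
  mul_nonneg (mul_nonneg hR (totientRatio_pos w).le) (sq_nonneg _)

theorem primeWeight_le (χ : ℝ → ℝ) {R : ℝ} (hR : 0 ≤ R) (w : ℕ) :
    primeWeight F χ R w ≤ R * χ 0 ^ 2 := by
  rw [primeWeight, mul_right_comm]
  exact mul_le_of_le_one_right (by positivity) (totientRatio_le_one w)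

theorem sieveWeight_eq_primeWeight (χ : ℝ → ℝ) {R : ℝ} (hR : 0 < R) {w : ℕ} {b h : F[X]}
    (hirr : Irreducible (polyPrimorial F w * h + b))
    (hdeg : R ≤ (polyPrimorial F w * h + b).natDegree) :
    sieveWeight χ R (polyPrimorial F w) b h = primeWeight F χ R w := by
  rw [sieveWeight, divisorSum_of_irreducible χ hR hirr hdeg, primeWeight]

theorem mul_sub_div_pow_le_primeWeight_mul (χ : ℝ → ℝ) {R : ℝ} (hR : 0 ≤ R) {w N : ℕ} {a t c : ℝ}
    (h : a ≤ t + polyTotient (polyPrimorial F w) * c) :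
    R * χ 0 ^ 2 * ((a - t) / (Fintype.card F : ℝ) ^ (N + (polyPrimorial F w).natDegree)) ≤
      primeWeight F χ R w * (c / (Fintype.card F : ℝ) ^ N) := by
  have : (0 : ℝ) < Fintype.card F := Nat.cast_pos.2 Fintype.card_pos
  calc _ ≤ R * χ 0 ^ 2 * (polyTotient (polyPrimorial F w) * c /
        (Fintype.card F : ℝ) ^ (N + (polyPrimorial F w).natDegree)) := by
        gcongr
        linarith
    _ = _ := by
        rw [primeWeight, polyNorm_polyPrimorial, pow_add]
        field_simp

/-- A function `φ` with `0 ≤ φ ≤ ν` that is supported on the `h` with `W * h + b ∈ A`, has mean at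
least `δ`, and is bounded by `B`. -/
def FieldChoice.HasDenseMinorant (M : FieldChoice F) (A : Set F[X]) (W b : F[X]) {N : ℕ+}
    (ν : M.FqN N → ℝ) (δ B : ℝ) : Prop :=
  ∃ φ : M.FqN N → ℝ, (∀ x, W * M.rep N x + b ∉ A → φ x = 0) ∧ (∀ x, 0 ≤ φ x ∧ φ x ≤ ν x) ∧
    δ ≤ 𝔼 x, φ x ∧ ∀ x, |φ x| ≤ B

theorem FieldChoice.HasDenseMinorant.anti_left {M : FieldChoice F} {A : Set F[X]} {W b : F[X]}
    {N : ℕ+} {ν : M.FqN N → ℝ} {δ δ' B : ℝ} (h : M.HasDenseMinorant A W b ν δ B) (hδ : δ' ≤ δ) :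
    M.HasDenseMinorant A W b ν δ' B :=
  h.imp fun _ ⟨hsupp, hle, hmean, hbdd⟩ => ⟨hsupp, hle, hδ.trans hmean, hbdd⟩

theorem FieldChoice.exists_hasDenseMinorant_sieveWeight (M : FieldChoice F) (χ : ℝ → ℝ)
    {A : Set F[X]} (hA : A ⊆ irreducibles F) {w T : ℕ} (hT : w ≤ T) (N : ℕ+) {R : ℝ} (hR : 0 < R)
    (hRT : R ≤ T) :
    ∃ b : F[X], b.degree < (polyPrimorial F w).degree ∧ IsCoprime b (polyPrimorial F w) ∧
      M.HasDenseMinorant A (polyPrimorial F w) b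
        (fun x => sieveWeight χ R (polyPrimorial F w) b (M.rep N x))
        (R * χ 0 ^ 2 * (({f ∈ A | f.degree <
          ((N + (polyPrimorial F w).natDegree : ℕ) : WithBot ℕ)}.ncard -
            (Fintype.card F : ℝ) ^ T) /
              (Fintype.card F : ℝ) ^ (N + (polyPrimorial F w).natDegree : ℕ)))
        (R * χ 0 ^ 2) := by
  classical
  obtain ⟨b, hbdeg, hbW, hcard⟩ := exists_residue_card_le hA hT N
  replace hcard := (Nat.cast_le (α := ℝ)).2 hcard
  push_cast at hcard
  have hs := primeWeight_nonneg (F := F) χ hR.le w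
  have hsle := primeWeight_le (F := F) χ hR.le w
  refine ⟨b, hbdeg, hbW, fun x => if polyPrimorial F w * M.rep N x + b ∈ A ∧
    T ≤ (polyPrimorial F w * M.rep N x + b).natDegree then primeWeight F χ R w else 0,
    fun x hx => if_neg fun h => hx h.1, fun x => ?_, ?_, fun x => ?_⟩
  · dsimp only
    split_ifs with h
    · exact ⟨hs, (sieveWeight_eq_primeWeight χ hR (hA h.1)
        (hRT.trans (Nat.cast_le.2 h.2))).ge⟩
    · exact ⟨le_rfl, sieveWeight_nonneg χ hR.le w b _⟩
  · refine (mul_sub_div_pow_le_primeWeight_mul χ hR.le hcard).trans_eq ?_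
    rw [M.expect_rep N fun h => if polyPrimorial F w * h + b ∈ A ∧
      T ≤ (polyPrimorial F w * h + b).natDegree then primeWeight F χ R w else 0,
      ← Finset.sum_filter, Finset.sum_const, nsmul_eq_mul, mul_comm _ (primeWeight F χ R w),
      mul_div_assoc]
  · dsimp only
    split_ifs
    · rwa [abs_of_nonneg hs]
    · rw [abs_zero]
      positivity

end Majorant

section Diagonal

theorem exists_slow_growth {P : ℕ → ℕ → Prop} (hP : ∀ j, ∀ᶠ N in atTop, P j N) {G : ℕ → Prop}
    (hG : ∃ᶠ N in atTop, G N) (D : ℕ → ℕ) :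
    ∃ w : ℕ → ℕ, Tendsto w atTop atTop ∧ (∀ N, w N = 0 ∨ P (w N) N) ∧
      ∃ᶠ N in atTop, G (N + D (w N)) := by
  have hstep (j x : ℕ) : ∃ g n : ℕ, x ≤ g ∧ G (g + D j) ∧ g < n ∧ ∀ N, n ≤ N → P (j + 1) N := by
    obtain ⟨y, hy, hGy⟩ := frequently_atTop.1 hG (x + D j)
    obtain ⟨n, hn⟩ := eventually_atTop.1 (hP (j + 1))
    refine ⟨y - D j, max n (y - D j + 1), by omega, ?_, by omega, fun N hN => hn N (by omega)⟩
    rwa [Nat.sub_add_cancel (by omega)]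
  choose g n hxg hGg hgn hPn using hstep
  let s : ℕ → ℕ := fun j => Nat.rec 0 n j
  have hmono : StrictMono s :=
    strictMono_nat_of_lt_succ fun j => (hxg j (s j)).trans_lt (hgn j (s j))
  -- `w` takes the value `j` on `[s j, s (j + 1))`, an interval that contains `g j (s j)`
  have hbetween (N : ℕ) : ∃ j, s j < N + 1 ∧ N + 1 ≤ s (j + 1) :=
    hmono.exists_between_of_tendsto_atTop hmono.tendsto_atTop N.succ_pos
  choose w hsw hws using hbetween
  have hle {j N : ℕ} (h : s j ≤ N) : j ≤ w N :=
    Nat.lt_succ_iff.1 (hmono.lt_iff_lt.1 (h.trans_lt (hws N)))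
  refine ⟨w, tendsto_atTop.2 fun j => (eventually_ge_atTop (s j)).mono fun _ => hle, fun N => ?_,
    frequently_atTop.2 fun a => ⟨g a (s a), (hmono.id_le a).trans (hxg a _), ?_⟩⟩
  · rcases hwN : w N with _ | j
    · exact Or.inl rfl
    · have hsN := hsw N
      rw [hwN] at hsN
      exact Or.inr (hPn j (s j) N (Nat.lt_succ_iff.1 hsN))
  · have hwa : w (g a (s a)) ≤ a :=
      Nat.lt_succ_iff.1 (hmono.lt_iff_lt.1 ((hsw _).trans_le (hgn a (s a))))
    rw [hwa.antisymm (hle (hxg a (s a)))]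
    exact hGg a (s a)

theorem frequently_pnat_atTop {P : ℕ → Prop} (h : ∃ᶠ N in atTop, P N) :
    ∃ᶠ N : ℕ+ in atTop, P N :=
  frequently_atTop.2 fun a =>
    let ⟨N, hN, hPN⟩ := frequently_atTop.1 h a
    ⟨⟨N, a.pos.trans_le hN⟩, hN, hPN⟩

end Diagonal

section Assembly

variable {F : Type*} [Field F] [Fintype F]

/-- The measures `ν_N` at the level `R = α * N`, for the modulus `∏ P` over the monic irreducible
`P` of degree less than `w N` and the residue `b N`. -/
noncomputable def sieveMeasure (M : FieldChoice F) (χ : ℝ → ℝ) (α : ℝ) (w : ℕ+ → ℕ) (b : ℕ+ → F[X])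
    (N : ℕ+) (x : M.FqN N) : ℝ :=
  sieveWeight χ (α * (N : ℕ)) (polyPrimorial F (w N)) (b N) (M.rep N x)

/-- `N` is so large in terms of `w` that the box estimates with remainder `K` are effective at the
level `R = α * N` for the primorial of `w`. The constant `c` bounds the degrees that clearing the
denominators of a system of linear forms costs. -/
structure IsLargeFor (F : Type*) [Field F] [Fintype F] (α : ℝ) (c : ℕ) (K : ℕ → ℝ) (w N : ℕ) :
    Prop where
  one_le_level : 1 ≤ α * N
  two_mul_le : 2 * w ≤ N
  two_mul_cost_le : 2 * c ≤ N
  natDegree_lt : (polyPrimorial F w).natDegree < N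
  remainder_le : K w / (α * N) ≤ 1 / (w + 1)

theorem eventually_isLargeFor {α : ℝ} (hα : 0 < α) (c : ℕ) (K : ℕ → ℝ) (w : ℕ) :
    ∀ᶠ N : ℕ in atTop, IsLargeFor F α c K w N := by
  have hlevel : Tendsto (fun N : ℕ => α * (N : ℝ)) atTop atTop :=
    tendsto_natCast_atTop_atTop.const_mul_atTop hα
  filter_upwards [hlevel.eventually_ge_atTop 1, eventually_ge_atTop (2 * w),
    eventually_ge_atTop (2 * c), eventually_gt_atTop (polyPrimorial F w).natDegree,
    (hlevel.const_div_atTop (K w)).eventually_le_const (by positivity : (0 : ℝ) < 1 / (w + 1))]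
    with N h₁ h₂ h₃ h₄ h₅ using ⟨h₁, h₂, h₃, h₄, h₅⟩

theorem degree_polyPrimorial_lt {α : ℝ} {c : ℕ} {K : ℕ → ℝ} {w : ℕ} {N : ℕ+}
    (h : w = 0 ∨ IsLargeFor F α c K w N) : (polyPrimorial F w).degree < (N : ℕ) := by
  rw [degree_eq_natDegree (polyPrimorial_monic w).ne_zero, Nat.cast_lt]
  rcases h with rfl | h
  · rw [polyPrimorial_eq, MonicIrr.natDegree_prod, Finset.sum_eq_zero]
    · exact N.pos
    · exact fun P hP => absurd (mem_primesLT.1 hP) (Nat.not_lt_zero _)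
  · exact h.natDegree_lt

theorem tendsto_sieveError (A : ℝ) :
    Tendsto (fun j : ℕ => sieveError A (1 / ((j : ℝ) + 1)) (2 * (1 / 2) ^ j)) atTop (𝓝 0) := by
  have hL : Tendsto (fun j : ℕ => A * (2 * (1 / 2 : ℝ) ^ j)) atTop (𝓝 (A * (2 * 0))) :=
    ((tendsto_pow_atTop_nhds_zero_of_lt_one (by norm_num) (by norm_num)).const_mul 2).const_mul A
  have hexp := (Real.continuous_exp.tendsto _).comp hL
  simp only [sieveError]
  simpa using ((hexp.sub_const 1).const_mul A).add
    (hexp.mul tendsto_one_div_add_atTop_nhds_zero_nat)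

theorem two_mul_level_le {α : ℝ} (hα : 0 ≤ α) {m m₀ : ℕ} (hm : m ≤ m₀) (hαm : 4 * m₀ * α ≤ 1)
    (N : ℕ) : 2 * m * (α * N) ≤ N / 2 := by
  have hm' : (m : ℝ) ≤ m₀ := Nat.cast_le.2 hm
  calc 2 * m * (α * N) ≤ 2 * m₀ * (α * N) := by gcongr
    _ = 4 * m₀ * α * (N / 2) := by ring
    _ ≤ N / 2 := mul_le_of_le_one_left (by positivity) hαm

theorem linearFormsCondition_sieveMeasure (M : FieldChoice F) {χ : ℝ → ℝ} {A : ℝ} {K : ℕ → ℝ}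
    {m₀ n₀ k₀ : ℕ} (hbox : ∀ m ≤ m₀, BoxEstimate F χ m A K) {α : ℝ} (hα : 0 ≤ α)
    (hα₁ : α ≤ 1) (hαm : 4 * m₀ * α ≤ 1) {w : ℕ+ → ℕ} (hw : Tendsto w atTop atTop)
    (hlarge : ∀ N, w N = 0 ∨ IsLargeFor F α (m₀ * n₀ * k₀) K (w N) N) {b : ℕ+ → F[X]}
    (hb : ∀ N, IsCoprime (b N) (polyPrimorial F (w N))) :
    LinearFormsCondition M m₀ n₀ k₀ (sieveMeasure M χ α w b) := by
  intro ε hε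
  obtain ⟨N₀, hN₀⟩ := eventually_atTop.1
    ((((tendsto_sieveError A).comp hw).eventually_le_const hε).and
      (hw.eventually_gt_atTop (2 * (m₀ * n₀ * k₀))))
  refine ⟨N₀, fun N hN m n hm hn L hL hL0 hprop d => ?_⟩
  obtain ⟨herr, hwlarge⟩ := hN₀ N hN
  have h := (hlarge N).resolve_left (pos_of_gt hwlarge).ne'
  have hcost : m * n * k₀ ≤ m₀ * n₀ * k₀ := by gcongr
  have hwcost : 2 * (m * n * k₀) < w N := (Nat.mul_le_mul_left 2 hcost).trans_lt hwlarge
  have hcost' : (m * n * k₀ : ℝ) ≤ ((N : ℕ) : ℝ) / 2 := by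
    rw [le_div_iff₀' two_pos]
    exact_mod_cast (Nat.mul_le_mul_left 2 hcost).trans h.two_mul_cost_le
  have hlevel := two_mul_level_le hα hm hαm N
  calc _ ≤ sieveError A (K (w N) / (α * (N : ℕ))) (2 * (1 / 2) ^ w N) :=
        (hbox m hm).abs_expect_linearForms_sub_one_le h.one_le_level
          (mul_le_of_le_one_left (Nat.cast_nonneg _) hα₁) (by linarith [h.two_mul_le]) hwcost
          (by linarith) (hb N) hL hL0 hprop d
    _ ≤ sieveError A (1 / ((w N : ℝ) + 1)) (2 * (1 / 2) ^ w N) := by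
        have hrem := h.remainder_le
        unfold sieveError
        gcongr
    _ ≤ ε := herr

theorem correlationCondition_sieveMeasure (M : FieldChoice F) {χ : ℝ → ℝ} {A : ℝ} {K : ℕ → ℝ}
    (hA : 0 ≤ A) {l₀ : ℕ} (hbox : ∀ l ≤ l₀, BoxEstimate F χ l A K) {α : ℝ} (hα : 0 ≤ α)
    (hα₁ : α ≤ 1) (hαl : 4 * l₀ * α ≤ 1) {c : ℕ} {w : ℕ+ → ℕ} (hw : Tendsto w atTop atTop)
    (hlarge : ∀ N, w N = 0 ∨ IsLargeFor F α c K (w N) N) {b : ℕ+ → F[X]}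
    (hb : ∀ N, IsCoprime (b N) (polyPrimorial F (w N))) :
    CorrelationCondition M l₀ (sieveMeasure M χ α w b) := by
  obtain ⟨N₀, hN₀⟩ := eventually_atTop.1 (hw.eventually_gt_atTop 0)
  refine correlationCondition_of_eventually M (D := Real.exp (A * 2) * (1 + A + 1)) (N₀ := N₀)
    (fun N x => sieveWeight_nonneg χ (by positivity) _ _ _) (by positivity) hA
    fun N hN l hl g => ?_
  have h := (hlarge N).resolve_left (hN₀ N hN).ne'
  have hrem : K (w N) / (α * (N : ℕ)) ≤ 1 :=
    h.remainder_le.trans (div_le_one_of_le₀ (by linarith [Nat.cast_nonneg (α := ℝ) (w N)])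
      (by positivity))
  refine ((hbox l hl).expect_correlation_le hA h.one_le_level
    (mul_le_of_le_one_left (Nat.cast_nonneg _) hα₁) (by linarith [h.two_mul_le])
    (by linarith [two_mul_level_le hα hl hαl N, Nat.cast_nonneg (α := ℝ) (N : ℕ)])
    (hb N) g).trans ?_
  rw [mul_add A, Real.exp_add, mul_right_comm]
  gcongr

theorem isPseudorandom_sieveMeasure (M : FieldChoice F) {χ : ℝ → ℝ} {A : ℝ} {K : ℕ → ℝ}
    (hA : 0 ≤ A) {k m₀ : ℕ} (hm₀ : m₀ = Fintype.card F ^ k * 2 ^ (Fintype.card F ^ k - 1))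
    (hbox : ∀ m ≤ m₀, BoxEstimate F χ m A K) {α : ℝ} (hα : 0 ≤ α)
    (hα₁ : α ≤ 1) (hαm : 4 * m₀ * α ≤ 1) {w : ℕ+ → ℕ} (hw : Tendsto w atTop atTop)
    (hlarge : ∀ N, w N = 0 ∨
      IsLargeFor F α (m₀ * (3 * Fintype.card F ^ k - 4) * k) K (w N) N) {b : ℕ+ → F[X]}
    (hb : ∀ N, IsCoprime (b N) (polyPrimorial F (w N))) :
    IsPseudorandom M k (sieveMeasure M χ α w b) := by
  have hl : 2 ^ (Fintype.card F ^ k - 1) ≤ m₀ :=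
    hm₀ ▸ Nat.le_mul_of_pos_left _ (pow_pos Fintype.card_pos k)
  have hαl : 4 * ((2 ^ (Fintype.card F ^ k - 1) : ℕ) : ℝ) * α ≤ 1 := le_trans (by gcongr) hαm
  refine ⟨fun N x => sieveWeight_nonneg χ (by positivity) _ _ _, ?_,
    correlationCondition_sieveMeasure M hA (fun l h => hbox l (h.trans hl)) hα hα₁ hαl hw hlarge hb⟩
  rw [← hm₀]
  exact linearFormsCondition_sieveMeasure M hbox hα hα₁ hαm hw hlarge hb

theorem FieldChoice.exists_hasDenseMinorant_of_isLargeFor (M : FieldChoice F) (χ : ℝ → ℝ)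
    {A : Set F[X]} (hA : A ⊆ irreducibles F) {α ε : ℝ} (hα : 0 < α) (hα₄ : α ≤ 1 / 4) (hε : 0 ≤ ε)
    {c : ℕ} {K : ℕ → ℝ} {w : ℕ} {N : ℕ+} (h : IsLargeFor F α c K w N) :
    ∃ b : F[X], b.degree < (polyPrimorial F w).degree ∧ IsCoprime b (polyPrimorial F w) ∧
      (IsDenseAt A ε (N + (polyPrimorial F w).natDegree) →
        M.HasDenseMinorant A (polyPrimorial F w) b
          (fun x => sieveWeight χ (α * (N : ℕ)) (polyPrimorial F w) b (M.rep N x))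
          (α * χ 0 ^ 2 * (ε / (8 * Fintype.card F))) (α * χ 0 ^ 2 * (N : ℕ))) := by
  have : (0 : ℝ) < Fintype.card F := Nat.cast_pos.2 Fintype.card_pos
  have : (0 : ℝ) < (N : ℕ) := Nat.cast_pos.2 N.pos
  have hN₄ : 4 ≤ (N : ℕ) := by
    have : (4 : ℝ) ≤ (N : ℕ) := by nlinarith [h.one_le_level]
    exact_mod_cast this
  have hdeg := h.natDegree_lt
  have hw := h.two_mul_le
  obtain ⟨E, hE⟩ : ∃ E, E = N + (polyPrimorial F w).natDegree := ⟨_, rfl⟩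
  have hE₀ : (0 : ℝ) < E := Nat.cast_pos.2 (by omega)
  have hE₂ : (E : ℝ) ≤ 2 * (N : ℕ) := by exact_mod_cast (by omega : E ≤ 2 * N)
  have hRT : α * (N : ℕ) ≤ (E / 2 : ℕ) := by
    have : ((N : ℕ) : ℝ) ≤ 4 * (E / 2 : ℕ) := by exact_mod_cast (by omega : (N : ℕ) ≤ 4 * (E / 2))
    nlinarith
  obtain ⟨b, hb, hbW, hφ⟩ := M.exists_hasDenseMinorant_sieveWeight χ hA
    (by omega : w ≤ E / 2) N (by positivity : 0 < α * (N : ℕ)) hRT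
  rw [← hE, mul_right_comm α] at hφ
  rw [← hE]
  refine ⟨b, hb, hbW, fun hdense => hφ.anti_left ?_⟩
  rw [IsDenseAt, ← le_sub_iff_add_le', ← le_div_iff₀ (by positivity)] at hdense
  calc α * χ 0 ^ 2 * (ε / (8 * Fintype.card F))
      = α * χ 0 ^ 2 * (N : ℕ) * (ε / (4 * Fintype.card F * (2 * (N : ℕ)))) := by
        field_simp
        ring
    _ ≤ α * χ 0 ^ 2 * (N : ℕ) * (ε / (4 * Fintype.card F * E)) := by gcongr
    _ ≤ _ := by gcongr

theorem FieldChoice.exists_residue_hasDenseMinorant (M : FieldChoice F) (χ : ℝ → ℝ)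
    {A : Set F[X]} (hA : A ⊆ irreducibles F) {α ε : ℝ} (hα : 0 < α) (hα₄ : α ≤ 1 / 4) (hε : 0 ≤ ε)
    {c : ℕ} {K : ℕ → ℝ} {w : ℕ} {N : ℕ+} (h : w = 0 ∨ IsLargeFor F α c K w N) :
    ∃ b : F[X], b.degree < (polyPrimorial F w).degree ∧ IsCoprime b (polyPrimorial F w) ∧
      (w ≠ 0 → IsDenseAt A ε (N + (polyPrimorial F w).natDegree) →
        M.HasDenseMinorant A (polyPrimorial F w) b
          (fun x => sieveWeight χ (α * (N : ℕ)) (polyPrimorial F w) b (M.rep N x))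
          (α * χ 0 ^ 2 * (ε / (8 * Fintype.card F))) (α * χ 0 ^ 2 * (N : ℕ))) := by
  rcases h with rfl | h
  · obtain ⟨b, hb, hbW, -⟩ := exists_residue_card_le hA le_rfl N
    exact ⟨b, hb, hbW, fun h => absurd rfl h⟩
  · obtain ⟨b, hb, hbW, hφ⟩ := M.exists_hasDenseMinorant_of_isLargeFor χ hA hα hα₄ hε h
    exact ⟨b, hb, hbW, fun _ => hφ⟩

end Assembly

end FunctionFieldGT

theorem theorem2p3 {F : Type*} [Field F] [Fintype F] (k : ℕ) (hk : 0 < k) :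
    ∃ (α : ℝ) (χ : ℝ → ℝ) (C : ℝ), 0 < α ∧ FunctionFieldGT.IsCutoff χ ∧
      ∀ ε : ℝ, 0 < ε → ∃ δ : ℝ, 0 < δ ∧
        ∀ (M : FunctionFieldGT.FieldChoice F) (A : Set F[X]),
          A ⊆ FunctionFieldGT.irreducibles F → ε ≤ FunctionFieldGT.relUpperDensity A →
          ∃ (w : ℕ+ → ℕ) (W b : ℕ+ → F[X]) (ν : ∀ N : ℕ+, M.FqN N → ℝ),
            Tendsto w atTop atTop ∧
            (∀ N : ℕ+, W N = FunctionFieldGT.polyPrimorial F (w N)) ∧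
            (∀ N : ℕ+, (W N).degree < (N : ℕ) ∧ (b N).degree < (W N).degree ∧
              IsCoprime (b N) (W N)) ∧
            (∀ (N : ℕ+) (x : M.FqN N), ν N x =
              FunctionFieldGT.sieveWeight χ (α * (N : ℕ)) (W N) (b N) (M.rep N x)) ∧
            FunctionFieldGT.IsPseudorandom M k ν ∧
            ∃ᶠ N : ℕ+ in atTop, ∃ φ : M.FqN N → ℝ,
              (∀ x, W N * M.rep N x + b N ∉ A → φ x = 0) ∧
              (∀ x, 0 ≤ φ x ∧ φ x ≤ ν N x) ∧
              δ ≤ 𝔼 x, φ x ∧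
              ∀ x, |φ x| ≤ C * (N : ℕ) := by
  open FunctionFieldGT in
  obtain ⟨χ, hχ⟩ := exists_isCutoff
  have hχ₀ := hχ.pos
  obtain ⟨m₀, hm₀⟩ : ∃ m₀, m₀ = Fintype.card F ^ k * 2 ^ (Fintype.card F ^ k - 1) := ⟨_, rfl⟩
  have hm₁ : 1 ≤ (m₀ : ℝ) := by
    exact_mod_cast hm₀ ▸ Nat.mul_pos (pow_pos Fintype.card_pos k) (by positivity)
  obtain ⟨B, K, hB, -, hbox⟩ := exists_forall_le_boxEstimate F hχ m₀
  obtain ⟨α, hα, hα₄, hαm⟩ : ∃ α : ℝ, 0 < α ∧ α ≤ 1 / 4 ∧ 4 * m₀ * α ≤ 1 :=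
    ⟨1 / (4 * m₀), by positivity, one_div_le_one_div_of_le four_pos (by linarith),
      (mul_one_div_cancel (by positivity)).le⟩
  refine ⟨α, χ, α * χ 0 ^ 2, hα, hχ, fun ε hε =>
    ⟨α * χ 0 ^ 2 * (ε / (8 * Fintype.card F)), by positivity, fun M A hA hAε => ?_⟩⟩
  obtain ⟨w, hw, hlarge, hdense⟩ := exists_slow_growth
    (eventually_isLargeFor (F := F) hα (m₀ * (3 * Fintype.card F ^ k - 4) * k) K)
    (M.frequently_isDenseAt hε hAε) fun j => (polyPrimorial F j).natDegree
  replace hw := hw.comp tendsto_PNat_val_atTop_atTop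
  choose b hbdeg hbW hφ using fun N : ℕ+ =>
    M.exists_residue_hasDenseMinorant χ hA hα hα₄ hε.le (hlarge N)
  exact ⟨fun N => w N, fun N => polyPrimorial F (w N), b, sieveMeasure M χ α (fun N => w N) b, hw,
    fun _ => rfl, fun N => ⟨degree_polyPrimorial_lt (hlarge N), hbdeg N, hbW N⟩, fun _ _ => rfl,
    isPseudorandom_sieveMeasure M hB hm₀ hbox hα.le (by linarith) hαm hw (fun N => hlarge N) hbW,
    ((frequently_pnat_atTop hdense).and_eventually (hw.eventually_ne_atTop 0)).mono
      fun N ⟨hN, hwN⟩ => hφ N hwN hN⟩
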